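/- **Setting.** Let $\Sigma$ be a fan in $\mathbb R^2\times\mathbb R$ (with respect to the lattice $\mathbb Z^2\oplus\mathbb Z$) all of whose cones lie in the half space $\{(m,r) : r\ge 0\}$, let $X=X_\Sigma$ be its toric variety over $\mathbb C$ and $X\to\mathbb A^1=\operatorname{Spec}\mathbb C[t]$ the toric morphism $t=z^{(0,0,1)}$ given by the projection to the last coordinate, with central fibre $X_0$. Let $\mathcal P$ be the set of non-empty closed $\tau\subseteq\mathbb R^2$ for which the closure $\overline{\operatorname{Cone}(\tau)}$ of $\{(rm,r) : m\in\tau,\ r\ge 0\}$ is a cone of $\Sigma$. For $\tau\in\mathcal P$ let $D_\tau\subseteq X_0$ be the closure of the torus orbit of $\overline{\operatorname{Cone}(\tau)}$. The variety $X$ carries the divisorial log structure of its toric boundary, $X_0^\dagger$ is $X_0$ with the pulled-back log structure, and $\operatorname{Spec}\mathbb C^\dagger$ is the standard log point (monoid $\mathbb N\oplus\mathbb C^\times$); $t$ gives $X_0^\dagger\to\operatorname{Spec}\mathbb C^\dagger$. Log structures are taken in the étale topology. A *log curve* is a fine saturated log scheme $C^\dagger$ with a log smooth morphism to $\operatorname{Spec}\mathbb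 C^\dagger$ whose underlying scheme $C$ is reduced and purely one-dimensional. Here log smooth means: étale locally on $C$ there are a chart of the log structure by a finitely generated cancellative commutative monoid $P$ and an injective homomorphism $\mathbb N\to P$, $1\mapsto p_0$, compatible with the morphism to the log point, such that the induced morphism from $C$ to $\operatorname{Spec}\mathbb C[P]/(z^{p_0})$ is smooth. A morphism $g:C^\dagger\to X_0^\dagger$ of log schemes over $\operatorname{Spec}\mathbb C^\dagger$ is *torically transverse* if $g(C)$ meets no zero-dimensional toric stratum and no irreducible component of $C$ is mapped into a one-dimensional toric stratum. **Statement.** Let $v_1\ne v_2$ be points of $\mathbb Z^2$ such that the segment $E=[v_1,v_2]$ belongs to $\mathcal P$, and let $l$ be its integral length, i.e. the greatest common divisor of the coordinates of $v_2-v_1$. Let $g:C^\dagger\to X_0^\dagger$ be a torically transverse log curve as above, let $C_1,C_2$ be irreducible components of $C$ with $g(C_1)\subseteq D_{v_1}$ and $g(C_2)\subseteq D_{v_2}$, and let $p\in C_1\cap C_2$ be a $\mathbb C$-rational point with $g(p)\in D_E$. Then there are positive integers $w$ and $e$ such that: 1. the intersection multiplicities of $g|_{C_1}$ and of $g|_{C_2}$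 with $D_E$ at $p$ are both equal to $w$, where the multiplicity of $g|_{C_i}$ is the length at $p$ of the scheme-theoretic preimage of $D_E$ in $C_i$ ($D_E$ and $C_i$ with their reduced structures); 2. $e$ is the unique natural number for which there is an isomorphism from the stalk $\overline{\mathcal M}_{C,p}$ of the ghost sheaf (log structure modulo units) to $S_e=\langle x,y,z\mid xy=z^e\rangle$ that maps the image of the generator of the monoid $\mathbb N$ of the log point to $z$; 3. $w\,e=l$. -/

import Mathlib

open CategoryTheory AlgebraicGeometry Opposite

noncomputable section

namespace LogTrop

theorem mem_basicOpen_appTop {Y Z : Scheme.{0}} (φ : Y ⟶ Z) (s : Γ(Z, ⊤)) (y : Y) :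
    y ∈ Y.basicOpen (φ.appTop.hom s) ↔ φ y ∈ Z.basicOpen s := by
  change _ ↔ y ∈ φ ⁻¹ᵁ Z.basicOpen s
  rw [Scheme.preimage_basicOpen]
  rfl


/-! ### Toric degenerations -/

/-- A (finite) fan in `ℝⁿ` with respect to the lattice `ℤⁿ`: a finite collection of strongly convex
rational polyhedral cones, closed under taking faces, any two of which meet in a common face.
The dual lattice is identified with `ℤⁿ` by the standard pairing. -/
structure Fan (n : ℕ) where
  cones : Set (Set (Fin n → ℝ))
  finite : cones.Finite
  polyhedral : ∀ σ ∈ cones, ∃ s : Finset (Fin n → ℤ),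
    σ = {x | ∃ c : (Fin n → ℤ) → ℝ, (∀ v, 0 ≤ c v) ∧ x = ∑ v ∈ s, c v • fun i => (v i : ℝ)}
  pointed : ∀ σ ∈ cones, ∀ x ∈ σ, -x ∈ σ → x = 0
  zero_mem : {0} ∈ cones
  face_mem : ∀ σ ∈ cones, ∀ m : Fin n → ℤ, (∀ x ∈ σ, 0 ≤ ∑ i, (m i : ℝ) * x i) →
    {x ∈ σ | ∑ i, (m i : ℝ) * x i = 0} ∈ cones
  inter_face : ∀ σ ∈ cones, ∀ τ ∈ cones, ∃ m : Fin n → ℤ,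
    (∀ x ∈ σ, 0 ≤ ∑ i, (m i : ℝ) * x i) ∧ σ ∩ τ = {x ∈ σ | ∑ i, (m i : ℝ) * x i = 0}

/-- The monoid of integral linear forms which are nonnegative on `σ`. -/
def dualMonoid {n : ℕ} (σ : Set (Fin n → ℝ)) : AddSubmonoid (Fin n → ℤ) where
  carrier := {m | ∀ x ∈ σ, 0 ≤ ∑ i, (m i : ℝ) * x i}
  zero_mem' := by simp
  add_mem' := by
    intro a b ha hb x hx
    have := add_nonneg (ha x hx) (hb x hx)
    rw [← Finset.sum_add_distrib] at this
    simpa [add_mul] using this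

theorem dualMonoid_anti {n : ℕ} {σ τ : Set (Fin n → ℝ)} (h : σ ⊆ τ) :
    dualMonoid τ ≤ dualMonoid σ := fun _ hm x hx => hm x (h hx)

/-- The monoid algebra `ℂ[σ^∨ ∩ ℤⁿ]`. -/
abbrev coneRing {n : ℕ} (σ : Set (Fin n → ℝ)) : Type := AddMonoidAlgebra ℂ (dualMonoid σ)

/-- The monomial `z^m`. -/
def zmon {n : ℕ} {σ : Set (Fin n → ℝ)} (m : dualMonoid σ) : coneRing σ :=
  AddMonoidAlgebra.single m 1

/-- The inclusion `ℂ[τ^∨ ∩ ℤⁿ] → ℂ[σ^∨ ∩ ℤⁿ]` for `σ ⊆ τ`. -/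
def coneRingMap {n : ℕ} {σ τ : Set (Fin n → ℝ)} (h : σ ⊆ τ) : coneRing τ →+* coneRing σ :=
  AddMonoidAlgebra.mapDomainRingHom ℂ (AddSubmonoid.inclusion (dualMonoid_anti h))

theorem coneRingMap_single {n : ℕ} {σ τ : Set (Fin n → ℝ)} (h : σ ⊆ τ) (m : dualMonoid τ) (c : ℂ) :
    coneRingMap h (AddMonoidAlgebra.single m c) =
      AddMonoidAlgebra.single (AddSubmonoid.inclusion (dualMonoid_anti h) m) c := by
  simp [coneRingMap]

namespace Fan
variable {n : ℕ} (F : Fan n)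

theorem exists_add_mem {σ : Set (Fin n → ℝ)} (hσ : σ ∈ F.cones) {m : Fin n → ℤ}
    (hm : m ∈ dualMonoid σ) {u : Fin n → ℤ}
    (hu : u ∈ dualMonoid {x ∈ σ | ∑ i, (m i : ℝ) * x i = 0}) :
    ∃ N : ℕ, ∀ k : ℕ, N ≤ k → u + k • m ∈ dualMonoid σ := by
  classical
  obtain ⟨s, hs⟩ := F.polyhedral σ hσ
  let p : (Fin n → ℤ) → (Fin n → ℤ) → ℝ := fun a v => ∑ i, (a i : ℝ) * (v i : ℝ)
  have hmem : ∀ v ∈ s, (fun i => (v i : ℝ)) ∈ σ := by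
    intro v hv
    rw [hs]
    refine ⟨fun w => if w = v then 1 else 0, fun w => by dsimp only; split_ifs <;> norm_num, ?_⟩
    simp [Finset.sum_ite_eq', hv, ite_smul]
  have key : ∀ v ∈ s, ∃ N : ℕ, ∀ k : ℕ, N ≤ k → 0 ≤ p u v + k * p m v := by
    intro v hv
    have h0 : 0 ≤ p m v := hm _ (hmem v hv)
    rcases h0.eq_or_lt with h | h
    · refine ⟨0, fun k _ => ?_⟩
      have : 0 ≤ p u v := hu _ ⟨hmem v hv, h.symm⟩
      rw [← h]; simpa using this
    · obtain ⟨N, hN⟩ := exists_nat_gt (-(p u v) / p m v)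
      refine ⟨N, fun k hk => ?_⟩
      rw [div_lt_iff₀ h] at hN
      have : (N : ℝ) ≤ k := by exact_mod_cast hk
      nlinarith
  choose! N hN using key
  refine ⟨s.sup N, fun k hk x hx => ?_⟩
  rw [hs] at hx
  obtain ⟨c, hc, rfl⟩ := hx
  have : ∑ i, (((u + k • m) i : ℤ) : ℝ) * (∑ v ∈ s, c v • fun i => (v i : ℝ)) i
      = ∑ v ∈ s, c v * (p u v + k * p m v) := by
    simp only [p, Finset.sum_apply, Pi.smul_apply, smul_eq_mul, Pi.add_apply, Finset.mul_sum]
    rw [Finset.sum_comm]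
    refine Finset.sum_congr rfl fun v _ => ?_
    rw [← Finset.sum_add_distrib, Finset.mul_sum]
    refine Finset.sum_congr rfl fun i _ => ?_
    push_cast
    simp
    ring
  rw [this]
  exact Finset.sum_nonneg fun v hv =>
    mul_nonneg (hc v) (hN v hv k (le_trans (Finset.le_sup hv) hk))

theorem isLocalization_face {σ τ : Set (Fin n → ℝ)} (hσ : σ ∈ F.cones) (h : τ ⊆ σ)
    {m : dualMonoid σ} (hτ : τ = {x ∈ σ | ∑ i, (m.1 i : ℝ) * x i = 0}) :
    @IsLocalization.Away _ _ (zmon m) (coneRing τ) _ (coneRingMap h).toAlgebra := by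
  let _ := (coneRingMap h).toAlgebra
  let m' : dualMonoid τ := AddSubmonoid.inclusion (dualMonoid_anti h) m
  have hmτ : -m.1 ∈ dualMonoid τ := by
    intro x hx
    rw [hτ] at hx
    simp [Finset.sum_neg_distrib, hx.2]
  have hinj : Function.Injective (coneRingMap h) :=
    AddMonoidAlgebra.mapDomain_injective (AddSubmonoid.inclusion_injective (dualMonoid_anti h))
  have hmap : coneRingMap h (zmon m) = AddMonoidAlgebra.single m' 1 := coneRingMap_single h m 1
  refine IsLocalization.Away.mk _ ?_ ?_ ?_
  · refine IsUnit.of_mul_eq_one (AddMonoidAlgebra.single ⟨-m.1, hmτ⟩ 1) ?_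
    change coneRingMap h (zmon m) * _ = 1
    rw [hmap, AddMonoidAlgebra.single_mul_single, AddMonoidAlgebra.one_def]
    congr 1
    · ext1; simp [m']
    · simp
  · intro s
    suffices ∃ N : ℕ, ∀ k, N ≤ k → ∃ a, s * coneRingMap h (zmon m) ^ k = coneRingMap h a by
      obtain ⟨N, hN⟩ := this
      exact ⟨N, hN N le_rfl⟩
    induction s using AddMonoidAlgebra.induction_linear with
    | zero => exact ⟨0, fun k _ => ⟨0, by simp⟩⟩
    | add f g hf hg =>
      obtain ⟨N, hN⟩ := hf
      obtain ⟨N', hN'⟩ := hg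
      refine ⟨max N N', fun k hk => ?_⟩
      obtain ⟨a, ha⟩ := hN k (le_trans (le_max_left _ _) hk)
      obtain ⟨b, hb⟩ := hN' k (le_trans (le_max_right _ _) hk)
      exact ⟨a + b, by rw [add_mul, ha, hb, map_add]⟩
    | single u c =>
      have hu : u.1 ∈ dualMonoid {x ∈ σ | ∑ i, (m.1 i : ℝ) * x i = 0} := hτ ▸ u.2
      obtain ⟨N, hN⟩ := F.exists_add_mem hσ m.2 hu
      refine ⟨N, fun k hk => ⟨AddMonoidAlgebra.single ⟨_, hN k hk⟩ c, ?_⟩⟩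
      rw [coneRingMap_single, hmap, AddMonoidAlgebra.single_pow, one_pow,
        AddMonoidAlgebra.single_mul_single, mul_one]
      congr 1
  · intro a b hab
    exact ⟨0, by rw [hinj hab]⟩

theorem inter_mem {σ τ : Set (Fin n → ℝ)} (hσ : σ ∈ F.cones) (hτ : τ ∈ F.cones) :
    σ ∩ τ ∈ F.cones := by
  obtain ⟨m, hm, h⟩ := F.inter_face σ hσ τ hτ
  rw [h]
  exact F.face_mem σ hσ m hm

theorem exists_face {σ τ : Set (Fin n → ℝ)} (hσ : σ ∈ F.cones) (hτ : τ ∈ F.cones) (h : τ ⊆ σ) :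
    ∃ m : dualMonoid σ, τ = {x ∈ σ | ∑ i, (m.1 i : ℝ) * x i = 0} := by
  obtain ⟨m, hm, h'⟩ := F.inter_face σ hσ τ hτ
  exact ⟨⟨m, hm⟩, by rw [← h', Set.inter_eq_right.mpr h]⟩

/-- The poset of cones of a fan. -/
abbrev Cone : Type := {σ : Set (Fin n → ℝ) // σ ∈ F.cones}

/-- The diagram of affine toric varieties of the cones of a fan. -/
def charts : F.Cone ⥤ Scheme.{0} where
  obj σ := Spec (.of (coneRing σ.1))
  map {τ σ} f := Spec.map (CommRingCat.ofHom (coneRingMap (leOfHom f : τ.1 ⊆ σ.1)))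
  map_id σ := by
    rw [← Spec.map_id]
    congr 1
    ext x
    · simp [coneRingMap]
    · simp [coneRingMap]
      rfl
  map_comp {ρ τ σ} f g := by
    rw [← Spec.map_comp]
    congr 1
    ext x
    · simp [coneRingMap]
    · simp [coneRingMap]
      rfl

theorem charts_map {τ σ : F.Cone} (f : τ ⟶ σ) {m : dualMonoid σ.1}
    (hτ : τ.1 = {x ∈ σ.1 | ∑ i, (m.1 i : ℝ) * x i = 0}) :
    IsOpenImmersion (F.charts.map f) ∧
      Set.range (F.charts.map f) = (PrimeSpectrum.basicOpen (zmon m) : Set (PrimeSpectrum (coneRing σ.1))) := by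
  let _ := (coneRingMap (leOfHom f : τ.1 ⊆ σ.1)).toAlgebra
  have := F.isLocalization_face σ.2 (leOfHom f) hτ
  exact ⟨IsOpenImmersion.of_isLocalization (zmon m),
    PrimeSpectrum.localization_away_comap_range (coneRing τ.1) (zmon m)⟩

instance {τ σ : F.Cone} (f : τ ⟶ σ) : IsOpenImmersion (F.charts.map f) := by
  obtain ⟨m, hm⟩ := F.exists_face σ.2 τ.2 (leOfHom f)
  exact (F.charts_map f hm).1

instance : (F.charts ⋙ Scheme.forget).IsLocallyDirected where
  cond {τ₁ τ₂ σ} f₁ f₂ x₁ x₂ h := by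
    obtain ⟨m₁, hm₁⟩ := F.exists_face σ.2 τ₁.2 (leOfHom f₁)
    obtain ⟨m₂, hm₂⟩ := F.exists_face σ.2 τ₂.2 (leOfHom f₂)
    let ρ : F.Cone := ⟨τ₁.1 ∩ τ₂.1, F.inter_mem τ₁.2 τ₂.2⟩
    let g₁ : ρ ⟶ τ₁ := homOfLE Set.inter_subset_left
    let g₂ : ρ ⟶ τ₂ := homOfLE Set.inter_subset_right
    have hρ : ρ.1 = {x ∈ σ.1 | ∑ i, ((m₁ + m₂ : dualMonoid σ.1).1 i : ℝ) * x i = 0} := by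
      have e : ∀ x : Fin n → ℝ, ∑ i, ((m₁ + m₂ : dualMonoid σ.1).1 i : ℝ) * x i =
          (∑ i, (m₁.1 i : ℝ) * x i) + ∑ i, (m₂.1 i : ℝ) * x i := by
        intro x
        simp [add_mul, Finset.sum_add_distrib]
      change τ₁.1 ∩ τ₂.1 = _
      rw [hm₁, hm₂]
      ext x
      simp only [Set.mem_inter_iff, Set.mem_ofPred_eq, e]
      constructor
      · rintro ⟨⟨hx, h1⟩, _, h2⟩
        exact ⟨hx, by rw [h1, h2, add_zero]⟩
      · rintro ⟨hx, h12⟩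
        have a := m₁.2 x hx
        have b := m₂.2 x hx
        exact ⟨⟨hx, by linarith⟩, hx, by linarith⟩
    have h' : F.charts.map f₁ x₁ = F.charts.map f₂ x₂ := h
    have mem₁ : F.charts.map f₁ x₁ ∈ Set.range (F.charts.map f₁) := ⟨_, rfl⟩
    have mem₂ : F.charts.map f₁ x₁ ∈ Set.range (F.charts.map f₂) := ⟨x₂, h'.symm⟩
    have mem : F.charts.map f₁ x₁ ∈ Set.range (F.charts.map (g₁ ≫ f₁)) := by
      rw [(F.charts_map f₁ hm₁).2] at mem₁
      rw [(F.charts_map f₂ hm₂).2] at mem₂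
      rw [(F.charts_map (g₁ ≫ f₁) hρ).2]
      have : zmon (m₁ + m₂) = zmon m₁ * zmon m₂ := by
        simp [zmon, AddMonoidAlgebra.single_mul_single]
      rw [this, PrimeSpectrum.basicOpen_mul]
      exact ⟨mem₁, mem₂⟩
    obtain ⟨x, hx⟩ := mem
    refine ⟨ρ, g₁, g₂, x, ?_, ?_⟩
    · apply (F.charts.map f₁).isOpenEmbedding.injective
      rw [← hx, Functor.map_comp]
      rfl
    · apply (F.charts.map f₂).isOpenEmbedding.injective
      rw [← h', ← hx, show g₁ ≫ f₁ = g₂ ≫ f₂ from Subsingleton.elim _ _, Functor.map_comp]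
      rfl

/-- The toric variety of a fan, glued from the affine toric varieties of the cones. -/
def toric : Scheme.{0} := Limits.colimit F.charts

/-- The affine chart of the toric variety that belongs to a cone. -/
def chart (σ : F.Cone) : Spec (.of (coneRing σ.1)) ⟶ F.toric := Limits.colimit.ι F.charts σ

instance (σ : F.Cone) : IsOpenImmersion (F.chart σ) :=
  inferInstanceAs (IsOpenImmersion (Limits.colimit.ι F.charts σ))
end Fan

/-- A fan in `ℝ² × ℝ` (the last coordinate is the height) which lies over the fan of the affine line,
i.e. whose cones lie in the closed upper half space. -/
structure DegenerationFan extends Fan 3 where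
  upper : ∀ σ ∈ cones, ∀ x ∈ σ, 0 ≤ x 2

namespace DegenerationFan
variable (F : DegenerationFan)

theorem height_mem (σ : F.Cone) : Pi.single 2 1 ∈ dualMonoid σ.1 := by
  intro x hx
  have := F.upper σ.1 σ.2 x hx
  simpa [Fin.sum_univ_three, Pi.single_apply] using this

/-- The ring map `ℂ[t] → ℂ[σ^∨ ∩ ℤ³]`, `t ↦ z^(0,0,1)`. -/
def chartProj (σ : F.Cone) : Polynomial ℂ →+* coneRing σ.1 :=
  (Polynomial.aeval (zmon ⟨_, F.height_mem σ⟩)).toRingHom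

/-- The toric morphism to the affine line that is given by the height. -/
def proj : F.toric ⟶ Spec (.of (Polynomial ℂ)) :=
  Limits.colimit.desc F.charts
    { pt := Spec (.of (Polynomial ℂ))
      ι :=
        { app := fun σ => Spec.map (CommRingCat.ofHom (F.chartProj σ))
          naturality := fun τ σ f => by
            change Spec.map _ ≫ Spec.map _ = Spec.map _ ≫ 𝟙 _
            rw [← Spec.map_comp, Category.comp_id]
            congr 1
            ext x
            · simp [chartProj, coneRingMap]
            · simp [chartProj, coneRingMap, zmon]
              rfl } }

theorem chart_proj (σ : F.Cone) :
    F.chart σ ≫ F.proj = Spec.map (CommRingCat.ofHom (F.chartProj σ)) :=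
  Limits.colimit.ι_desc _ _

/-- The coordinate `t` of the affine line, as a function on the toric variety. -/
def tFun : Γ(F.toric, ⊤) :=
  F.proj.appTop.hom ((Scheme.ΓSpecIso (.of (Polynomial ℂ))).inv.hom Polynomial.X)

theorem chart_tFun (σ : F.Cone) : (F.chart σ).appTop F.tFun =
    (Scheme.ΓSpecIso (.of (coneRing σ.1))).inv.hom (zmon ⟨_, F.height_mem σ⟩) := by
  have h1 : (F.chart σ ≫ F.proj).appTop.hom
      ((Scheme.ΓSpecIso (.of (Polynomial ℂ))).inv.hom Polynomial.X) =
      (F.chart σ).appTop F.tFun := by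
    rw [Scheme.Hom.comp_appTop]
    rfl
  rw [← h1, F.chart_proj]
  have h2 := congr($(Scheme.ΓSpecIso_inv_naturality (CommRingCat.ofHom (F.chartProj σ))).hom
    (Polynomial.X : Polynomial ℂ))
  refine h2.symm.trans ?_
  change (Scheme.ΓSpecIso (.of (coneRing σ.1))).inv.hom (F.chartProj σ Polynomial.X) = _
  congr 1
  simp [chartProj]

/-- The open dense torus; its complement is the toric boundary. -/
def torus : F.toric.Opens := (F.chart ⟨{0}, F.zero_mem⟩).opensRange

theorem mem_basicOpen_tFun (x : F.toric) (hx : x ∈ F.torus) : x ∈ F.toric.basicOpen F.tFun := by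
  obtain ⟨y, rfl⟩ := hx
  refine (mem_basicOpen_appTop (F.chart ⟨{0}, F.zero_mem⟩) F.tFun y).mp ?_
  have hu : IsUnit ((F.chart ⟨{0}, F.zero_mem⟩).appTop F.tFun) := by
    rw [F.chart_tFun ⟨{0}, F.zero_mem⟩]
    refine IsUnit.map _ ?_
    refine IsUnit.of_mul_eq_one (AddMonoidAlgebra.single ⟨-Pi.single 2 1, by
      intro x hx; simp [Set.mem_singleton_iff.mp hx]⟩ 1) ?_
    rw [zmon, AddMonoidAlgebra.single_mul_single, AddMonoidAlgebra.one_def]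
    congr 1
    · ext1; simp
    · simp
  rw [Scheme.basicOpen_of_isUnit _ hu]
  trivial

/-- The origin of the affine line. -/
def zeroPt : Spec (.of ℂ) ⟶ Spec (.of (Polynomial ℂ)) :=
  Spec.map (CommRingCat.ofHom (Polynomial.evalRingHom 0))

/-- The central fibre `X₀`, the scheme theoretic fibre of `proj` over the origin. -/
def centralFibre : Scheme.{0} := Limits.pullback F.proj zeroPt

/-- The inclusion of the central fibre. -/
def inclusion : F.centralFibre ⟶ F.toric := Limits.pullback.fst F.proj zeroPt

/-- The structure morphism of the central fibre as a scheme over `ℂ`. -/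
def toPoint : F.centralFibre ⟶ Spec (.of ℂ) := Limits.pullback.snd F.proj zeroPt

/-- The closed toric stratum of a cone `σ` of the fan: the closure of the torus orbit of `σ`, which
in the affine chart of `σ` is the common zero set of all non-invertible monomials.
(It is empty if `σ` is not a cone of the fan.) -/
def stratum (σ : Set (Fin 3 → ℝ)) : Set F.toric :=
  ⋃ hσ : σ ∈ F.cones, closure (F.chart ⟨σ, hσ⟩ ''
    {x | ∀ m : dualMonoid σ, -m.1 ∉ dualMonoid σ → zmon m ∈ x.asIdeal})

/-- The closure of the cone over a subset `τ` of the plane at height one. -/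
def coneOver (τ : Set (Fin 2 → ℝ)) : Set (Fin 3 → ℝ) :=
  closure {x | ∃ r : ℝ, 0 ≤ r ∧ ∃ m ∈ τ, x = ![r * m 0, r * m 1, r]}

/-- The cells of the polyhedral decomposition which the cones of the fan cut out at height one. -/
def cells : Set (Set (Fin 2 → ℝ)) :=
  {τ | τ.Nonempty ∧ IsClosed τ ∧ coneOver τ ∈ F.cones}

/-- The closed stratum `D_τ` of the toric variety that belongs to a cell `τ`. -/
def cellStratum (τ : Set (Fin 2 → ℝ)) : Set F.toric := F.stratum (coneOver τ)

/-- A morphism `g` from a curve to the central fibre is torically transverse: its image is disjoint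
from all zero-dimensional strata, and no irreducible component is mapped into a one-dimensional
stratum. (In the three-dimensional toric variety, a stratum of dimension `d` belongs to a cone of
dimension `3 - d`.) -/
def IsToricallyTransverse {C : Scheme.{0}} (g : C ⟶ F.centralFibre) : Prop :=
  (∀ σ ∈ F.cones, Module.finrank ℝ (Submodule.span ℝ σ) = 3 →
    ∀ x : C, (g ≫ F.inclusion) x ∉ F.stratum σ) ∧
  (∀ σ ∈ F.cones, Module.finrank ℝ (Submodule.span ℝ σ) = 2 →
    ∀ Z ∈ irreducibleComponents C, ¬ Set.MapsTo (g ≫ F.inclusion) Z (F.stratum σ))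

end DegenerationFan

/-! ### Log structures -/

theorem subcanonical_etaleTopology : Scheme.etaleTopology.{0}.Subcanonical :=
  .of_le (Scheme.etaleTopology_le_proetaleTopology.trans Scheme.proetaleTopology_le_fpqcTopology)

/-- The property of morphisms to be étale. -/
abbrev etaleProperty : MorphismProperty Scheme.{0} := @Etale

instance isContinuous_forget (X : Scheme.{0}) : (Scheme.Etale.forget X ⋙ Over.forget X).IsContinuous X.smallEtaleTopology Scheme.etaleTopology := by
  have : (Scheme.Etale.forget X).IsContinuous X.smallEtaleTopology (Scheme.etaleTopology.over X) := by
    have : RepresentablyFlat (Scheme.Etale.forget X) := flat_of_preservesFiniteLimits _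
    rw [Functor.isContinuous_iff_coverPreserving]
    have h : (MorphismProperty.Over.forget etaleProperty ⊤ X).LocallyCoverDense (X.overGrothendieckTopology etaleProperty) := inferInstance
    have : (MorphismProperty.Over.forget etaleProperty ⊤ X).Full := (MorphismProperty.Comma.forgetFullyFaithful _ _ _).full
    have : (MorphismProperty.Over.forget etaleProperty ⊤ X).Faithful := (MorphismProperty.Comma.forgetFullyFaithful _ _ _).faithful
    exact @Functor.coverPreserving_restrictedTopology _ _ _ _ (MorphismProperty.Over.forget etaleProperty ⊤ X) _ h inferInstance inferInstance
  exact Functor.isContinuous_comp _ _ _ (Scheme.etaleTopology.over X) _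

theorem isSheaf_globalSections : Presieve.IsSheaf Scheme.etaleTopology.{0} (Scheme.Γ.{0} ⋙ forget CommRingCat) := by
  have := subcanonical_etaleTopology
  have h : (Scheme.Γ.{0} ⋙ forget CommRingCat).IsRepresentable := by
    refine ⟨Spec (.of (MvPolynomial PUnit (ULift ℤ))), ⟨?_⟩⟩
    refine
      { homEquiv := fun {Y} => (AffineSpace.toSpecMvPolyIntEquiv PUnit).trans (Equiv.funUnique PUnit _)
        homEquiv_comp := ?_ }
    intro Y Y' f g
    exact AffineSpace.toSpecMvPolyIntEquiv_comp PUnit f g PUnit.unit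
  exact GrothendieckTopology.Subcanonical.isSheaf_of_isRepresentable _

/-- The functions on an étale `U → X` which are invertible over the open subset `W` of `X`. -/
def divisorialSubmonoid (X : Scheme.{0}) (W : X.Opens) (U : X.Etale) : Submonoid Γ(U.left, ⊤) where
  carrier := {f | ∀ x : U.left, U.hom x ∈ W → x ∈ U.left.basicOpen f}
  one_mem' := fun x _ => by simp
  mul_mem' := fun {f g} hf hg x hx => by
    rw [Scheme.basicOpen_mul]
    exact ⟨hf x hx, hg x hx⟩

theorem divisorialSubmonoid_map (X : Scheme.{0}) (W : X.Opens) {U V : X.Etale} (φ : V ⟶ U) {f : Γ(U.left, ⊤)} (hf : f ∈ divisorialSubmonoid X W U) :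
    φ.left.appTop.hom f ∈ divisorialSubmonoid X W V := by
  intro x hx
  have h : φ.left x ∈ U.left.basicOpen f := by
    apply hf
    have e : φ.left ≫ U.hom = V.hom := MorphismProperty.Over.w φ
    rw [← Scheme.Hom.comp_apply, e]
    exact hx
  exact (mem_basicOpen_appTop φ.left f x).mpr h

/-- The presheaf of monoids of functions which are invertible over `W`. -/
def divisorialPresheaf (X : Scheme.{0}) (W : X.Opens) : X.Etaleᵒᵖ ⥤ CommMonCat.{0} where
  obj U := .of (divisorialSubmonoid X W U.unop)
  map {U V} φ := CommMonCat.ofHom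
    { toFun := fun f => ⟨φ.unop.left.appTop.hom f.1, divisorialSubmonoid_map X W φ.unop f.2⟩
      map_one' := Subtype.ext (map_one _)
      map_mul' := fun f g => Subtype.ext (map_mul _ _ _) }
  map_id U := by
    ext f
    change (Scheme.Hom.appTop (𝟙 _)).hom f.1 = f.1
    simp
  map_comp φ ψ := by
    ext f
    change (Scheme.Hom.appTop (ψ.unop.left ≫ φ.unop.left)).hom f.1 = _
    rw [Scheme.Hom.comp_appTop]
    rfl

/-- The structure sheaf of the small étale site, as a presheaf of types. -/
def structurePresheaf (X : Scheme.{0}) : X.Etaleᵒᵖ ⥤ Type :=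
  (Scheme.Etale.forget X ⋙ Over.forget X).op ⋙ Scheme.Γ ⋙ forget CommRingCat

theorem isSheaf_structurePresheaf (X : Scheme.{0}) : Presieve.IsSheaf X.smallEtaleTopology (structurePresheaf X) := by
  rw [← isSheaf_iff_isSheaf_of_type]
  apply Functor.op_comp_isSheaf_of_isSheaf _ _ Scheme.etaleTopology
  rw [isSheaf_iff_isSheaf_of_type]
  exact isSheaf_globalSections

/-- The functions invertible over `W`, as a subfunctor of the structure sheaf. -/
def divisorialSubfunctor (X : Scheme.{0}) (W : X.Opens) : Subfunctor (structurePresheaf X) where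
  obj U := {f | f ∈ divisorialSubmonoid X W U.unop}
  map φ _ hf := divisorialSubmonoid_map X W φ.unop hf

theorem isSheaf_divisorialPresheaf (X : Scheme.{0}) (W : X.Opens) : Presheaf.IsSheaf X.smallEtaleTopology (divisorialPresheaf X W ⋙ forget CommMonCat) := by
  rw [isSheaf_iff_isSheaf_of_type]
  have e : divisorialPresheaf X W ⋙ forget CommMonCat = (divisorialSubfunctor X W).toFunctor := rfl
  rw [e, Subfunctor.isSheaf_iff _ (isSheaf_structurePresheaf X)]
  intro U s hs x hx
  let S := (divisorialSubfunctor X W).sieveOfSection s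
  obtain ⟨ι, Z, f, hf⟩ := S.exists_eq_ofArrows
  have hs' : Sieve.ofArrows Z f ∈ X.smallEtaleTopology U.unop := hf ▸ hs
  rw [Scheme.ofArrows_mem_smallEtaleTopology_iff] at hs'
  obtain ⟨i, y, rfl⟩ := Set.mem_iUnion.mp (hs' ▸ Set.mem_univ x)
  have hi : S (f i) := by
    rw [hf]; exact Sieve.ofArrows_mk _ _ _
  have hi' : (f i).left.appTop.hom s ∈ divisorialSubmonoid X W (Z i) := hi
  have e : (f i).left ≫ U.unop.hom = (Z i).hom := MorphismProperty.Over.w (f i)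
  have h := hi' y (by rw [← e]; exact hx)
  exact (mem_basicOpen_appTop (f i).left s y).mp h

/-- A log structure on a scheme `X`: a sheaf of commutative monoids `M` on the small étale site of
`X` with a homomorphism `α` to the multiplicative monoid of the structure sheaf, which induces a
bijection from `α⁻¹(𝒪ˣ)` to `𝒪ˣ`. -/
structure LogStr (X : Scheme.{0}) where
  M : X.Etaleᵒᵖ ⥤ CommMonCat.{0}
  isSheaf : Presheaf.IsSheaf X.smallEtaleTopology (M ⋙ forget CommMonCat)
  α : ∀ U : X.Etale, M.obj (op U) →* Γ(U.left, ⊤)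
  α_map : ∀ {U V : X.Etale} (φ : V ⟶ U) (m : M.obj (op U)),
    α V (M.map φ.op m) = φ.left.appTop (α U m)
  units : ∀ (U : X.Etale) (f : Γ(U.left, ⊤)), IsUnit f → ∃! m, α U m = f

/-- `X` itself as an object of its small étale site. -/
def etaleTop (X : Scheme.{0}) : X.Etale := MorphismProperty.Over.mk ⊤ (𝟙 X) (inferInstance : Etale (𝟙 X))

/-- The structure morphism of an étale `U → X` as a morphism to `X` in the small étale site. -/
def toEtaleTop {X : Scheme.{0}} (U : X.Etale) : U ⟶ etaleTop X :=
  MorphismProperty.Over.homMk U.hom (Category.comp_id _) trivial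

namespace LogStr

/-- The sections of the sheaf of monoids over an étale `U → X`. -/
abbrev sec {X : Scheme.{0}} (L : LogStr X) (U : X.Etale) : Type := L.M.obj (op U)

/-- Restriction of sections. -/
abbrev res {X : Scheme.{0}} (L : LogStr X) {U V : X.Etale} (φ : V ⟶ U) : L.sec U →* L.sec V :=
  (L.M.map φ.op).hom

/-- Global sections. -/
abbrev global {X : Scheme.{0}} (L : LogStr X) : Type := L.sec (etaleTop X)

/-- The divisorial log structure of the complement of an open subset `W` of `X`: its sections are
the functions which are invertible over `W`. -/
def divisorial (X : Scheme.{0}) (W : X.Opens) : LogStr X where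
  M := divisorialPresheaf X W
  isSheaf := isSheaf_divisorialPresheaf X W
  α U := (divisorialSubmonoid X W U).subtype
  α_map _ _ := rfl
  units U f hf := by
    refine ⟨⟨f, fun x _ => ?_⟩, rfl, fun m hm => Subtype.ext hm⟩
    rw [Scheme.basicOpen_of_isUnit _ hf]
    trivial

end LogStr

/-- "Étale locally on `U`": the property holds after restriction to the members of an étale
covering of `U`. -/
def Locally {X : Scheme.{0}} (U : X.Etale) (P : ∀ V : X.Etale, (V ⟶ U) → Prop) : Prop :=
  ∀ x : U.left, ∃ (V : X.Etale) (φ : V ⟶ U) (y : V.left), φ.left y = x ∧ P V φ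

/-- A morphism of log structures over a morphism of schemes `f : X ⟶ Y`, i.e. a homomorphism from
`f⁻¹ M_Y` to `M_X` which is compatible with the homomorphisms to the structure sheaves. It is given by
compatible homomorphisms `M_Y(V) → M_X(U)`, one for each commutative square with `U ⟶ V` over
`f : X ⟶ Y`, where `U` is étale over `X` and `V` is étale over `Y`. -/
structure LogHom {X Y : Scheme.{0}} (f : X ⟶ Y) (L : LogStr X) (N : LogStr Y) where
  map : ∀ {U : X.Etale} {V : Y.Etale} (φ : U.left ⟶ V.left), φ ≫ V.hom = U.hom ≫ f →
    (N.sec V →* L.sec U)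
  map_res : ∀ {U : X.Etale} {V V' : Y.Etale} (φ : U.left ⟶ V'.left) (b : V' ⟶ V)
    (h' : φ ≫ V'.hom = U.hom ≫ f) (h : (φ ≫ b.left) ≫ V.hom = U.hom ≫ f) (m : N.sec V),
    map φ h' (N.res b m) = map (φ ≫ b.left) h m
  res_map : ∀ {U U' : X.Etale} {V : Y.Etale} (φ : U.left ⟶ V.left) (a : U' ⟶ U)
    (h : φ ≫ V.hom = U.hom ≫ f) (h' : (a.left ≫ φ) ≫ V.hom = U'.hom ≫ f) (m : N.sec V),
    L.res a (map φ h m) = map (a.left ≫ φ) h' m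
  α_map : ∀ {U : X.Etale} {V : Y.Etale} (φ : U.left ⟶ V.left) (h : φ ≫ V.hom = U.hom ≫ f)
    (m : N.sec V), L.α U (map φ h m) = φ.appTop (N.α V m)

namespace LogHom

variable {X Y : Scheme.{0}} {f : X ⟶ Y} {L : LogStr X} {N : LogStr Y}

/-- The map on global sections. -/
def global (F : LogHom f L N) : N.global →* L.global :=
  F.map (U := etaleTop X) (V := etaleTop Y) f
    ((Category.comp_id f).trans (Category.id_comp f).symm)

/-- A morphism of log schemes is strict if its log structure is the pull-back log structure, i.e. if
`M_X` is the amalgamated sum of `f⁻¹ M_Y` and `𝒪_Xˣ` over `f⁻¹ 𝒪_Yˣ`: locally every section is of the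
form `f♯(m) u` with a unit `u`, and `f♯(m) u = f♯(m') u'` only if locally `m = m' v` and
`u' = f♯(v) u` with a unit `v`. -/
structure IsStrict (F : LogHom f L N) : Prop where
  generates : ∀ (U : X.Etale) (s : L.sec U), Locally U fun U' a =>
    ∃ (V : Y.Etale) (φ : U'.left ⟶ V.left) (h : φ ≫ V.hom = U'.hom ≫ f) (m : N.sec V)
      (u : (L.sec U')ˣ), L.res a s = F.map φ h m * u
  relations : ∀ (U : X.Etale) (V : Y.Etale) (φ : U.left ⟶ V.left) (h : φ ≫ V.hom = U.hom ≫ f)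
    (m m' : N.sec V) (u u' : (L.sec U)ˣ), F.map φ h m * u = F.map φ h m' * u' →
    Locally U fun U' a =>
      ∃ (V' : Y.Etale) (ψ : U'.left ⟶ V'.left) (b : V' ⟶ V) (h' : ψ ≫ V'.hom = U'.hom ≫ f)
        (v : (N.sec V')ˣ), ψ ≫ b.left = a.left ≫ φ ∧
        N.res b m = N.res b m' * v ∧ L.res a u' = F.map ψ h' v * L.res a u

end LogHom

/-- A homomorphism `β` from a monoid `P` to the sections over `U` is a chart if the sheaf of monoids is
over `U` the log structure generated by `P`, i.e. the amalgamated sum of `P` and `𝒪ˣ` over the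
preimage of `𝒪ˣ` in `P`. -/
structure IsChart {X : Scheme.{0}} (L : LogStr X) (U : X.Etale) {P : Type} [CommMonoid P]
    (β : P →* L.sec U) : Prop where
  generates : ∀ (V : X.Etale) (a : V ⟶ U) (s : L.sec V), Locally V fun V' b =>
    ∃ (p : P) (u : (L.sec V')ˣ), L.res b s = L.res (b ≫ a) (β p) * u
  relations : ∀ (V : X.Etale) (a : V ⟶ U) (p p' : P) (u u' : (L.sec V)ˣ),
    L.res a (β p) * u = L.res a (β p') * u' → Locally V fun V' b =>
      ∃ (q q' : P) (w w' : (L.sec V')ˣ), L.res (b ≫ a) (β q) = w ∧ L.res (b ≫ a) (β q') = w' ∧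
        p * q = p' * q' ∧ L.res b u * w' = L.res b u' * w

/-- The ring `ℂ[P]/(p₀)` of the fibre over the log point of the toric model `Spec ℂ[P] → Spec ℂ[ℕ]`
that is given by `1 ↦ p₀`. -/
abbrev modelRing (P : Type) [CommMonoid P] (p₀ : P) : Type :=
  MonoidAlgebra ℂ P ⧸ Ideal.span {MonoidAlgebra.of ℂ P p₀}

/-- The monomial of `p` as a function on the toric model. -/
def modelFun {P : Type} [CommMonoid P] (p₀ p : P) : Γ(Spec (.of (modelRing P p₀)), ⊤) :=
  (Scheme.ΓSpecIso (.of (modelRing P p₀))).inv.hom (Ideal.Quotient.mk _ (MonoidAlgebra.of ℂ P p))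

/-- The toric model as a scheme over `ℂ`. -/
def modelStr (P : Type) [CommMonoid P] (p₀ : P) : Spec (.of (modelRing P p₀)) ⟶ Spec (.of ℂ) :=
  Spec.map (CommRingCat.ofHom (algebraMap ℂ (modelRing P p₀)))

/-- A morphism from a log scheme to the standard log point `Spec ℂ† = (Spec ℂ, ℕ ⊕ ℂˣ)` is a structure
morphism to `Spec ℂ` together with a global section `ρ` of the log structure (the image of the
generator of `ℕ`) with `α(ρ) = 0`. It is log smooth (with fine source) if étale locally there is a
chart by a finitely generated cancellative monoid `P` in which `ρ` is represented by an element `p₀`,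
the homomorphism `ℕ → P`, `1 ↦ p₀` being injective, such that the induced morphism to
`Spec ℂ ×_{Spec ℂ[ℕ]} Spec ℂ[P] = Spec (ℂ[P]/(p₀))` is smooth. (In characteristic zero there is
no condition on torsion, and every such morphism to the log point is integral.) -/
def IsLogSmooth {C : Scheme.{0}} (str : C ⟶ Spec (.of ℂ)) (L : LogStr C) (ρ : L.global) : Prop :=
  ∀ c : C, ∃ (U : C.Etale) (x : U.left) (P : Type) (_ : CommMonoid P) (β : P →* L.sec U) (p₀ : P)
    (q : U.left ⟶ Spec (.of (modelRing P p₀))),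
    U.hom x = c ∧ Monoid.FG P ∧ IsCancelMul P ∧ IsChart L U β ∧
    β p₀ = L.res (toEtaleTop U) ρ ∧ Function.Injective (fun n : ℕ => p₀ ^ n) ∧
    Smooth q ∧ q ≫ modelStr P p₀ = U.hom ≫ str ∧
    ∀ p : P, q.appTop (modelFun p₀ p) = L.α U (β p)

/-- The stalk of the log structure at a geometric point. -/
abbrev LogStr.stalk {X : Scheme.{0}} (L : LogStr X) {Ω : Type} [Field Ω] [IsSepClosed Ω]
    (s : Spec (.of Ω) ⟶ X) : MonCat.{0} :=
  (Scheme.pointSmallEtale s).presheafFiber.obj (L.M ⋙ forget₂ CommMonCat MonCat)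

instance {X : Scheme.{0}} (L : LogStr X) {Ω : Type} [Field Ω] [IsSepClosed Ω]
    (s : Spec (.of Ω) ⟶ X) : CommMonoid (L.stalk s) where
  mul_comm a b := by
    obtain ⟨U, u, x, y, rfl, rfl⟩ :=
      (Scheme.pointSmallEtale s).toPresheafFiber_jointly_surjective₂ a b
    rw [← map_mul, ← map_mul]
    congr 1
    exact mul_comm (G := L.M.obj (op U)) x y

/-- The germ of a global section at a geometric point. -/
def LogStr.germ {X : Scheme.{0}} (L : LogStr X) {Ω : Type} [Field Ω] [IsSepClosed Ω]
    (s : Spec (.of Ω) ⟶ X) (m : L.global) : L.stalk s :=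
  (Scheme.pointSmallEtale s).toPresheafFiber (etaleTop X) (Over.homMk s (Category.comp_id s))
    (L.M ⋙ forget₂ CommMonCat MonCat) m

/-- A commutative monoid is integral (cancellative) and saturated: an element `a/b` of the group of
fractions lies in the monoid as soon as one of its powers `aⁿ/bⁿ` with `n > 0` does. -/
def IsSaturatedMonoid (N : Type) [CommMonoid N] : Prop :=
  IsCancelMul N ∧ ∀ (a b : N) (n : ℕ), 0 < n → b ^ n ∣ a ^ n → b ∣ a

/-- A log structure is saturated if its stalks at all geometric points are. -/
def LogStr.IsSaturated {X : Scheme.{0}} (L : LogStr X) : Prop :=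
  ∀ (Ω : Type) [Field Ω] [IsAlgClosed Ω] (s : Spec (.of Ω) ⟶ X), IsSaturatedMonoid (L.stalk s)

/-- A log curve over the standard log point: a reduced fine saturated log scheme, log smooth over the
standard log point, whose underlying scheme is purely one-dimensional. -/
structure IsLogCurve {C : Scheme.{0}} (str : C ⟶ Spec (.of ℂ)) (L : LogStr C) (ρ : L.global) :
    Prop where
  isReduced : IsReduced C
  dim_eq_one : ∀ x : C, IsClosed {x} → ringKrullDim (C.presheaf.stalk x) = 1
  α_eq_zero : L.α (etaleTop C) ρ = 0
  logSmooth : IsLogSmooth str L ρ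
  saturated : L.IsSaturated

namespace DegenerationFan

variable (F : DegenerationFan)

/-- The toric variety carries the divisorial log structure of its toric boundary. -/
def logStr : LogStr F.toric := .divisorial F.toric F.torus

/-- The function `t` as a global section of the toric log structure. -/
def tSec : F.logStr.global :=
  (⟨F.tFun, F.mem_basicOpen_tFun⟩ : divisorialSubmonoid F.toric F.torus (etaleTop F.toric))

end DegenerationFan

/-- The monoid `S_e = ⟨x, y, z | x y = z^e⟩`, written additively. -/
abbrev S (e : ℕ) : Type :=
  (addConGen fun a b : ℕ × ℕ × ℕ => a = (1, 1, 0) ∧ b = (0, 0, e)).Quotient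

/-- The element `z` of `S_e`. -/
def S.z (e : ℕ) : S e := ((0, 0, 1) : ℕ × ℕ × ℕ)

/-- `e` is the integer of the log structure at the geometric point `p`: the stalk at `p` of the ghost
sheaf (the quotient of the log structure by its units) is isomorphic to `S_e`, such that the section
`ρ` that comes from the log point corresponds to `z`. -/
def HasNodeInteger {C : Scheme.{0}} (L : LogStr C) (ρ : L.global) (p : Spec (.of ℂ) ⟶ C) (e : ℕ) :
    Prop :=
  ∃ ι : Associates (L.stalk p) ≃* Multiplicative (S e),
    ι (Associates.mk (L.germ p ρ)) = Multiplicative.ofAdd (S.z e)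

/-- The ideal of germs at `x` of functions which vanish on the subset `Z`; for closed `Z` this is the
stalk of the ideal sheaf of `Z` with its reduced structure. -/
def stalkIdeal {X : Scheme.{0}} (Z : Set X) (x : X) : Ideal (X.presheaf.stalk x) :=
  Ideal.span {a | ∃ (U : X.Opens) (hx : x ∈ U) (f : Γ(X, U)),
    (∀ z ∈ Z, z ∉ X.basicOpen f) ∧ X.presheaf.germ U x hx f = a}

/-- The intersection multiplicity at `x` of (the image under `h` of) `Z` with the closed subset `D`
of `X`, i.e. the length at `x` of the scheme theoretic preimage of `D` in `Z`, both with their reduced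
structures. -/
def interMult {C X : Scheme.{0}} (h : C ⟶ X) (Z : Set C) (D : Set X) (x : C) : ℕ∞ :=
  Module.length (C.presheaf.stalk x) (C.presheaf.stalk x ⧸
    (stalkIdeal Z x ⊔ (stalkIdeal D (h x)).map (h.stalkMap x).hom))

end LogTrop

end

open LogTrop

/-! ### The monoid of a node -/

namespace LogTrop

section Monoid

variable {Q : Type*} [AddCommMonoid Q]

/-! Both `w` and `e` are read off from the ghost stalk `Q` at the node. Bézout's identity gives
linear forms `s₁`, `s₂` on `ℤ³` whose values on the two vertices, lifted to height one, are `(l, 0)`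
and `(0, l)`, and whose sum is `l` times the height. Their monomials pull back to sections of the
log structure of the curve with product `ρ ^ l`. By transversality the first vanishes on `C₁` but
not on `C₂`, the second on `C₂` but not on `C₁`, and the preimage of `D_E` in each component is cut
out by the one that does not vanish there (`DegenerationFan.stalkIdeal_component`).

A log smooth chart provides an étale neighbourhood whose local ring `O` is flat and formally smooth
over `ℂ[P]/(p₀)`, and `Q` is `P` modulo the monomials invertible in `O` (`LogStr.isGhostMap`). The
monomials which do not vanish on a given branch form a face of `Q`. Since the branch is a minimal
prime and `O` is reduced, every element outside the face is divisible by `z`, the class of `p₀`, up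
to the face. Hence there is an order of vanishing `hᵢ : Q →+ ℕ` along each branch, normalized by `hᵢ
z = 1` (`exists_multiplicity`). One-dimensionality of `O` and saturation of `Q` imply that `(h₁,
h₂)` identifies `Q` with the pairs `(a, b)` such that `a ≡ b` modulo some `e`
(`exists_isNodeChart`). This monoid is `S e` with `x = (e, 0)`, `y = (0, e)`, `z = (1, 1)`, and it
determines `e` (`IsNodeChart.eq_of_equiv`). The two sections become `(l, 0)` and `(0, l)`, so `e`
divides `l`; with `l = w * e` they are `w • x` and `w • y`.

It remains to see that `w` is the intersection multiplicity. The maximal ideal of `O` is generated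
by monomials (`maximalIdeal_eq_span`). A monomial which is not invertible is divisible by `x`, by
`y` or by `z`; here `z` maps to `0`, and `x` vanishes on the first branch. So `y` generates the
maximal ideal there, and the quotient by `y ^ w` has length `w`. The other branch is symmetric, and
lengths descend from `O` to the local ring of the curve (`LogTrop.length_quotient_eq`). -/

theorem exists_lt_add_eq_of_fg [AddMonoid.FG Q] (f : ℕ → Q) :
    ∃ m n, m < n ∧ ∃ c, f n = f m + c := by
  obtain ⟨s, hs⟩ := (AddMonoid.fg_def.mp ‹_› : (⊤ : AddSubmonoid Q).FG)
  have h : ∀ n, ∃ u : Q → ℕ, f n = ∑ a ∈ s, u a • a := by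
    intro n
    obtain ⟨u, -, hu⟩ := AddSubmonoid.mem_closure_finset.mp (hs ▸ AddSubmonoid.mem_top (f n))
    exact ⟨u, hu.symm⟩
  choose u hu using h
  -- Dickson's lemma for the exponent vectors with respect to a finite generating set.
  obtain ⟨m, n, hmn, hle⟩ := wellQuasiOrdered_le (α := s → ℕ) (fun n a => u n a)
  refine ⟨m, n, hmn, ∑ a ∈ s, (u n a - u m a) • a, ?_⟩
  rw [hu m, hu n, ← Finset.sum_add_distrib]
  refine Finset.sum_congr rfl fun a ha => ?_
  rw [← add_nsmul, Nat.add_sub_cancel' (hle ⟨a, ha⟩)]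

/-- If every element outside the face `G` can be divided by `z` up to `G`, then every element is a
multiple of `z` up to `G`. -/
theorem exists_add_eq_nsmul_add [IsCancelAdd Q] [AddMonoid.FG Q] {z : Q} {G : AddSubmonoid Q}
    (face : ∀ a b, a + b ∈ G → a ∈ G) (hz : z ∉ G)
    (div : ∀ a ∉ G, ∃ g ∈ G, ∃ b, a + g = z + b) (a : Q) :
    ∃ k : ℕ, ∃ g ∈ G, ∃ g' ∈ G, a + g = k • z + g' := by
  by_contra hbad
  let Bad := {a : Q // ¬ ∃ k : ℕ, ∃ g ∈ G, ∃ g' ∈ G, a + g = k • z + g'}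
  -- Dividing a bad element by `z` leaves a bad element, so one bad element starts an infinite
  -- descent.
  have step : ∀ a : Bad, ∃ b : Bad, ∃ g ∈ G, a.1 + g = z + b.1 := by
    rintro ⟨a, ha⟩
    have haG : a ∉ G := fun h => ha ⟨0, 0, G.zero_mem, a, h, by simp⟩
    obtain ⟨g, hg, b, hb⟩ := div a haG
    refine ⟨⟨b, ?_⟩, g, hg, hb⟩
    rintro ⟨k, g₁, hg₁, g₂, hg₂, h⟩
    refine ha ⟨k + 1, g + g₁, G.add_mem hg hg₁, g₂, hg₂, ?_⟩
    rw [← add_assoc, hb, add_assoc, h, succ_nsmul]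
    abel
  choose next hnext using step
  let seq : ℕ → Bad := fun n => Nat.rec ⟨a, hbad⟩ (fun _ b => next b) n
  have hseq : ∀ n k, ∃ g ∈ G, (seq n).1 + g = k • z + (seq (n + k)).1 := by
    intro n k
    induction k with
    | zero => exact ⟨0, G.zero_mem, by simp⟩
    | succ k ih =>
      obtain ⟨g, hg, h⟩ := ih
      obtain ⟨g', hg', h'⟩ := hnext (seq (n + k))
      refine ⟨g + g', G.add_mem hg hg', ?_⟩
      rw [← add_assoc, h, add_assoc, h', succ_nsmul, add_assoc]
      rfl
  obtain ⟨m, n, hmn, c, hc⟩ := exists_lt_add_eq_of_fg fun n => (seq n).1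
  obtain ⟨k, rfl⟩ := Nat.exists_eq_add_of_lt hmn
  obtain ⟨g, hg, h⟩ := hseq m (k + 1)
  rw [← add_assoc] at h
  rw [hc] at h
  -- By Dickson's lemma a later term of the descent is a multiple of an earlier one; after
  -- cancellation `z` divides an element of the face.
  have hzg : z + (k • z + c) = g := by
    apply add_left_cancel (a := (seq m).1)
    rw [h, succ_nsmul]
    abel
  exact hz (face z _ (hzg ▸ hg))

/-- The multiplicity of `z` modulo the face `G`. -/
theorem exists_multiplicity [IsCancelAdd Q] [AddMonoid.FG Q] {z : Q} {G : AddSubmonoid Q}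
    (face : ∀ a b, a + b ∈ G → a ∈ G) (hz : z ∉ G)
    (div : ∀ a ∉ G, ∃ g ∈ G, ∃ b, a + g = z + b) :
    ∃ h : Q →+ ℕ, h z = 1 ∧ (∀ a, h a = 0 ↔ a ∈ G) ∧
      ∀ a, ∃ g ∈ G, ∃ g' ∈ G, a + g = h a • z + g' := by
  choose k hk using exists_add_eq_nsmul_add face hz div
  -- The exponent of `z` is unique, since otherwise cancellation would make `z` divide an element of
  -- the face. Uniqueness also gives additivity.
  have le : ∀ (m n : ℕ) (g g' : Q), g ∈ G → g' ∈ G → m • z + g = n • z + g' → n ≤ m := by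
    intro m n g g' hg hg' h
    by_contra hlt
    obtain ⟨d, rfl⟩ := Nat.exists_eq_add_of_lt (not_le.mp hlt)
    refine hz (face z (d • z + g') ?_)
    have : z + (d • z + g') = g := by
      apply add_left_cancel (a := m • z)
      rw [h, succ_nsmul, add_nsmul]
      abel
    rwa [this]
  have uniq : ∀ (a : Q) (n : ℕ) (g g' : Q), g ∈ G → g' ∈ G → a + g = n • z + g' → k a = n := by
    intro a n g g' hg hg' h
    obtain ⟨g₁, hg₁, g₂, hg₂, h₁⟩ := hk a
    have e : k a • z + (g₂ + g) = n • z + (g' + g₁) := by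
      rw [← add_assoc, ← add_assoc, ← h₁, ← h]
      abel
    exact le_antisymm (le _ _ _ _ (G.add_mem hg' hg₁) (G.add_mem hg₂ hg) e.symm)
      (le _ _ _ _ (G.add_mem hg₂ hg) (G.add_mem hg' hg₁) e)
  refine ⟨⟨⟨k, ?_⟩, ?_⟩, ?_, ?_, hk⟩
  · exact uniq 0 0 0 0 G.zero_mem G.zero_mem (by simp)
  · intro a b
    obtain ⟨g₁, hg₁, g₂, hg₂, h₁⟩ := hk a
    obtain ⟨g₃, hg₃, g₄, hg₄, h₂⟩ := hk b
    refine uniq _ _ (g₁ + g₃) (g₂ + g₄) (G.add_mem hg₁ hg₃) (G.add_mem hg₂ hg₄) ?_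
    rw [add_add_add_comm, h₁, h₂, add_nsmul]
    abel
  · exact uniq z 1 0 0 G.zero_mem G.zero_mem (by simp)
  · intro a
    constructor
    · intro h
      obtain ⟨g₁, hg₁, g₂, hg₂, h₁⟩ := hk a
      change k a = 0 at h
      rw [h, zero_nsmul, zero_add] at h₁
      exact face a g₁ (h₁ ▸ hg₂)
    · intro h
      exact uniq a 0 0 a G.zero_mem h (by simp)

/-- If every nonzero element of the face `G` has a multiple above `s`, then it has a multiple which is
a multiple of `s`. -/
theorem exists_nsmul_eq_nsmul [IsCancelAdd Q] [AddMonoid.FG Q] {s : Q} {G : AddSubmonoid Q}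
    (face : ∀ a b, a + b ∈ G → a ∈ G) (h : Q →+ ℕ) (hs : 0 < h s)
    (arch : ∀ a ∈ G, a ≠ 0 → ∃ n : ℕ, ∃ b, n • a = s + b) {a : Q} (ha : a ∈ G) :
    ∃ n m : ℕ, 0 < n ∧ n • a = m • s := by
  classical
  obtain ⟨T, hT⟩ := (AddMonoid.fg_def.mp ‹_› : (⊤ : AddSubmonoid Q).FG)
  have hN : ∀ t : Q, ∃ n : ℕ, 0 < n ∧ (t ∈ G → t ≠ 0 → ∃ b, n • t = s + b) := by
    intro t
    by_cases ht : t ∈ G ∧ t ≠ 0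
    · obtain ⟨n, b, hb⟩ := arch t ht.1 ht.2
      refine ⟨n + 1, n.succ_pos, fun _ _ => ⟨b + t, ?_⟩⟩
      rw [succ_nsmul, hb, add_assoc]
    · exact ⟨1, one_pos, fun h1 h2 => absurd ⟨h1, h2⟩ ht⟩
  choose N hNpos hN using hN
  -- The finite set of remainders that can occur once no further `s` can be split off by means of a
  -- large coefficient.
  let R : Set Q := (fun c : T → ℕ => ∑ t, c t • t.1) '' Set.Iic (fun t => N t)
  have hR : R.Finite := (Set.finite_Iic _).image _
  -- A coefficient of at least `N t` allows `s` to be split off, which lowers `h` by `h s > 0`;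
  -- hence the strong induction on `h a`.
  have key : ∀ n, ∀ a ∈ G, h a = n → ∃ j : ℕ, ∃ r ∈ R, a = j • s + r := by
    intro n
    induction n using Nat.strong_induction_on with
    | _ n ih =>
    intro a ha hn
    obtain ⟨c, -, hc⟩ := AddSubmonoid.mem_closure_finset.mp (hT ▸ AddSubmonoid.mem_top a)
    by_cases hex : ∃ t ∈ T, t ≠ 0 ∧ N t ≤ c t
    · obtain ⟨t, ht, ht0, hle⟩ := hex
      have e1 : a = N t • t + ((c t - N t) • t + ∑ x ∈ T.erase t, c x • x) := by
        rw [← hc, ← Finset.add_sum_erase T _ ht, ← add_assoc, ← add_nsmul,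
          Nat.add_sub_cancel' hle]
      have htG : t ∈ G := by
        obtain ⟨k, hk⟩ := Nat.exists_eq_add_of_lt (hNpos t)
        rw [zero_add] at hk
        refine face t (k • t + ((c t - N t) • t + ∑ x ∈ T.erase t, c x • x)) ?_
        have : t + (k • t + ((c t - N t) • t + ∑ x ∈ T.erase t, c x • x)) = a := by
          rw [e1]
          conv_rhs => rw [show N t • t = k • t + t by rw [hk, succ_nsmul]]
          abel
        rwa [this]
      obtain ⟨b, hb⟩ := hN t htG ht0
      rw [hb, add_assoc] at e1
      set d := b + ((c t - N t) • t + ∑ x ∈ T.erase t, c x • x)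
      have hd : d ∈ G := face d s (by rw [add_comm, ← e1]; exact ha)
      have hlt : h d < n := by
        rw [← hn, e1, map_add h s d]
        omega
      obtain ⟨j, r, hr, hjr⟩ := ih _ hlt d hd rfl
      refine ⟨j + 1, r, hr, ?_⟩
      rw [e1, hjr, succ_nsmul]
      abel
    · push Not at hex
      refine ⟨0, a, ⟨fun t => min (c t) (N t), fun t => min_le_right _ _, ?_⟩, by simp⟩
      rw [← hc, ← Finset.sum_coe_sort T (fun t => c t • t)]
      refine Finset.sum_congr rfl fun t _ => ?_
      by_cases ht : t.1 = 0
      · simp [ht]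
      · dsimp only
        rw [min_eq_left (hex t t.2 ht).le]
  have hmem : ∀ n : ℕ, n • a ∈ G := fun n => G.nsmul_mem ha n
  choose j r hr hjr using fun n : ℕ => key _ (n • a) (hmem n) rfl
  have := hR.to_subtype
  -- Two multiples of `a` have the same remainder, and their difference is then a difference of
  -- multiples of `s`.
  obtain ⟨m, n, hne, heq⟩ := Finite.exists_ne_map_eq_of_infinite fun n => (⟨r n, hr n⟩ : R)
  wlog hmn : m < n generalizing m n
  · exact this n m hne.symm heq.symm (lt_of_le_of_ne (not_lt.mp hmn) hne.symm)
  obtain ⟨d, rfl⟩ := Nat.exists_eq_add_of_lt hmn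
  have heq : r m = r (m + d + 1) := congrArg Subtype.val heq
  have e : (d + 1) • a + j m • s = j (m + d + 1) • s := by
    apply add_right_cancel (b := r m)
    rw [add_assoc, ← hjr m, heq, ← hjr, ← add_nsmul]
    congr 1
    ring
  have hle : j m ≤ j (m + d + 1) := by
    have := congrArg h e
    simp only [map_add, map_nsmul, smul_eq_mul] at this
    exact Nat.le_of_mul_le_mul_right (this ▸ Nat.le_add_left _ _) hs
  refine ⟨d + 1, j (m + d + 1) - j m, d.succ_pos, ?_⟩
  apply add_right_cancel (b := j m • s)
  rw [e, ← add_nsmul, Nat.sub_add_cancel hle]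

/-- Coordinates `h₁, h₂` on the monoid `Q` which identify it with `{(a, b) | a ≡ b mod e}` and `z`
with `(1, 1)`. -/
structure IsNodeChart (z : Q) (e : ℕ) (h₁ h₂ : Q →+ ℕ) : Prop where
  pos : 0 < e
  z₁ : h₁ z = 1
  z₂ : h₂ z = 1
  inj : ∀ a b, h₁ a = h₁ b → h₂ a = h₂ b → a = b
  dvd : ∀ a, (e : ℤ) ∣ h₁ a - h₂ a
  surj : ∀ x y : ℕ, (e : ℤ) ∣ x - y → ∃ a, h₁ a = x ∧ h₂ a = y

/-- The coordinates are the multiplicities of `z` modulo the two faces. Elements with equal `h₁`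
differ by elements of `G₁`, which have positive multiples in `ℕ • s₂`; `h₂` compares these
multiples, and torsion-freeness removes the factor. The integer `e` generates the group of all
differences `h₁ a - h₂ a`. -/
theorem exists_isNodeChart [IsCancelAdd Q] [AddMonoid.FG Q]
    (sharp : ∀ a b : Q, a + b = 0 → a = 0)
    (sat : ∀ (a b : Q) (n : ℕ), 0 < n → (∃ c, n • a = n • b + c) → ∃ c, a = b + c)
    {z s₁ s₂ : Q} {l : ℕ} (hl : 0 < l) (hs : s₁ + s₂ = l • z) {G₁ G₂ : AddSubmonoid Q}
    (face₁ : ∀ a b, a + b ∈ G₁ → a ∈ G₁) (face₂ : ∀ a b, a + b ∈ G₂ → a ∈ G₂)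
    (hz₁ : z ∉ G₁) (hz₂ : z ∉ G₂) (hs₂ : s₂ ∈ G₁) (hs₁ : s₁ ∈ G₂)
    (red : ∀ (a : Q) (n : ℕ), (∃ c, n • a = z + c) → ∃ c, a = z + c)
    (div₁ : ∀ a ∉ G₁, ∃ n : ℕ, ∃ g ∈ G₁, ∃ c, n • a + g = z + c)
    (div₂ : ∀ a ∉ G₂, ∃ n : ℕ, ∃ g ∈ G₂, ∃ c, n • a + g = z + c)
    (arch : ∀ a ∈ G₁, a ≠ 0 → ∃ n : ℕ, ∃ b, n • a = s₂ + b) :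
    ∃ (e : ℕ) (h₁ h₂ : Q →+ ℕ), IsNodeChart z e h₁ h₂ ∧ h₁ s₁ = l ∧ h₁ s₂ = 0 ∧ h₂ s₁ = 0 ∧
      h₂ s₂ = l := by
  have step : ∀ G : AddSubmonoid Q,
      (∀ a ∉ G, ∃ n : ℕ, ∃ g ∈ G, ∃ c, n • a + g = z + c) → ∀ a ∉ G, ∃ g ∈ G, ∃ b, a + g = z + b := by
    intro G hG a ha
    obtain ⟨n, g, hg, c, h⟩ := hG a ha
    -- `n + 1` instead of `n`, so that at least one copy of `g` is available also when `n = 0`.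
    obtain ⟨d, hd⟩ := red (a + g) (n + 1) ⟨c + a + n • g, by
      rw [succ_nsmul, nsmul_add]
      calc n • a + n • g + (a + g) = (n • a + g) + (a + n • g) := by abel
        _ = _ := by rw [h]; abel⟩
    exact ⟨g, hg, d, hd⟩
  obtain ⟨h₁, z₁, ker₁, rep₁⟩ := exists_multiplicity face₁ hz₁ (step G₁ div₁)
  obtain ⟨h₂, z₂, ker₂, rep₂⟩ := exists_multiplicity face₂ hz₂ (step G₂ div₂)
  have h₁s₂ : h₁ s₂ = 0 := (ker₁ _).mpr hs₂
  have h₂s₁ : h₂ s₁ = 0 := (ker₂ _).mpr hs₁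
  have h₁s₁ : h₁ s₁ = l := by simpa [h₁s₂, z₁] using congrArg h₁ hs
  have h₂s₂ : h₂ s₂ = l := by simpa [h₂s₁, z₂] using congrArg h₂ hs
  -- By saturation `a` and `b` divide each other, and by sharpness the quotient is `0`.
  have tf : ∀ (n : ℕ) (a b : Q), 0 < n → n • a = n • b → a = b := by
    intro n a b hn h
    obtain ⟨c, hc⟩ := sat a b n hn ⟨0, by rw [h, add_zero]⟩
    obtain ⟨d, hd⟩ := sat b a n hn ⟨0, by rw [h, add_zero]⟩
    have : c + d = 0 := by
      apply add_left_cancel (a := b)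
      rw [← add_assoc, ← hc, ← hd, add_zero]
    rw [hc, sharp c d this, add_zero]
  have inj : ∀ a b, h₁ a = h₁ b → h₂ a = h₂ b → a = b := by
    intro a b e₁ e₂
    obtain ⟨g₁, hg₁, g₂, hg₂, ha⟩ := rep₁ a
    obtain ⟨g₃, hg₃, g₄, hg₄, hb⟩ := rep₁ b
    have hab : a + (g₁ + g₄) = b + (g₃ + g₂) := by
      rw [← add_assoc, ha, ← add_assoc, hb, e₁]
      abel
    have pos : 0 < h₂ s₂ := h₂s₂ ▸ hl
    obtain ⟨n, m, hn, hnm⟩ := exists_nsmul_eq_nsmul face₁ h₂ pos arch (G₁.add_mem hg₁ hg₄)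
    obtain ⟨n', m', hn', hnm'⟩ := exists_nsmul_eq_nsmul face₁ h₂ pos arch (G₁.add_mem hg₃ hg₂)
    have hN : (n' * n) • a + (n' * m) • s₂ = (n' * n) • b + (n * m') • s₂ := by
      have h3 := congrArg (fun x => (n' * n) • x) hab
      simp only [nsmul_add] at h3
      calc (n' * n) • a + (n' * m) • s₂ = (n' * n) • a + n' • n • (g₁ + g₄) := by
            rw [hnm, mul_nsmul' s₂]
        _ = (n' * n) • (a + (g₁ + g₄)) := by rw [nsmul_add a (g₁ + g₄), mul_nsmul' (g₁ + g₄)]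
        _ = (n' * n) • (b + (g₃ + g₂)) := by rw [hab]
        _ = (n' * n) • b + n • n' • (g₃ + g₂) := by
            rw [nsmul_add b (g₃ + g₂), mul_comm n' n, mul_nsmul' (g₃ + g₂)]
        _ = _ := by rw [hnm', mul_nsmul' s₂]
    have hM : n' * m = n * m' := by
      have := congrArg h₂ hN
      simp only [map_add, map_nsmul, smul_eq_mul, e₂, h₂s₂] at this
      exact Nat.eq_of_mul_eq_mul_right hl (by omega)
    rw [hM] at hN
    exact tf _ a b (Nat.mul_pos hn' hn) (add_right_cancel hN)
  let D : AddSubgroup ℤ :=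
    { carrier := {d | ∃ a, (h₁ a : ℤ) - h₂ a = d}
      zero_mem' := ⟨0, by simp⟩
      add_mem' := by
        rintro _ _ ⟨a, rfl⟩ ⟨b, rfl⟩
        exact ⟨a + b, by push_cast [map_add]; ring⟩
      neg_mem' := by
        rintro _ ⟨a, rfl⟩
        -- The first two summands contribute `-l` times the difference of `a`, the last one `l - 1`
        -- times.
        refine ⟨h₁ a • s₂ + h₂ a • s₁ + (l - 1) • a, ?_⟩
        simp only [map_add, map_nsmul, smul_eq_mul, h₁s₁, h₁s₂, h₂s₁, h₂s₂]
        push_cast [Nat.cast_sub (show 1 ≤ l from hl)]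
        ring }
  obtain ⟨g, hg⟩ := Int.subgroup_cyclic D
  have memD : ∀ d : ℤ, (∃ a, (h₁ a : ℤ) - h₂ a = d) ↔ (g.natAbs : ℤ) ∣ d := by
    intro d
    change d ∈ D ↔ _
    rw [hg, ← AddSubgroup.zmultiples_eq_closure, Int.mem_zmultiples_iff, Int.natAbs_dvd]
  refine ⟨g.natAbs, h₁, h₂, ⟨?_, z₁, z₂, inj, fun a => (memD _).mp ⟨a, rfl⟩, ?_⟩, h₁s₁, h₁s₂, h₂s₁, h₂s₂⟩
  · rw [Nat.pos_iff_ne_zero]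
    intro h0
    have := (memD l).mp ⟨s₁, by simp [h₁s₁, h₂s₁]⟩
    rw [h0, Nat.cast_zero, zero_dvd_iff] at this
    omega
  · intro x y hxy
    obtain ⟨a, ha⟩ := (memD _).mpr hxy
    rcases le_total (h₁ a) x with hle | hle
    · refine ⟨a + (x - h₁ a) • z, ?_, ?_⟩
      · simp only [map_add, map_nsmul, z₁, smul_eq_mul]
        omega
      · simp only [map_add, map_nsmul, z₂, smul_eq_mul]
        omega
    -- Here copies of `z` have to be subtracted from `a`. After multiplication by `l` the quotient
    -- is visibly `x • s₁ + y • s₂`, and saturation removes the `l`.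
    · have e : l • a = l • ((h₁ a - x) • z) + (x • s₁ + y • s₂) := by
        apply inj
        · simp only [map_add, map_nsmul, z₁, smul_eq_mul, h₁s₁, h₁s₂]
          zify [hle]
          ring
        · simp only [map_add, map_nsmul, z₂, smul_eq_mul, h₂s₁, h₂s₂]
          zify [hle]
          linear_combination -(l : ℤ) * ha
      obtain ⟨c, hc⟩ := sat a ((h₁ a - x) • z) l hl ⟨_, e⟩
      have c₁ := congrArg h₁ hc
      have c₂ := congrArg h₂ hc
      simp only [map_add, map_nsmul, z₁, z₂, smul_eq_mul] at c₁ c₂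
      exact ⟨c, by omega, by omega⟩

end Monoid

end LogTrop

/-! ### The monoid `S e` in coordinates -/

noncomputable section

namespace LogTrop

/-- The element `x ^ i y ^ j z ^ k` of `S_e`, written additively. -/
def S.mk (e : ℕ) : ℕ × ℕ × ℕ →+ S e := AddCon.mk' _

theorem S.mk_surjective (e : ℕ) : Function.Surjective (S.mk e) := AddCon.mk'_surjective

theorem S.mk_relation (e : ℕ) : S.mk e (1, 1, 0) = S.mk e (0, 0, e) :=
  (AddCon.eq _).mpr (AddConGen.Rel.of _ _ ⟨rfl, rfl⟩)

theorem S.mk_z (e : ℕ) : S.mk e (0, 0, 1) = S.z e := rfl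

/-- Each factor `x y` is traded for `z ^ e` until one of the two exponents is used up. -/
theorem S.exists_normalForm (e i j k : ℕ) :
    ∃ i' j' k', (i' = 0 ∨ j' = 0) ∧ S.mk e (i, j, k) = S.mk e (i', j', k') := by
  induction i generalizing j k with
  | zero => exact ⟨0, j, k, Or.inl rfl, rfl⟩
  | succ i ih =>
    cases j with
    | zero => exact ⟨i + 1, 0, k, Or.inr rfl, rfl⟩
    | succ j =>
      obtain ⟨i', j', k', h, h'⟩ := ih j (k + e)
      refine ⟨i', j', k', h, h' ▸ ?_⟩
      have e1 : ((i + 1, j + 1, k) : ℕ × ℕ × ℕ) = (i, j, k) + (1, 1, 0) := by simp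
      have e2 : ((i, j, k + e) : ℕ × ℕ × ℕ) = (i, j, k) + (0, 0, e) := by simp
      rw [e1, e2, map_add, map_add, S.mk_relation]

variable {Q : Type*} [AddCommMonoid Q] {z : Q} {e : ℕ} {h₁ h₂ : Q →+ ℕ}

namespace IsNodeChart

theorem exists_x (H : IsNodeChart z e h₁ h₂) : ∃ x, h₁ x = e ∧ h₂ x = 0 :=
  H.surj e 0 (by simp)

theorem exists_y (H : IsNodeChart z e h₁ h₂) : ∃ y, h₁ y = 0 ∧ h₂ y = e :=
  H.surj 0 e (by simp)

/-- The element `x ^ i y ^ j z ^ k` has coordinates `(i e + k, j e + k)`. In normal form `k` is the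
smaller coordinate, and the excess of the other one is a multiple of `e`; this gives injectivity and
surjectivity. -/
theorem exists_equiv (H : IsNodeChart z e h₁ h₂) : ∃ ι : Q ≃+ S e, ι z = S.z e := by
  obtain ⟨x, x₁, x₂⟩ := H.exists_x
  obtain ⟨y, y₁, y₂⟩ := H.exists_y
  let f : ℕ × ℕ × ℕ →+ Q :=
    { toFun := fun u => u.1 • x + u.2.1 • y + u.2.2 • z
      map_zero' := by simp
      map_add' := by
        intro u v
        simp only [Prod.fst_add, Prod.snd_add, add_nsmul]
        abel }
  have hf : ∀ i j k, f (i, j, k) = i • x + j • y + k • z := fun _ _ _ => rfl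
  have hf₁ : ∀ i j k, h₁ (f (i, j, k)) = i * e + k := by simp [hf, x₁, y₁, H.z₁]
  have hf₂ : ∀ i j k, h₂ (f (i, j, k)) = j * e + k := by simp [hf, x₂, y₂, H.z₂]
  let g : S e →+ Q := AddCon.lift _ f (AddCon.addConGen_le.mpr fun a b hab => by
    obtain ⟨rfl, rfl⟩ := hab
    exact H.inj _ _ (by simp [hf₁]) (by simp [hf₂]))
  have hg : ∀ u, g (S.mk e u) = f u := fun u => AddCon.lift_mk' _ u
  have he := H.pos
  have bij : Function.Bijective g := by
    constructor
    · intro a b hab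
      obtain ⟨⟨i, j, k⟩, rfl⟩ := S.mk_surjective e a
      obtain ⟨⟨i', j', k'⟩, rfl⟩ := S.mk_surjective e b
      obtain ⟨a₁, a₂, a₃, ha, ha'⟩ := S.exists_normalForm e i j k
      obtain ⟨b₁, b₂, b₃, hb, hb'⟩ := S.exists_normalForm e i' j' k'
      rw [ha', hb', hg, hg] at hab
      have e₁ := congrArg h₁ hab
      have e₂ := congrArg h₂ hab
      rw [hf₁, hf₁] at e₁
      rw [hf₂, hf₂] at e₂
      rw [ha', hb']
      have c₃ : a₃ = b₃ := by
        rcases ha with rfl | rfl <;> rcases hb with rfl | rfl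
        · omega
        · have := Nat.zero_le (b₁ * e)
          have := Nat.zero_le (a₂ * e)
          omega
        · have := Nat.zero_le (a₁ * e)
          have := Nat.zero_le (b₂ * e)
          omega
        · omega
      subst c₃
      have c₁ : a₁ = b₁ := Nat.eq_of_mul_eq_mul_right he (by omega)
      have c₂ : a₂ = b₂ := Nat.eq_of_mul_eq_mul_right he (by omega)
      rw [c₁, c₂]
    · intro a
      rcases le_total (h₂ a) (h₁ a) with hle | hle
      · obtain ⟨i, hi⟩ := H.dvd a
        have hi' : 0 ≤ i := by
          by_contra hneg
          push Not at hneg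
          nlinarith
        lift i to ℕ using hi'
        refine ⟨S.mk e (i, 0, h₂ a), ?_⟩
        rw [hg]
        refine H.inj _ _ ?_ ?_
        · rw [hf₁]
          zify
          linear_combination -hi
        · rw [hf₂]
          simp
      · obtain ⟨i, hi⟩ := H.dvd a
        have hi' : 0 ≤ -i := by
          by_contra hneg
          push Not at hneg
          nlinarith
        obtain ⟨n, hn⟩ := Int.eq_ofNat_of_zero_le hi'
        obtain rfl : i = -n := by omega
        refine ⟨S.mk e (0, n, h₁ a), ?_⟩
        rw [hg]
        refine H.inj _ _ ?_ ?_
        · rw [hf₁]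
          simp
        · rw [hf₂]
          zify
          linear_combination hi
  refine ⟨(AddEquiv.ofBijective g bij).symm, ?_⟩
  rw [AddEquiv.symm_apply_eq]
  change z = g (S.mk e (0, 0, 1))
  rw [hg, hf]
  simp

/-- The images `x'`, `y'` of the generators of `S e'` lie on the two axes, since the elements `(e,
0)` and `(0, e)` are combinations of `x'`, `y'`, `z` in which `z` cannot occur. The one on the first
axis is then `(e, 0)`, and comparing first coordinates in `x' + y' = e' • z` gives `e' = e`. -/
theorem eq_of_equiv (H : IsNodeChart z e h₁ h₂) {e' : ℕ} (ι : Q ≃+ S e') (hι : ι z = S.z e') :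
    e' = e := by
  obtain ⟨x, x₁, x₂⟩ := H.exists_x
  obtain ⟨y, y₁, y₂⟩ := H.exists_y
  set x' := ι.symm (S.mk e' (1, 0, 0))
  set y' := ι.symm (S.mk e' (0, 1, 0))
  have hz : ι.symm (S.z e') = z := by rw [← hι, ι.symm_apply_apply]
  have gen : ∀ a : Q, ∃ i j k : ℕ, a = i • x' + j • y' + k • z := by
    intro a
    obtain ⟨⟨i, j, k⟩, h⟩ := S.mk_surjective e' (ι a)
    refine ⟨i, j, k, ?_⟩
    apply ι.injective
    rw [map_add ι, map_add ι, map_nsmul ι, map_nsmul ι, map_nsmul ι, hι, ← S.mk_z,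
      ι.apply_symm_apply, ι.apply_symm_apply, ← map_nsmul (S.mk e'), ← map_nsmul (S.mk e'),
      ← map_nsmul (S.mk e'), ← map_add (S.mk e'), ← map_add (S.mk e'), ← h]
    simp
  have rel : x' + y' = e' • z := by
    apply ι.injective
    rw [map_add ι, map_nsmul ι, hι, ← S.mk_z, ι.apply_symm_apply, ι.apply_symm_apply,
      ← map_nsmul (S.mk e'), ← map_add (S.mk e')]
    simpa using S.mk_relation e'
  have rel₁ : h₁ x' + h₁ y' = e' := by simpa [H.z₁] using congrArg h₁ rel
  have rel₂ : h₂ x' + h₂ y' = e' := by simpa [H.z₂] using congrArg h₂ rel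
  have he := H.pos
  obtain ⟨i, j, k, hx⟩ := gen x
  obtain ⟨i', j', k', hy⟩ := gen y
  have hx₁ := congrArg h₁ hx
  have hx₂ := congrArg h₂ hx
  have hy₁ := congrArg h₁ hy
  have hy₂ := congrArg h₂ hy
  simp only [map_add, map_nsmul, smul_eq_mul, H.z₁, H.z₂, mul_one, x₁, x₂, y₁, y₂] at hx₁ hx₂ hy₁ hy₂
  have le_of : ∀ {m n d : ℕ}, (e : ℤ) ∣ (m : ℤ) - n → n = 0 → d * m = e → m = e := by
    intro m n d hm hn hd
    subst hn
    rw [Nat.cast_zero, sub_zero, Int.natCast_dvd_natCast] at hm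
    exact Nat.dvd_antisymm ⟨d, by rw [← hd, mul_comm]⟩ hm
  have dx := H.dvd x'
  have dy := H.dvd y'
  have dx' : (e : ℤ) ∣ (h₂ x' : ℤ) - h₁ x' := by rw [← dvd_neg, neg_sub]; exact dx
  have dy' : (e : ℤ) ∣ (h₂ y' : ℤ) - h₁ y' := by rw [← dvd_neg, neg_sub]; exact dy
  have p₁ : i * h₂ x' = 0 := by omega
  have p₂ : j * h₂ y' = 0 := by omega
  have q₁ : i' * h₁ x' = 0 := by omega
  have q₂ : j' * h₁ y' = 0 := by omega
  have hk : k = 0 := by omega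
  have hk' : k' = 0 := by omega
  subst hk hk'
  -- Which of `x'`, `y'` lies on the first axis; the extreme cases would make `(e, 0)` or `(0, e)`
  -- zero.
  rcases Nat.mul_eq_zero.mp p₁ with rfl | hx0 <;> rcases Nat.mul_eq_zero.mp p₂ with rfl | hy0
  · omega
  · -- `x` is a multiple of `y'`
    have h₁y' := le_of dy hy0 (d := j) (by omega)
    have : j' = 0 := by
      rcases Nat.mul_eq_zero.mp q₂ with h | h
      · exact h
      · omega
    subst this
    have hx0 : h₁ x' = 0 := by
      rcases Nat.mul_eq_zero.mp q₁ with rfl | h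
      · omega
      · exact h
    omega
  · have h₁x' := le_of dx hx0 (d := i) (by omega)
    have : i' = 0 := by
      rcases Nat.mul_eq_zero.mp q₁ with h | h
      · exact h
      · omega
    subst this
    have hy0 : h₁ y' = 0 := by
      rcases Nat.mul_eq_zero.mp q₂ with rfl | h
      · omega
      · exact h
    omega
  · rw [hx0, hy0] at hy₂
    omega

end IsNodeChart

end LogTrop
end

noncomputable section

/-! ### Local étale algebras -/

namespace LogTrop

open IsLocalRing TensorProduct

section EtaleLocal

variable (B O : Type*) [CommRing B] [CommRing O] [Algebra B O]

/-- By flatness the inclusion of `B ⧸ c` into the residue field stays injective after tensoring with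
`O`, so `O ⧸ cO` embeds in the fibre over `c`. -/
theorem mem_map_iff_tmul_eq_zero [Module.Flat B O] (c : Ideal B) [c.IsPrime] (x : O) :
    x ∈ c.map (algebraMap B O) ↔ x ⊗ₜ[B] (1 : c.ResidueField) = 0 := by
  have inj : Function.Injective (algebraMap (B ⧸ c) c.ResidueField) :=
    c.injective_algebraMap_quotient_residueField
  have inj' := Module.Flat.lTensor_preserves_injective_linearMap (M := O)
    (IsScalarTower.toAlgHom B (B ⧸ c) c.ResidueField).toLinearMap inj
  rw [← Ideal.Quotient.eq_zero_iff_mem,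
    ← EmbeddingLike.map_eq_zero_iff (f := Algebra.TensorProduct.quotIdealMapEquivTensorQuot O c),
    Algebra.TensorProduct.quotIdealMapEquivTensorQuot_mk, ← map_eq_zero_iff _ inj']
  simp

variable [Algebra.FormallyUnramified B O] [Algebra.EssFiniteType B O]

instance isReduced_tensorProduct_residueField (c : Ideal B) [c.IsPrime] :
    IsReduced (O ⊗[B] c.ResidueField) := by
  have : IsReduced (c.ResidueField ⊗[B] O) :=
    Algebra.FormallyUnramified.isReduced_of_field c.ResidueField _
  exact isReduced_of_injective (Algebra.TensorProduct.comm B O c.ResidueField)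
    (Algebra.TensorProduct.comm B O c.ResidueField).injective

/-- `O ⧸ cO` is contained in the fibre, which is reduced as an unramified algebra over a field. Thus
a branch of the curve stays reduced in an étale neighbourhood, although it may split there. -/
theorem isRadical_map_of_isPrime [Module.Flat B O] (c : Ideal B) [c.IsPrime] :
    (c.map (algebraMap B O)).IsRadical := by
  rintro x ⟨n, hn⟩
  rw [mem_map_iff_tmul_eq_zero] at hn ⊢
  refine IsReduced.eq_zero _ ⟨n, ?_⟩
  rwa [Algebra.TensorProduct.tmul_pow, one_pow]

/-- `B` embeds in the product of the residue fields of its finitely many minimal primes; by flatness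
`O` embeds in the product of the corresponding fibres, and these are reduced. -/
theorem isReduced_of_formallyUnramified_of_flat [Module.Flat B O] [IsNoetherianRing B]
    [IsReduced B] : IsReduced O := by
  classical
  let ι := {c : PrimeSpectrum B // c.asIdeal ∈ minimalPrimes B}
  have : Finite ι := by
    have h := Ideal.finite_minimalPrimes_of_isNoetherianRing B ⊥
    have := h.to_subtype
    refine Finite.of_injective (β := (⊥ : Ideal B).minimalPrimes) (fun c => ⟨c.1.asIdeal, c.2⟩) ?_
    intro c d hcd
    exact Subtype.ext (PrimeSpectrum.ext (congrArg Subtype.val hcd))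
  have := Fintype.ofFinite ι
  let T := ∀ c : ι, c.1.asIdeal.ResidueField
  have inj : Function.Injective (algebraMap B T) := by
    rw [injective_iff_map_eq_zero]
    intro b hb
    have : b ∈ sInf (⊥ : Ideal B).minimalPrimes := by
      refine (Ideal.mem_sInf).mpr fun {c} hc => ?_
      have hprime : c.IsPrime := hc.1.1
      exact (Ideal.algebraMap_residueField_eq_zero).mp (congrFun hb ⟨⟨c, hprime⟩, hc⟩)
    rw [Ideal.sInf_minimalPrimes] at this
    obtain ⟨n, hn⟩ := this
    exact IsReduced.eq_zero b ⟨n, hn⟩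
  have inj' := Module.Flat.lTensor_preserves_injective_linearMap (M := O)
    (Algebra.linearMap B T) inj
  let e := Algebra.TensorProduct.piRight B O O (fun c : ι => c.1.asIdeal.ResidueField)
  refine ⟨fun x hx => ?_⟩
  have h1 : IsNilpotent (e (x ⊗ₜ 1)) := by
    obtain ⟨n, hn⟩ := hx
    exact ⟨n, by rw [← map_pow, Algebra.TensorProduct.tmul_pow, hn, zero_tmul, map_zero]⟩
  have h2 : e (x ⊗ₜ 1) = 0 := h1.eq_zero
  rw [EmbeddingLike.map_eq_zero_iff] at h2
  have h3 : Function.Injective (fun y : O => y ⊗ₜ[B] (1 : B)) := 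
    (TensorProduct.rid B O).symm.injective
  apply h3
  apply inj'
  simpa using h2

theorem quasiFinite_of_formallyUnramified : Algebra.QuasiFinite B O where
  finite_fiber c _ := Algebra.FormallyUnramified.finite_of_free c.ResidueField (c.Fiber O)

end EtaleLocal

section Local

variable {B O : Type*} [CommRing B] [CommRing O] [Algebra B O]

/-- Extension of ideals along a faithfully flat map is strictly monotone, so ascending chains of `B`
stop because those of `O` do. Applied to the curve, whose local rings are not assumed Noetherian. -/
theorem isNoetherianRing_of_faithfullyFlat [Module.FaithfullyFlat B O] [IsNoetherianRing O] :
    IsNoetherianRing B := by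
  rw [isNoetherianRing_iff, isNoetherian_iff']
  have := (isNoetherian_iff' (R := O) (M := O)).mp inferInstance
  refine ⟨?_⟩
  refine (InvImage.wf (fun I : Ideal B => I.map (algebraMap B O)) this.wf).mono ?_
  intro I J h
  exact lt_of_le_of_ne (Ideal.map_mono h.le) fun h' =>
    h.ne (Ideal.map_injective_of_faithfullyFlat h')

/-- There is no chain of three prime ideals in a local étale algebra over a one-dimensional ring. -/
theorem eq_maximalIdeal_of_lt [IsLocalRing O] [Algebra.FormallyUnramified B O] [Algebra.EssFiniteType B O]
    (dim : ringKrullDim B = 1) {p q : Ideal O} [p.IsPrime] [q.IsPrime] (h : p < q) :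
    q = maximalIdeal O := by
  have := quasiFinite_of_formallyUnramified B O
  -- Incomparability: distinct comparable primes cannot lie over the same prime, because the fibres
  -- are finite.
  have hlt : ∀ {p q : Ideal O} [p.IsPrime] [q.IsPrime], p < q → p.under B < q.under B := by
    intro p q _ _ h
    refine lt_of_le_of_ne (Ideal.comap_mono h.le) fun h' => h.ne ?_
    exact Algebra.QuasiFinite.eq_of_le_of_under_eq (R := B) p q h.le h'
  by_contra hne
  have h₁ := hlt h
  have h₂ : q.under B < (maximalIdeal O).under B :=
    hlt (lt_of_le_of_ne (le_maximalIdeal (Ideal.IsPrime.ne_top ‹_›)) hne)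
  have : Ring.KrullDimLE 1 B := Ring.krullDimLE_iff.mpr dim.le
  rcases Ring.krullDimLE_one_iff.mp this (q.under B) inferInstance with hm | hm
  · exact absurd (hm.2 ⟨inferInstance, bot_le⟩ h₁.le) (not_le_of_gt h₁)
  · exact h₂.ne (hm.eq_of_le (Ideal.IsPrime.ne_top inferInstance) h₂.le)

/-- If `B → O` is a faithfully flat unramified homomorphism of local rings which is surjective on
residue fields, then `B ⧸ I → O ⧸ I O` preserves the length. -/
theorem length_quotient_eq [IsLocalRing B] [IsLocalRing O] [IsLocalHom (algebraMap B O)] [Module.FaithfullyFlat B O] [Algebra.FormallyUnramified B O]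
    [Algebra.EssFiniteType B O]
    (res : ∀ a : O, ∃ b : B, a - algebraMap B O b ∈ maximalIdeal O) (I : Ideal B) (n : ℕ)
    (hn : maximalIdeal O ^ n ≤ I.map (algebraMap B O)) :
    Module.length B (B ⧸ I) = Module.length O (O ⧸ I.map (algebraMap B O)) := by
  have hmax : (maximalIdeal B).map (algebraMap B O) = maximalIdeal O :=
    Algebra.FormallyUnramified.map_maximalIdeal
  -- Successive approximation: since the maximal ideal of `O` is extended from `B` and the residue
  -- fields agree, elements of `B` approximate those of `O` modulo every power of the maximal ideal.
  have key : ∀ k, ∀ a : O, ∃ b : B, a - algebraMap B O b ∈ maximalIdeal O ^ k := by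
    intro k
    induction k with
    | zero => exact fun a => ⟨0, by simp⟩
    | succ k ih =>
      intro a
      obtain ⟨b, hb⟩ := ih a
      have hb' : a - algebraMap B O b ∈ ((maximalIdeal B) ^ k).map (algebraMap B O) := by
        rwa [Ideal.map_pow, hmax]
      obtain ⟨b', -, hb''⟩ : ∃ b' ∈ maximalIdeal B ^ k,
          (a - algebraMap B O b) - algebraMap B O b' ∈ maximalIdeal O ^ (k + 1) := by
        refine Submodule.span_induction (p := fun x _ => ∃ b' ∈ maximalIdeal B ^ k,
          x - algebraMap B O b' ∈ maximalIdeal O ^ (k + 1)) ?_ ?_ ?_ ?_ hb'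
        · rintro _ ⟨b, hb, rfl⟩
          exact ⟨b, hb, by simp⟩
        · exact ⟨0, Ideal.zero_mem _, by simp⟩
        · rintro x y - - ⟨b₁, h₁, h₁'⟩ ⟨b₂, h₂, h₂'⟩
          refine ⟨b₁ + b₂, Ideal.add_mem _ h₁ h₂, ?_⟩
          convert Ideal.add_mem _ h₁' h₂' using 1
          rw [map_add]
          ring
        · rintro r x - ⟨b₁, h₁, h₁'⟩
          obtain ⟨r', hr'⟩ := res r
          refine ⟨r' * b₁, Ideal.mul_mem_left _ _ h₁, ?_⟩
          have e : r • x - algebraMap B O (r' * b₁) =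
              r * (x - algebraMap B O b₁) + (r - algebraMap B O r') * algebraMap B O b₁ := by
            rw [map_mul, smul_eq_mul]
            ring
          rw [e]
          refine Ideal.add_mem _ (Ideal.mul_mem_left _ _ h₁') ?_
          rw [pow_succ']
          refine Ideal.mul_mem_mul hr' ?_
          rw [← hmax, ← Ideal.map_pow]
          exact Ideal.mem_map_of_mem _ h₁
      exact ⟨b + b', by rwa [map_add, ← sub_sub]⟩
  let J := I.map (algebraMap B O)
  have surj : Function.Surjective (algebraMap B (O ⧸ J)) := by
    intro a
    obtain ⟨a, rfl⟩ := Ideal.Quotient.mk_surjective a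
    obtain ⟨b, hb⟩ := key n a
    refine ⟨b, ?_⟩
    have := Ideal.Quotient.eq.mpr (hn hb)
    exact this.symm
  have ker : RingHom.ker (algebraMap B (O ⧸ J)) = I := by
    ext b
    rw [RingHom.mem_ker, IsScalarTower.algebraMap_apply B O, Ideal.Quotient.algebraMap_eq,
      Ideal.Quotient.eq_zero_iff_mem, ← Ideal.mem_comap, Ideal.comap_map_eq_self_of_faithfullyFlat]
  let f : B →ₗ[B] O ⧸ J := Algebra.linearMap B (O ⧸ J)
  have hker : LinearMap.ker f = I := by
    ext b
    exact SetLike.ext_iff.mp ker b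
  let e : (B ⧸ I) ≃ₗ[B] O ⧸ J :=
    (Submodule.quotEquivOfEq I _ hker.symm).trans (f.quotKerEquivOfSurjective surj)
  rw [e.length_eq, Module.length_eq_of_surjective (R := O ⧸ J) surj,
    Module.length_eq_of_surjective (S := O) (R := O ⧸ J) Ideal.Quotient.mk_surjective]

/-- The length of a local ring modulo the `w`-th power of a generator of the maximal ideal. -/
theorem length_quotient_span_pow [IsLocalRing O] {J : Ideal O} {y : O}
    (hmax : maximalIdeal O ≤ J ⊔ Ideal.span {y}) (hy : y ∈ maximalIdeal O) (hJ : ∀ k, y ^ k ∉ J)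
    (w : ℕ) : Module.length O (O ⧸ (J ⊔ Ideal.span {y ^ w})) = w := by
  induction w with
  | zero =>
    have : J ⊔ Ideal.span {y ^ 0} = ⊤ := by simp
    rw [this, Nat.cast_zero, Module.length_eq_zero_iff]
    exact Ideal.Quotient.subsingleton_iff.mpr rfl
  | succ w ih =>
    let I := J ⊔ Ideal.span {y ^ (w + 1)}
    let I' := J ⊔ Ideal.span {y ^ w}
    have hle : I ≤ I' := sup_le_sup_left
      ((Ideal.span_singleton_le_span_singleton).mpr (pow_dvd_pow y w.le_succ)) _
    -- Multiplication by `y ^ w`. Its kernel is the maximal ideal, so its image in `O ⧸ I` is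
    -- simple, with quotient `O ⧸ I'`; the length goes up by one.
    let f : O →ₗ[O] O ⧸ I := LinearMap.toSpanSingleton O _ (Submodule.Quotient.mk (y ^ w))
    have hf : ∀ a, f a = Submodule.Quotient.mk (a * y ^ w) := fun a => rfl
    have hker : LinearMap.ker f = maximalIdeal O := by
      refine le_antisymm (fun a ha => ?_) fun a ha => ?_
      · by_contra hu
        rw [mem_maximalIdeal, mem_nonunits_iff, not_not] at hu
        rw [LinearMap.mem_ker, hf, Submodule.Quotient.mk_eq_zero, Ideal.unit_mul_mem_iff_mem _ hu]
          at ha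
        obtain ⟨j, hj, d, hd, e⟩ := Submodule.mem_sup.mp ha
        obtain ⟨c, rfl⟩ := Ideal.mem_span_singleton'.mp hd
        -- If a unit multiple of `y ^ w` were in `I`, then `(1 - c y) y ^ w` would lie in `J`, and
        -- so would `y ^ w`.
        have hunit : IsUnit (1 - c * y) := by
          by_contra hn
          have h1 : (1 - c * y) + c * y ∈ maximalIdeal O :=
            Ideal.add_mem _ hn (Ideal.mul_mem_left _ _ hy)
          rw [sub_add_cancel] at h1
          exact (Ideal.ne_top_iff_one _).mp (maximalIdeal.isMaximal O).ne_top h1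
        refine hJ w ((Ideal.unit_mul_mem_iff_mem _ hunit).mp ?_)
        have : (1 - c * y) * y ^ w = j := by
          rw [← sub_eq_zero]
          linear_combination -e
        rwa [this]
      · rw [LinearMap.mem_ker, hf, Submodule.Quotient.mk_eq_zero]
        obtain ⟨j, hj, d, hd, rfl⟩ := Submodule.mem_sup.mp (hmax ha)
        obtain ⟨c, rfl⟩ := Ideal.mem_span_singleton'.mp hd
        rw [add_mul]
        refine Ideal.add_mem _ (Ideal.mem_sup_left (Ideal.mul_mem_right _ _ hj))
          (Ideal.mem_sup_right ?_)
        rw [mul_assoc, ← pow_succ']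
        exact Ideal.mul_mem_left _ _ (Ideal.mem_span_singleton_self _)
    have hone : Module.length O (O ⧸ LinearMap.ker f) = 1 := by
      rw [Module.length_eq_one_iff, isSimpleModule_iff_isCoatom, hker]
      exact (maximalIdeal.isMaximal O).out
    have exact : Function.Exact ((LinearMap.ker f).liftQ f le_rfl) (Submodule.factor hle) := by
      rw [LinearMap.exact_iff, Submodule.range_liftQ]
      refine le_antisymm (fun a ha => ?_) ?_
      · obtain ⟨a, rfl⟩ := Submodule.Quotient.mk_surjective _ a
        replace ha : a ∈ I' := (Submodule.Quotient.mk_eq_zero _).mp ha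
        obtain ⟨j, hj, d, hd, rfl⟩ := Submodule.mem_sup.mp ha
        obtain ⟨c, rfl⟩ := Ideal.mem_span_singleton'.mp hd
        refine ⟨c, ?_⟩
        rw [hf, Submodule.Quotient.eq, sub_add_cancel_right]
        exact I.neg_mem (Ideal.mem_sup_left hj)
      · rintro _ ⟨a, rfl⟩
        rw [LinearMap.mem_ker, hf]
        exact (Submodule.Quotient.mk_eq_zero _).mpr
          (Ideal.mul_mem_left _ _ (Ideal.mem_sup_right (Ideal.mem_span_singleton_self _)))
    have := Module.length_eq_add_of_exact ((LinearMap.ker f).liftQ f le_rfl) (Submodule.factor hle)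
      (LinearMap.ker_eq_bot.mp (Submodule.ker_liftQ_eq_bot _ _ _ le_rfl))
      (Submodule.factor_surjective hle) exact
    rw [this, hone, ih, Nat.cast_add, Nat.cast_one, add_comm]

end Local

end LogTrop
end

/-! ### Tangent vectors and formal smoothness at a rational point -/

noncomputable section

namespace LogTrop

open IsLocalRing Polynomial

section Smooth

variable {k A O : Type*} [Field k] [CommRing A] [CommRing O] [Algebra k A] [Algebra k O]
  [Algebra A O] [IsScalarTower k A O]

theorem sub_algebraMap_mem_maximalIdeal [IsLocalRing O] (ψ : O →ₐ[k] k) (a : O) :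
    a - algebraMap k O (ψ a) ∈ maximalIdeal O := by
  rw [mem_maximalIdeal, mem_nonunits_iff]
  intro h
  simpa using (h.map ψ).ne_zero

theorem map_eq_zero_iff_mem_maximalIdeal [IsLocalRing O] (ψ : O →ₐ[k] k) (a : O) :
    ψ a = 0 ↔ a ∈ maximalIdeal O := by
  constructor
  · intro h
    simpa [h] using sub_algebraMap_mem_maximalIdeal ψ a
  · intro h
    by_contra h0
    have hu : IsUnit (algebraMap k O (ψ a)) := (IsUnit.mk0 _ h0).map _
    have := Ideal.sub_mem _ h (sub_algebraMap_mem_maximalIdeal ψ a)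
    rw [sub_sub_cancel] at this
    exact this hu

theorem aeval_eps (p : k[X]) : Polynomial.aeval (DualNumber.eps : DualNumber k) p =
    TrivSqZeroExt.inl (p.coeff 0) + TrivSqZeroExt.inr (p.coeff 1) := by
  induction p using Polynomial.induction_on' with
  | add p q hp hq =>
    rw [map_add, hp, hq, coeff_add, coeff_add, TrivSqZeroExt.inl_add, TrivSqZeroExt.inr_add]
    exact add_add_add_comm _ _ _ _
  | monomial n a =>
    rw [aeval_monomial, coeff_monomial, coeff_monomial]
    match n with
    | 0 => simp [TrivSqZeroExt.algebraMap_eq_inl]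
    | 1 => ext <;> simp [TrivSqZeroExt.algebraMap_eq_inl]
    | n + 2 =>
      have : (DualNumber.eps : DualNumber k) ^ (n + 2) = 0 := by
        rw [pow_add, pow_two, DualNumber.eps_mul_eps, mul_zero]
      simp [this]

/-- A tangent vector of a formally smooth algebra does not vanish on nilpotent elements. -/
theorem pow_notMem_of_dualNumber {k A O : Type*} [Field k] [CommRing A] [CommRing O] [Algebra A k]
    [Algebra A O] [Algebra.FormallySmooth A O] (f : O →ₐ[A] DualNumber k) {a : O}
    (h₀ : (f a).fst = 0) (h₁ : (f a).snd ≠ 0) (N : ℕ) :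
    a ^ N ∉ (RingHom.ker (algebraMap A k)).map (algebraMap A O) := by
  intro haN
  -- A truncated arc to which the tangent vector `f` lifts by formal smoothness. The exponent is at
  -- least `2`, so that `T` maps onto the dual numbers, and exceeds `N`, so that the `N`-th power of
  -- an element of order one is not zero in `T`.
  let T := k[X] ⧸ Ideal.span {(X : k[X]) ^ (N + 2)}
  let g : T →ₐ[A] DualNumber k :=
    Ideal.Quotient.liftₐ _ ((Polynomial.aeval DualNumber.eps).restrictScalars A) (by
      intro a ha
      obtain ⟨b, rfl⟩ := Ideal.mem_span_singleton'.mp ha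
      rw [map_mul]
      have : (Polynomial.aeval (R := k) DualNumber.eps).restrictScalars A (X ^ (N + 2)) =
          (0 : DualNumber k) := by
        change Polynomial.aeval (R := k) DualNumber.eps (X ^ (N + 2)) = _
        rw [map_pow, aeval_X, pow_add, pow_two, DualNumber.eps_mul_eps, mul_zero]
      rw [this, mul_zero])
  have hg : ∀ p : k[X], g (Ideal.Quotient.mk _ p) =
      TrivSqZeroExt.inl (p.coeff 0) + TrivSqZeroExt.inr (p.coeff 1) := aeval_eps
  have hsurj : Function.Surjective g := by
    intro x
    refine ⟨Ideal.Quotient.mk _ (C x.fst + C x.snd * X), ?_⟩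
    rw [hg]
    ext <;> simp
  have hker : RingHom.ker g ≤ Ideal.span {Ideal.Quotient.mk _ X} := by
    intro x hx
    obtain ⟨p, rfl⟩ := Ideal.Quotient.mk_surjective x
    have : p.coeff 0 = 0 := by
      have := congrArg TrivSqZeroExt.fst ((hg p).symm.trans hx)
      simpa using this
    obtain ⟨q, rfl⟩ := X_dvd_iff.mpr this
    exact Ideal.mem_span_singleton.mpr ⟨Ideal.Quotient.mk _ q, map_mul _ _ _⟩
  have hnil : IsNilpotent (RingHom.ker g) := by
    refine ⟨N + 2, le_bot_iff.mp ((Ideal.pow_right_mono hker _).trans ?_)⟩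
    rw [Ideal.span_singleton_pow, ← map_pow, Ideal.Quotient.eq_zero_iff_mem.mpr
      (Ideal.mem_span_singleton_self _)]
    simp
  let F := Algebra.FormallySmooth.liftOfSurjective f g hsurj hnil
  have hF : ∀ x, g (F x) = f x := Algebra.FormallySmooth.liftOfSurjective_apply f g hsurj hnil
  obtain ⟨p, hp⟩ := Ideal.Quotient.mk_surjective (F a)
  have hpa := hF a
  rw [← hp, hg] at hpa
  have hp0 : p.coeff 0 = 0 := by simpa [h₀] using congrArg TrivSqZeroExt.fst hpa
  have hp1 : p.coeff 1 ≠ 0 := by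
    have := congrArg TrivSqZeroExt.snd hpa
    simp only [TrivSqZeroExt.snd_add, TrivSqZeroExt.snd_inl, TrivSqZeroExt.snd_inr, zero_add] at this
    rwa [this]
  have h0 : F (a ^ N) = 0 := by
    have hle : (RingHom.ker (algebraMap A k)).map (algebraMap A O) ≤ RingHom.ker F := by
      rw [Ideal.map_le_iff_le_comap]
      intro b hb
      rw [Ideal.mem_comap, RingHom.mem_ker, AlgHom.commutes, IsScalarTower.algebraMap_apply A k T,
        (RingHom.mem_ker).mp hb, map_zero]
    exact hle haN
  rw [map_pow, ← hp, ← map_pow, Ideal.Quotient.eq_zero_iff_mem, Ideal.mem_span_singleton] at h0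
  obtain ⟨q, rfl⟩ := X_dvd_iff.mpr hp0
  rw [mul_pow, pow_add, mul_dvd_mul_iff_left (pow_ne_zero _ X_ne_zero)] at h0
  have : (X : k[X]) ∣ q ^ N := (dvd_pow_self X two_ne_zero).trans h0
  rw [X_dvd_iff, coeff_zero_eq_eval_zero, eval_pow, ← coeff_zero_eq_eval_zero] at this
  rw [show (1 : ℕ) = 0 + 1 from rfl, coeff_X_mul] at hp1
  exact pow_ne_zero N hp1 this

/-- A formally smooth algebra whose fibre at a rational point is zero-dimensional is unramified
there. -/
theorem map_ker_eq_maximalIdeal [IsLocalRing O] [IsNoetherianRing O] [Algebra.FormallySmooth A O]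
    (ψ : O →ₐ[k] k)
    (dim : ∀ n : Ideal O, n.IsPrime →
      (RingHom.ker (ψ.toRingHom.comp (algebraMap A O))).map (algebraMap A O) ≤ n →
        n = maximalIdeal O) :
    (RingHom.ker (ψ.toRingHom.comp (algebraMap A O))).map (algebraMap A O) = maximalIdeal O := by
  set q := RingHom.ker (ψ.toRingHom.comp (algebraMap A O)) with hq
  set J := q.map (algebraMap A O) with hJ
  have hJm : J ≤ maximalIdeal O := by
    rw [hJ, Ideal.map_le_iff_le_comap]
    intro a ha
    exact (map_eq_zero_iff_mem_maximalIdeal ψ _).mp ha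
  have hrad : maximalIdeal O ≤ J.radical := by
    rw [Ideal.radical_eq_sInf]
    exact le_sInf fun n hn => (dim n hn.2 hn.1).ge
  obtain ⟨N, hN⟩ := Ideal.exists_pow_le_of_le_radical_of_fg hrad (IsNoetherian.noetherian _)
  refine le_antisymm hJm ?_
  -- By Nakayama it suffices to work modulo the square of the maximal ideal. An element not in `J +
  -- 𝔪²` has a tangent vector that kills `A` but not this element, while some power of it lies in
  -- `J`; formal smoothness excludes that.
  refine Submodule.le_of_le_smul_of_le_jacobson_bot (I := maximalIdeal O)
    (IsNoetherian.noetherian _) (IsLocalRing.maximalIdeal_le_jacobson _) ?_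
  by_contra hnot
  rw [SetLike.not_le_iff_exists] at hnot
  obtain ⟨a₀, ha₀, ha₀'⟩ := hnot
  let I : Ideal O := J ⊔ maximalIdeal O • maximalIdeal O
  obtain ⟨lam, hlam⟩ : ∃ lam : Module.Dual k (O ⧸ I), lam (Ideal.Quotient.mk I a₀) ≠ 0 := by
    by_contra hall
    push Not at hall
    exact ha₀' (Ideal.Quotient.eq_zero_iff_mem.mp ((Module.forall_dual_apply_eq_zero_iff k _).mp hall))
  have lam_zero : ∀ a ∈ I, lam (Ideal.Quotient.mk I a) = 0 := fun a ha => by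
    rw [Ideal.Quotient.eq_zero_iff_mem.mpr ha, map_zero]
  have lam_smul : ∀ (c : k) (a : O), lam (Ideal.Quotient.mk I (algebraMap k O c * a)) =
      c * lam (Ideal.Quotient.mk I a) := by
    intro c a
    rw [← Algebra.smul_def, ← smul_eq_mul, ← map_smul]
    rfl
  let _ : Algebra A k := (ψ.toRingHom.comp (algebraMap A O)).toAlgebra
  have algA : ∀ a : A, algebraMap A k a = ψ (algebraMap A O a) := fun _ => rfl
  -- The derivation over `A` which corresponds to the functional `lam`; together with `ψ` it is a
  -- homomorphism to the dual numbers.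
  let d : O → k := fun a => lam (Ideal.Quotient.mk I (a - algebraMap k O (ψ a)))
  have d_mul : ∀ a b, d (a * b) = ψ a * d b + d a * ψ b := by
    intro a b
    have e : a * b - algebraMap k O (ψ (a * b)) =
        algebraMap k O (ψ a) * (b - algebraMap k O (ψ b)) +
        algebraMap k O (ψ b) * (a - algebraMap k O (ψ a)) +
        (a - algebraMap k O (ψ a)) * (b - algebraMap k O (ψ b)) := by
      rw [map_mul, map_mul]
      ring
    have hz : (a - algebraMap k O (ψ a)) * (b - algebraMap k O (ψ b)) ∈ I :=
      Ideal.mem_sup_right (Ideal.mul_mem_mul (sub_algebraMap_mem_maximalIdeal ψ a)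
        (sub_algebraMap_mem_maximalIdeal ψ b))
    simp only [d]
    rw [e, map_add, map_add, map_add, map_add, lam_smul, lam_smul, lam_zero _ hz]
    ring
  have d_add : ∀ a b, d (a + b) = d a + d b := by
    intro a b
    simp only [d]
    rw [← map_add, ← map_add]
    congr 2
    rw [map_add, map_add]
    ring
  have d_alg : ∀ a : A, d (algebraMap A O a) = 0 := by
    intro a
    refine lam_zero _ (Ideal.mem_sup_left ?_)
    rw [IsScalarTower.algebraMap_apply k A O, ← map_sub]
    refine Ideal.mem_map_of_mem _ ?_
    rw [hq, RingHom.mem_ker]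
    change ψ _ = 0
    rw [map_sub, map_sub, ← IsScalarTower.algebraMap_apply k A O]
    simp
  have d_one : d 1 = 0 := by simpa using d_alg 1
  have d_zero : d 0 = 0 := by simpa using d_alg 0
  let f : O →ₐ[A] DualNumber k :=
    { toFun := fun a => (ψ a, d a)
      map_one' := TrivSqZeroExt.ext (map_one ψ) d_one
      map_zero' := TrivSqZeroExt.ext (map_zero ψ) d_zero
      map_add' := fun a b => TrivSqZeroExt.ext (map_add ψ a b) (d_add a b)
      map_mul' := fun a b => TrivSqZeroExt.ext (map_mul ψ a b) (d_mul a b)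
      commutes' := fun a => TrivSqZeroExt.ext rfl (d_alg a) }
  refine pow_notMem_of_dualNumber f (a := a₀) ((map_eq_zero_iff_mem_maximalIdeal ψ _).mpr ha₀) ?_ N
    (hN (Ideal.pow_mem_pow ha₀ N))
  change d a₀ ≠ 0
  simp only [d]
  rw [(map_eq_zero_iff_mem_maximalIdeal ψ _).mpr ha₀, map_zero, sub_zero]
  exact hlam

end Smooth
end LogTrop
end

noncomputable section

namespace LogTrop

open IsLocalRing

/-! ### Monomials in toric models -/

section Model

variable {P : Type} [CommMonoid P]

/-- The monomials of the toric model. -/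
def modelMon (p₀ : P) : P →* modelRing P p₀ :=
  ((Ideal.Quotient.mk (Ideal.span {MonoidAlgebra.of ℂ P p₀})).toMonoidHom).comp (MonoidAlgebra.of ℂ P)

theorem modelMon_self (p₀ : P) : modelMon p₀ p₀ = 0 :=
  Ideal.Quotient.eq_zero_iff_mem.mpr (Ideal.mem_span_singleton_self _)

theorem modelMon_eq_zero {p₀ p : P} (h : p₀ ∣ p) : modelMon p₀ p = 0 := by
  obtain ⟨c, rfl⟩ := h
  rw [map_mul, modelMon_self, zero_mul]

/-- The preimage of a monomial ideal under the quotient map is the monomial ideal with `p₀` added to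
the generators, so membership is tested on each monomial separately. -/
theorem mk_mem_span_modelMon {p₀ : P} {T : Set P} {σ : MonoidAlgebra ℂ P}
    (h : (Ideal.Quotient.mk _ σ : modelRing P p₀) ∈ Ideal.span (modelMon p₀ '' T)) :
    ∀ m ∈ σ.coeff.support, p₀ ∣ m ∨ ∃ t ∈ T, t ∣ m := by
  have h1 : Ideal.span (modelMon p₀ '' T) =
      (Ideal.span (MonoidAlgebra.of ℂ P '' T)).map (Ideal.Quotient.mk _) := by
    rw [Ideal.map_span, ← Set.image_comp]
    rfl
  have h2 : σ ∈ Ideal.span (MonoidAlgebra.of ℂ P '' (insert p₀ T)) := by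
    rw [h1, ← Ideal.mem_comap, Ideal.comap_map_of_surjective _ Ideal.Quotient.mk_surjective,
      ← RingHom.ker_eq_comap_bot, Ideal.mk_ker] at h
    rw [Set.image_insert_eq, Ideal.span_insert, sup_comm]
    exact h
  intro m hm
  obtain ⟨t, ht, d, rfl⟩ := MonoidAlgebra.mem_ideal_span_of_image.mp h2 m hm
  rcases ht with rfl | ht
  · exact Or.inl ⟨d, mul_comm _ _⟩
  · exact Or.inr ⟨t, ht, d, mul_comm _ _⟩

theorem exists_mem_support_of_notMem {p₀ : P} {q : Ideal (modelRing P p₀)} {σ : MonoidAlgebra ℂ P}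
    (h : (Ideal.Quotient.mk _ σ : modelRing P p₀) ∉ q) :
    ∃ g ∈ σ.coeff.support, modelMon p₀ g ∉ q := by
  by_contra! hall
  apply h
  rw [← MonoidAlgebra.sum_coeff_single σ, Finsupp.sum, map_sum]
  refine Ideal.sum_mem _ fun g hg => ?_
  have : MonoidAlgebra.single g (σ.coeff g) = algebraMap ℂ _ (σ.coeff g) * MonoidAlgebra.of ℂ P g := by
    simp [MonoidAlgebra.single_mul_single]
  rw [this, map_mul]
  exact Ideal.mul_mem_left _ _ (hall g hg)

/-- Some monomial `g` in the support of a lift of `s` lies outside `q`. As `P` is cancellative,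
distinct monomials of the lift remain distinct after multiplication by `p`, so `p * g` is in the
support of an element of a monomial ideal. This turns localization at `q` into divisibility in the
monoid. -/
theorem exists_dvd_of_mul_mem_span [IsCancelMul P] {p₀ : P} {q : Ideal (modelRing P p₀)}
    {s : modelRing P p₀} (hs : s ∉ q) {p : P} {T : Set P}
    (h : s * modelMon p₀ p ∈ Ideal.span (modelMon p₀ '' T)) :
    ∃ g, modelMon p₀ g ∉ q ∧ (p₀ ∣ p * g ∨ ∃ t ∈ T, t ∣ p * g) := by
  obtain ⟨σ, rfl⟩ := Ideal.Quotient.mk_surjective s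
  obtain ⟨g, hg, hgq⟩ := exists_mem_support_of_notMem hs
  refine ⟨g, hgq, mk_mem_span_modelMon (σ := σ * MonoidAlgebra.of ℂ P p) (by rwa [map_mul]) _ ?_⟩
  rw [Finsupp.mem_support_iff] at hg ⊢
  rw [mul_comm p g, MonoidAlgebra.of_apply, MonoidAlgebra.coeff_mul_single_eq_coeff_mul, mul_one]
  · exact hg
  · intro a _
    exact mul_left_inj p

theorem exists_dvd_of_mul_eq_zero [IsCancelMul P] {p₀ : P} {q : Ideal (modelRing P p₀)}
    {s : modelRing P p₀} (hs : s ∉ q) {p : P} (h : s * modelMon p₀ p = 0) :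
    ∃ g, modelMon p₀ g ∉ q ∧ p₀ ∣ p * g := by
  obtain ⟨g, hg, h⟩ := exists_dvd_of_mul_mem_span (T := ∅) hs (p := p) (by rw [h]; exact zero_mem _)
  exact ⟨g, hg, h.resolve_right (by simp)⟩

/-- If `z ^ u - c` is, up to an element outside the prime `q`, nilpotent modulo monomials in `q`, then
`u` is torsion. -/
theorem exists_pow_eq_one_of_mul_mem_span [IsCancelMul P] {p₀ : P} {q : Ideal (modelRing P p₀)}
    [q.IsPrime] {s : modelRing P p₀} (hs : s ∉ q) {u : P} (hu : modelMon p₀ u ∉ q) {c : ℂ}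
    {n : ℕ} {T : Set P} (hT : ∀ t ∈ T, modelMon p₀ t ∈ q)
    (h : s * (modelMon p₀ u - algebraMap ℂ _ c) ^ n ∈ Ideal.span (modelMon p₀ '' T)) :
    ∃ k, 0 < k ∧ u ^ k = 1 := by
  by_contra! htor
  obtain ⟨σ, rfl⟩ := Ideal.Quotient.mk_surjective s
  -- Multiplication by `u - c` keeps some monomial outside `q` in the support. Otherwise the
  -- coefficients satisfy a recursion along `g, g u, g u ^ 2, …` that makes all of them nonzero, and
  -- for `u` of infinite order the support would be infinite.
  have step : ∀ σ : MonoidAlgebra ℂ P, (∃ g ∈ σ.coeff.support, modelMon p₀ g ∉ q) →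
      ∃ g ∈ (σ * (MonoidAlgebra.of ℂ P u - algebraMap ℂ _ c)).coeff.support, modelMon p₀ g ∉ q := by
    intro σ hσ
    by_contra! hall
    obtain ⟨g, hg, hgq⟩ := hσ
    have hgu : ∀ n : ℕ, modelMon p₀ (g * u ^ n) ∉ q := fun n => by
      rw [map_mul, map_pow]
      exact fun hmem => (Ideal.IsPrime.mem_or_mem ‹_› hmem).elim hgq
        fun h' => hu (Ideal.IsPrime.mem_of_pow_mem ‹_› _ h')
    have hmem : ∀ n : ℕ, σ.coeff (g * u ^ n) ≠ 0 := by
      intro n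
      induction n with
      | zero => simpa using hg
      | succ n ih =>
        have h0 : (σ * (MonoidAlgebra.of ℂ P u - algebraMap ℂ _ c)).coeff (g * u ^ (n + 1)) = 0 := by
          by_contra hne
          exact hgu (n + 1) (hall _ (Finsupp.mem_support_iff.mpr hne))
        have e1 : (σ * MonoidAlgebra.of ℂ P u).coeff (g * u ^ (n + 1)) = σ.coeff (g * u ^ n) := by
          rw [pow_succ, ← mul_assoc, MonoidAlgebra.of_apply,
            MonoidAlgebra.coeff_mul_single_eq_coeff_mul, mul_one]
          intro a _
          exact mul_left_inj u
        have e2 : (σ * algebraMap ℂ _ c).coeff (g * u ^ (n + 1)) = σ.coeff (g * u ^ (n + 1)) * c := by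
          rw [mul_comm, ← Algebra.smul_def, MonoidAlgebra.coeff_smul, Finsupp.smul_apply, smul_eq_mul,
            mul_comm]
        rw [mul_sub, MonoidAlgebra.coeff_sub, Finsupp.sub_apply, e1, e2, sub_eq_zero] at h0
        intro hz
        rw [hz, zero_mul] at h0
        exact ih h0
    obtain ⟨m, n, hne, heq⟩ := Finite.exists_ne_map_eq_of_infinite
      fun n : ℕ => (⟨g * u ^ n, Finsupp.mem_support_iff.mpr (hmem n)⟩ : σ.coeff.support)
    wlog hmn : m < n generalizing m n
    · exact this n m hne.symm heq.symm (lt_of_le_of_ne (not_lt.mp hmn) hne.symm)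
    obtain ⟨d, rfl⟩ := Nat.exists_eq_add_of_lt hmn
    have e := mul_left_cancel (congrArg Subtype.val heq)
    rw [add_assoc, pow_add] at e
    exact htor (d + 1) d.succ_pos (mul_left_cancel (e.symm.trans (mul_one _).symm))
  have steps : ∀ n : ℕ, ∃ g ∈ (σ * (MonoidAlgebra.of ℂ P u - algebraMap ℂ _ c) ^ n).coeff.support,
      modelMon p₀ g ∉ q := by
    intro n
    induction n with
    | zero => simpa using exists_mem_support_of_notMem hs
    | succ n ih =>
      rw [pow_succ, ← mul_assoc]
      exact step _ ih
  obtain ⟨g, hg, hgq⟩ := steps n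
  refine hgq ?_
  have e : (Ideal.Quotient.mk _ (MonoidAlgebra.of ℂ P u - algebraMap ℂ _ c) : modelRing P p₀) =
      modelMon p₀ u - algebraMap ℂ _ c := map_sub _ _ _
  rw [← e, ← map_pow, ← map_mul] at h
  rcases mk_mem_span_modelMon h g hg with hd | ⟨t, ht, hd⟩
  · rw [modelMon_eq_zero hd]
    exact zero_mem _
  · obtain ⟨d, rfl⟩ := hd
    rw [map_mul]
    exact Ideal.mul_mem_right _ _ (hT t ht)

end Model

/-- Either `x` is nilpotent modulo `I` in the localization at the prime `q`, or some prime between `I`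
and `q` does not contain `x`. -/
theorem exists_mul_pow_mem_or_exists_prime {A : Type*} [CommRing A] (q : Ideal A) [hq : q.IsPrime]
    (I : Ideal A) (x : A) :
    (∃ s ∉ q, ∃ n : ℕ, s * x ^ n ∈ I) ∨ ∃ q' : Ideal A, q'.IsPrime ∧ I ≤ q' ∧ q' ≤ q ∧ x ∉ q' := by
  -- The multiplicative set generated by `x` and the complement of `q` either meets `I` or avoids a
  -- prime that contains `I`.
  by_cases h : Disjoint (I : Set A) (q.primeCompl ⊔ Submonoid.powers x : Submonoid A)
  · obtain ⟨q', hq', hI, hdis⟩ := Ideal.exists_le_prime_disjoint I _ h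
    have notMem : ∀ a ∈ (q.primeCompl ⊔ Submonoid.powers x : Submonoid A), a ∉ q' :=
      fun a ha ha' => Set.disjoint_left.mp hdis ha' ha
    refine Or.inr ⟨q', hq', hI, fun a ha => ?_, notMem x ?_⟩
    · by_contra haq
      exact notMem a (Submonoid.mem_sup_left haq) ha
    · exact Submonoid.mem_sup_right (Submonoid.mem_powers x)
  · rw [Set.not_disjoint_iff] at h
    obtain ⟨a, haI, ha⟩ := h
    obtain ⟨s, hs, _, ⟨n, rfl⟩, rfl⟩ := Submonoid.mem_sup.mp ha
    exact Or.inl ⟨s, hs, n, haI⟩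

/-- If `x` vanishes in a flat local algebra, then it is annihilated by an element which does not
vanish at the closed point. -/
theorem exists_mul_eq_zero_of_flat {A O : Type*} [CommRing A] [CommRing O] [IsLocalRing O]
    [Algebra A O] [Module.Flat A O] {x : A} (hx : algebraMap A O x = 0) :
    ∃ s ∉ (maximalIdeal O).under A, s * x = 0 := by
  -- Equational criterion for the relation `x • 1 = 0`: it writes `1` as a combination of elements
  -- `a j` which annihilate `x`. They cannot all vanish at the closed point.
  obtain ⟨k, a, y, hy, ha⟩ := Module.Flat.isTrivialRelation_of_sum_smul_eq_zero
    (f := fun _ : Unit => x) (x := fun _ => (1 : O)) (by simp [Algebra.smul_def, hx])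
  by_contra! hall
  have h1 : (1 : O) ∈ maximalIdeal O := by
    rw [show (1 : O) = ∑ j, a () j • y j from hy ()]
    refine Ideal.sum_mem _ fun j _ => ?_
    rw [Algebra.smul_def]
    refine Ideal.mul_mem_right _ _ ?_
    by_contra hn
    exact hall (a () j) hn (by simpa [mul_comm] using ha j)
  exact (Ideal.ne_top_iff_one _).mp (maximalIdeal.isMaximal O).ne_top h1

end LogTrop
end

noncomputable section

namespace LogTrop

open IsLocalRing

/-! ### Local rings of log smooth curves -/

section LogLocal

variable {P : Type} [CommMonoid P] {p₀ : P} {O : Type} [CommRing O] [Algebra (modelRing P p₀) O]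

variable (O) in
/-- The images of the monomials in an algebra over the toric model. -/
def algMon (p₀ : P) [Algebra (modelRing P p₀) O] : P →* O :=
  (algebraMap (modelRing P p₀) O).toMonoidHom.comp (modelMon p₀)

theorem algMon_eq_zero {p : P} (h : p₀ ∣ p) : algMon O p₀ p = 0 := by
  change algebraMap _ O (modelMon p₀ p) = 0
  rw [modelMon_eq_zero h, map_zero]

variable [IsCancelMul P] [Module.Flat (modelRing P p₀) O]

/-- A monomial in a minimal prime has a power which is divisible by `p₀`, up to a monomial outside that
prime. -/
theorem exists_dvd_of_mem_minimal {𝔭 : Ideal O} [𝔭.IsPrime]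
    (hmin : ∀ q : Ideal O, q.IsPrime → ¬ q < 𝔭) {p : P} (hp : algMon O p₀ p ∈ 𝔭) :
    ∃ (n : ℕ) (g : P), algMon O p₀ g ∉ 𝔭 ∧ p₀ ∣ p ^ n * g := by
  -- If `p` is not nilpotent in the localization at the image of `𝔭`, there is a strictly smaller
  -- prime of the model, and going down contradicts minimality.
  rcases exists_mul_pow_mem_or_exists_prime (𝔭.under (modelRing P p₀)) ⊥ (modelMon p₀ p) with
    ⟨s, hs, n, h⟩ | ⟨q', hq', -, hle, hx⟩
  · obtain ⟨g, hg, hd⟩ := exists_dvd_of_mul_eq_zero hs (p := p ^ n) (by rwa [map_pow])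
    exact ⟨n, g, hg, hd⟩
  · have hlt : q' < 𝔭.under (modelRing P p₀) := lt_of_le_of_ne hle fun h => hx (h ▸ hp)
    have : 𝔭.LiesOver (𝔭.under (modelRing P p₀)) := ⟨rfl⟩
    obtain ⟨Q, hQ, hQp, -⟩ := Ideal.exists_ideal_lt_liesOver_of_lt 𝔭 hlt
    exact absurd hQ (hmin Q hQp)

variable [IsLocalRing O]

/-- A monomial which vanishes is divisible by `p₀`, up to a monomial which is a unit. -/
theorem exists_dvd_of_algMon_eq_zero {p : P} (h : algMon O p₀ p = 0) :
    ∃ f, IsUnit (algMon O p₀ f) ∧ p₀ ∣ p * f := by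
  obtain ⟨s, hs, hs0⟩ := exists_mul_eq_zero_of_flat (A := modelRing P p₀) (O := O) h
  obtain ⟨g, hg, hd⟩ := exists_dvd_of_mul_eq_zero hs hs0
  exact ⟨g, by_contra fun hn => hg hn, hd⟩

/-- The monomials of `𝔭` together with a single monomial `s` outside `𝔭` already cut out the closed
point. A smaller `q` which contains them would either force `s` into `𝔭`, or lie above a still
smaller prime; going down would then produce three primes in a chain of `O`. -/
theorem eq_under_maximalIdeal
    (dim : ∀ p q : Ideal O, p.IsPrime → q.IsPrime → p < q → q = maximalIdeal O)
    {𝔭 : Ideal O} [𝔭.IsPrime] {s : P} (hs : algMon O p₀ s ∉ 𝔭)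
    {q : Ideal (modelRing P p₀)} [q.IsPrime]
    (hq : q ≤ (maximalIdeal O).under _)
    (h𝔭 : ∀ p, algMon O p₀ p ∈ 𝔭 → modelMon p₀ p ∈ q) (hsq : modelMon p₀ s ∈ q) :
    q = (maximalIdeal O).under _ := by
  by_contra hne
  rcases exists_mul_pow_mem_or_exists_prime q ⊥ (modelMon p₀ s) with
    ⟨t, ht, n, h⟩ | ⟨q', hq', -, hle, hx⟩
  · obtain ⟨g, hg, hd⟩ := exists_dvd_of_mul_eq_zero ht (p := s ^ n) (by rwa [map_pow])
    have h0 : algMon O p₀ (s ^ n * g) ∈ 𝔭 := by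
      rw [algMon_eq_zero hd]
      exact zero_mem _
    rw [map_mul, map_pow] at h0
    rcases Ideal.IsPrime.mem_or_mem ‹_› h0 with h0 | h0
    · exact hs (Ideal.IsPrime.mem_of_pow_mem ‹_› _ h0)
    · exact hg (h𝔭 g h0)
  · have hlt : q' < q := lt_of_le_of_ne hle fun h => hx (h ▸ hsq)
    have : (maximalIdeal O).LiesOver ((maximalIdeal O).under (modelRing P p₀)) := ⟨rfl⟩
    obtain ⟨Q, hQ, hQp, hQq⟩ := Ideal.exists_ideal_lt_liesOver_of_lt (maximalIdeal O)
      (lt_of_le_of_ne hq hne)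
    obtain ⟨Q', hQ', hQp', -⟩ := Ideal.exists_ideal_lt_liesOver_of_lt Q hlt
    exact hQ.ne (dim Q' Q hQp' hQp hQ')

/-- Every function vanishing at the closed point is nilpotent, in the localization of the model
there, modulo `s` and the monomials of `𝔭`. It is used for monomials and for differences of a
monomial and a constant. -/
theorem exists_mul_pow_mem_span
    (dim : ∀ p q : Ideal O, p.IsPrime → q.IsPrime → p < q → q = maximalIdeal O)
    {𝔭 : Ideal O} [𝔭.IsPrime] {s : P} (hs : algMon O p₀ s ∉ 𝔭)
    {x : modelRing P p₀} (hx : algebraMap _ O x ∈ maximalIdeal O) :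
    ∃ t ∉ (maximalIdeal O).under (modelRing P p₀), ∃ n : ℕ,
      t * x ^ n ∈ Ideal.span (modelMon p₀ '' insert s {p | algMon O p₀ p ∈ 𝔭}) := by
  rcases exists_mul_pow_mem_or_exists_prime ((maximalIdeal O).under (modelRing P p₀))
    (Ideal.span (modelMon p₀ '' insert s {p | algMon O p₀ p ∈ 𝔭})) x with h | ⟨q', hq', hI, hle, h⟩
  · exact h
  · have mem : ∀ p ∈ insert s {p | algMon O p₀ p ∈ 𝔭}, modelMon p₀ p ∈ q' :=
      fun p hp => hI (Ideal.subset_span ⟨p, hp, rfl⟩)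
    have := eq_under_maximalIdeal dim hs hle (fun p hp => mem p (Or.inr hp)) (mem s (Or.inl rfl))
    exact absurd (this ▸ hx) h

/-- On a branch, any two monomials which vanish at the closed point divide powers of each other. -/
theorem exists_dvd_pow_mul
    (dim : ∀ p q : Ideal O, p.IsPrime → q.IsPrime → p < q → q = maximalIdeal O)
    {𝔭 : Ideal O} [𝔭.IsPrime] {s : P} (hs : algMon O p₀ s ∉ 𝔭)
    {a : P} (ha : algMon O p₀ a ∉ 𝔭)
    (ha' : algMon O p₀ a ∈ maximalIdeal O) :
    ∃ (n : ℕ) (f : P), IsUnit (algMon O p₀ f) ∧ s ∣ a ^ n * f := by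
  obtain ⟨t, ht, n, h⟩ := exists_mul_pow_mem_span dim hs ha'
  rw [← map_pow] at h
  obtain ⟨g, hg, hd⟩ := exists_dvd_of_mul_mem_span ht h
  have hgu : IsUnit (algMon O p₀ g) := by_contra fun hn => hg hn
  have notMem : algMon O p₀ (a ^ n * g) ∉ 𝔭 := by
    rw [map_mul, map_pow, Ideal.mul_unit_mem_iff_mem _ hgu]
    exact fun h' => ha (Ideal.IsPrime.mem_of_pow_mem ‹_› _ h')
  refine ⟨n, g, hgu, ?_⟩
  -- Divisibility by `p₀`, or by a monomial of `𝔭`, would put `a ^ n * g` into `𝔭`; only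
  -- divisibility by `s` remains.
  rcases hd with hd | ⟨p, hp | hp, hd⟩
  · exact absurd ((algMon_eq_zero (O := O) hd).symm ▸ zero_mem 𝔭) notMem
  · exact hp ▸ hd
  · obtain ⟨c, hc⟩ := hd
    refine absurd ?_ notMem
    rw [hc, map_mul]
    exact Ideal.mul_mem_right _ _ hp

variable [Algebra ℂ O] [IsScalarTower ℂ (modelRing P p₀) O]

/-- An invertible monomial is equal to its value at the closed point. -/
theorem algMon_eq_algebraMap
    (dim : ∀ p q : Ideal O, p.IsPrime → q.IsPrime → p < q → q = maximalIdeal O)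
    {𝔭 : Ideal O} [𝔭.IsPrime] {s : P} (hs : algMon O p₀ s ∉ 𝔭)
    (hs' : algMon O p₀ s ∈ maximalIdeal O)
    (ψ : O →ₐ[ℂ] ℂ) {u : P} (hu : IsUnit (algMon O p₀ u)) :
    algMon O p₀ u = algebraMap ℂ O (ψ (algMon O p₀ u)) := by
  set c := ψ (algMon O p₀ u)
  have hc : c ≠ 0 := (hu.map ψ).ne_zero
  have mem := sub_algebraMap_mem_maximalIdeal ψ (algMon O p₀ u)
  obtain ⟨t, ht, n, h⟩ := exists_mul_pow_mem_span dim hs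
    (x := modelMon p₀ u - algebraMap ℂ _ c) (by
      rwa [map_sub, ← IsScalarTower.algebraMap_apply ℂ (modelRing P p₀) O])
  -- An invertible monomial of infinite order would give the model another dimension, so `u` has
  -- finite order.
  obtain ⟨k, hk, huk⟩ := exists_pow_eq_one_of_mul_mem_span (q := (maximalIdeal O).under _) ht
    (u := u) (fun hn => hn hu) (c := c) (by
      rintro p (rfl | hp)
      · exact hs'
      · exact le_maximalIdeal (Ideal.IsPrime.ne_top ‹_›) hp) h
  set v := algMon O p₀ u
  have hv : v ^ k = 1 := by rw [← map_pow, huk, map_one]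
  have hck : c ^ k = 1 := by rw [← map_pow, hv, map_one]
  have fac := (Commute.all v (algebraMap ℂ O c)).geom_sum₂_mul k
  rw [hv, ← map_pow, hck, map_one, sub_self] at fac
  -- The cofactor of `v - c` in `v ^ k - c ^ k = 0` has value `k * c ^ (k - 1)` at the closed point,
  -- which is not zero in characteristic zero.
  have hunit : IsUnit (∑ i ∈ Finset.range k, v ^ i * algebraMap ℂ O c ^ (k - 1 - i)) := by
    by_contra hn
    have := (map_eq_zero_iff_mem_maximalIdeal ψ _).mpr hn
    rw [map_sum] at this
    have e : ∀ i ∈ Finset.range k, ψ (v ^ i * algebraMap ℂ O c ^ (k - 1 - i)) = c ^ (k - 1) := by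
      intro i hi
      rw [Finset.mem_range] at hi
      rw [map_mul, map_pow, map_pow, AlgHom.commutes]
      change c ^ i * c ^ (k - 1 - i) = _
      rw [← pow_add]
      congr 1
      omega
    rw [Finset.sum_congr rfl e, Finset.sum_const, Finset.card_range, nsmul_eq_mul] at this
    exact mul_ne_zero (Nat.cast_ne_zero.mpr hk.ne') (pow_ne_zero _ hc) this
  exact sub_eq_zero.mp ((hunit.mul_right_eq_zero).mp fac)

/-- The maximal ideal is generated by monomials. -/
theorem maximalIdeal_eq_span [IsNoetherianRing O] [Algebra.FormallySmooth (modelRing P p₀) O]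
    (dim : ∀ p q : Ideal O, p.IsPrime → q.IsPrime → p < q → q = maximalIdeal O)
    {𝔭 : Ideal O} [𝔭.IsPrime] {s : P} (hs : algMon O p₀ s ∉ 𝔭)
    (hs' : algMon O p₀ s ∈ maximalIdeal O)
    (ψ : O →ₐ[ℂ] ℂ) :
    maximalIdeal O = Ideal.span (algMon O p₀ '' {p | algMon O p₀ p ∈ maximalIdeal O}) := by
  let q := RingHom.ker (ψ.toRingHom.comp (algebraMap (modelRing P p₀) O))
  have hq : q = (maximalIdeal O).under (modelRing P p₀) := by
    ext a
    exact map_eq_zero_iff_mem_maximalIdeal ψ _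
  -- The fibre over the closed point of the model has dimension zero: another prime in it would lie,
  -- by going down, above a prime over that of `𝔭`, which is too long a chain. Smoothness then makes
  -- `O` unramified over the model at this point.
  have hmap : q.map (algebraMap _ O) = maximalIdeal O := by
    refine map_ker_eq_maximalIdeal ψ fun n hn hle => ?_
    by_contra hne
    have hnlt : n < maximalIdeal O := lt_of_le_of_ne (le_maximalIdeal hn.ne_top) hne
    have hn' : n.LiesOver ((maximalIdeal O).under (modelRing P p₀)) := by
      refine ⟨le_antisymm ?_ (Ideal.comap_mono hnlt.le)⟩
      rw [← hq]
      exact Ideal.map_le_iff_le_comap.mp hle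
    have hlt : 𝔭.under (modelRing P p₀) < (maximalIdeal O).under (modelRing P p₀) := by
      refine lt_of_le_of_ne (Ideal.comap_mono (le_maximalIdeal (Ideal.IsPrime.ne_top ‹_›))) ?_
      intro h
      have : modelMon p₀ s ∈ (maximalIdeal O).under (modelRing P p₀) := hs'
      rw [← h] at this
      exact hs this
    obtain ⟨Q, hQ, hQp, -⟩ := Ideal.exists_ideal_lt_liesOver_of_lt n hlt
    exact hne (dim Q n hQp hn hQ)
  refine le_antisymm ?_ (Ideal.span_le.mpr ?_)
  · refine hmap.symm.le.trans (Ideal.map_le_iff_le_comap.mpr fun a ha => ?_)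
    have ha' : ψ (algebraMap _ O a) = 0 := ha
    rw [Ideal.mem_comap]
    obtain ⟨σ, rfl⟩ := Ideal.Quotient.mk_surjective a
    -- By linearity it suffices to compare a monomial with its value: an invertible monomial equals
    -- its value, and any other is a generator with value `0`.
    have key : ∀ σ : MonoidAlgebra ℂ P,
        algebraMap (modelRing P p₀) O (Ideal.Quotient.mk _ σ) -
          algebraMap ℂ O (ψ (algebraMap (modelRing P p₀) O (Ideal.Quotient.mk _ σ))) ∈
        Ideal.span (algMon O p₀ '' {p | algMon O p₀ p ∈ maximalIdeal O}) := by
      intro σ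
      induction σ using MonoidAlgebra.induction_linear with
      | zero => simp
      | add f g hf hg =>
        simp only [map_add]
        rw [add_sub_add_comm]
        exact Ideal.add_mem _ hf hg
      | single p c =>
        have e : algebraMap (modelRing P p₀) O (Ideal.Quotient.mk _ (MonoidAlgebra.single p c)) =
            algebraMap ℂ O c * algMon O p₀ p := by
          have : MonoidAlgebra.single p c = algebraMap ℂ _ c * MonoidAlgebra.of ℂ P p := by
            simp [MonoidAlgebra.single_mul_single]
          rw [this, map_mul, map_mul, IsScalarTower.algebraMap_apply ℂ (modelRing P p₀) O]
          rfl
        rw [e, map_mul, AlgHom.commutes, map_mul, Algebra.algebraMap_self_apply, ← mul_sub]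
        refine Ideal.mul_mem_left _ _ ?_
        by_cases hp : IsUnit (algMon O p₀ p)
        · rw [algMon_eq_algebraMap dim hs hs' ψ hp]
          simp
        · have hp' : algMon O p₀ p ∈ maximalIdeal O := hp
          rw [(map_eq_zero_iff_mem_maximalIdeal ψ _).mpr hp', map_zero, sub_zero]
          exact Ideal.subset_span ⟨p, hp', rfl⟩
    have := key σ
    rwa [ha', map_zero, sub_zero] at this
  · rintro _ ⟨p, hp, rfl⟩
    exact hp

end LogLocal

end LogTrop
end

noncomputable section

namespace LogTrop

open IsLocalRing

/-! ### The structure of a log smooth curve at a node -/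

section Node

variable {P : Type} [CommMonoid P] {p₀ : P} {O : Type} [CommRing O] [Algebra (modelRing P p₀) O]
  {Q : Type} [AddCommMonoid Q]

variable (O p₀) in
/-- `π` identifies `Q` with the quotient of `P` by the monomials which are units in `O`. -/
structure IsGhostMap (π : Additive P →+ Q) : Prop where
  surj : Function.Surjective π
  eq_iff : ∀ p p' : P, π (.ofMul p) = π (.ofMul p') ↔
    ∃ f f', IsUnit (algMon O p₀ f) ∧ IsUnit (algMon O p₀ f') ∧ p * f = p' * f'

variable {π : Additive P →+ Q}

theorem pi_mul (p q : P) : π (.ofMul (p * q)) = π (.ofMul p) + π (.ofMul q) := map_add π _ _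

theorem pi_pow (p : P) (n : ℕ) : π (.ofMul (p ^ n)) = n • π (.ofMul p) := map_nsmul π _ _

namespace IsGhostMap

theorem exists_eq (h : IsGhostMap p₀ O π) (a : Q) : ∃ p : P, π (.ofMul p) = a := h.surj a

theorem exists_add_iff (h : IsGhostMap p₀ O π) {a b : P} :
    (∃ c, π (.ofMul a) = π (.ofMul b) + c) ↔ ∃ f, IsUnit (algMon O p₀ f) ∧ b ∣ a * f := by
  constructor
  · rintro ⟨c, hc⟩
    obtain ⟨q, rfl⟩ := h.exists_eq c
    rw [← pi_mul] at hc
    obtain ⟨f, f', hf, -, e⟩ := (h.eq_iff _ _).mp hc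
    exact ⟨f, hf, q * f', by rw [e, mul_assoc]⟩
  · rintro ⟨f, hf, q, e⟩
    refine ⟨π (.ofMul q), ?_⟩
    rw [← pi_mul]
    exact (h.eq_iff _ _).mpr ⟨f, 1, hf, by simp, by rw [e, mul_one]⟩

theorem eq_zero_iff (h : IsGhostMap p₀ O π) (p : P) :
    π (.ofMul p) = 0 ↔ IsUnit (algMon O p₀ p) := by
  rw [show (0 : Q) = π (.ofMul 1) from (map_zero π).symm, h.eq_iff]
  constructor
  · rintro ⟨f, f', hf, hf', e⟩
    refine isUnit_of_mul_isUnit_left (y := algMon O p₀ f) ?_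
    rwa [← map_mul, e, one_mul]
  · intro hp
    exact ⟨1, p, by simp, hp, mul_comm _ _⟩

theorem sharp (h : IsGhostMap p₀ O π) (a b : Q) (hab : a + b = 0) : a = 0 := by
  obtain ⟨p, rfl⟩ := h.exists_eq a
  obtain ⟨q, rfl⟩ := h.exists_eq b
  rw [← pi_mul, h.eq_zero_iff, map_mul] at hab
  exact (h.eq_zero_iff p).mpr (isUnit_of_mul_isUnit_left hab)

/-- The face of the monomials which do not vanish along the subscheme of a prime ideal. -/
def face (_ : IsGhostMap p₀ O π) (𝔭 : Ideal O) [𝔭.IsPrime] : AddSubmonoid Q where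
  carrier := {a | ∃ p : P, π (.ofMul p) = a ∧ algMon O p₀ p ∉ 𝔭}
  zero_mem' := ⟨1, map_zero π, by
    rw [map_one]
    exact fun h => Ideal.IsPrime.ne_top ‹_› ((Ideal.eq_top_iff_one _).mpr h)⟩
  add_mem' := by
    rintro _ _ ⟨p, rfl, hp⟩ ⟨q, rfl, hq⟩
    refine ⟨p * q, pi_mul p q, ?_⟩
    rw [map_mul]
    exact fun h => (Ideal.IsPrime.mem_or_mem ‹_› h).elim hp hq

theorem mem_face (h : IsGhostMap p₀ O π) (𝔭 : Ideal O) [𝔭.IsPrime] (p : P) :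
    π (.ofMul p) ∈ h.face 𝔭 ↔ algMon O p₀ p ∉ 𝔭 := by
  constructor
  · rintro ⟨q, e, hq⟩ hp
    obtain ⟨f, f', hf, hf', e⟩ := (h.eq_iff _ _).mp e
    apply hq
    rw [← Ideal.mul_unit_mem_iff_mem 𝔭 hf, ← map_mul, e, map_mul]
    exact Ideal.mul_mem_right _ _ hp
  · exact fun hp => ⟨p, rfl, hp⟩

theorem mem_face_of_add_mem (h : IsGhostMap p₀ O π) (𝔭 : Ideal O) [𝔭.IsPrime] (a b : Q)
    (hab : a + b ∈ h.face 𝔭) : a ∈ h.face 𝔭 := by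
  obtain ⟨p, rfl⟩ := h.exists_eq a
  obtain ⟨q, rfl⟩ := h.exists_eq b
  rw [← pi_mul, h.mem_face, map_mul] at hab
  rw [h.mem_face]
  exact fun hp => hab (Ideal.mul_mem_right _ _ hp)

end IsGhostMap

variable [IsCancelMul P] [Module.Flat (modelRing P p₀) O]

/-- This supplies the divisibility by `z` which defines the order of vanishing along a branch. -/
theorem IsGhostMap.exists_add_of_notMem_face (h : IsGhostMap p₀ O π) {𝔭 : Ideal O} [𝔭.IsPrime]
    (hmin : ∀ q : Ideal O, q.IsPrime → ¬ q < 𝔭) (a : Q) (ha : a ∉ h.face 𝔭) :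
    ∃ n : ℕ, ∃ g ∈ h.face 𝔭, ∃ c, n • a + g = π (.ofMul p₀) + c := by
  obtain ⟨p, rfl⟩ := h.exists_eq a
  rw [h.mem_face, not_not] at ha
  obtain ⟨n, g, hg, c, hc⟩ := exists_dvd_of_mem_minimal hmin ha
  refine ⟨n, _, (h.mem_face 𝔭 g).mpr hg, π (.ofMul c), ?_⟩
  rw [← pi_pow, ← pi_mul, ← pi_mul, hc]

variable [IsLocalRing O]

/-- Translates the geometry of `O` into the hypotheses on the monoid: reducedness gives `red`,
minimality of the branches gives `div₁` and `div₂`, and dimension one gives `arch`. -/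
theorem IsGhostMap.exists_isNodeChart [IsReduced O] (h : IsGhostMap p₀ O π)
    [Monoid.FG P] [IsCancelAdd Q]
    (sat : ∀ (a b : Q) (n : ℕ), 0 < n → (∃ c, n • a = n • b + c) → ∃ c, a = b + c)
    (dim : ∀ p q : Ideal O, p.IsPrime → q.IsPrime → p < q → q = maximalIdeal O)
    {𝔭₁ 𝔭₂ : Ideal O} [𝔭₁.IsPrime] [𝔭₂.IsPrime] {p₁ p₂ : P} {l : ℕ} (hl : 0 < l)
    (hs : π (.ofMul p₁) + π (.ofMul p₂) = l • π (.ofMul p₀))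
    (h₁ : algMon O p₀ p₁ ∈ maximalIdeal O) (h₂ : algMon O p₀ p₂ ∈ maximalIdeal O)
    (h₁₂ : algMon O p₀ p₁ ∉ 𝔭₂) (h₂₁ : algMon O p₀ p₂ ∉ 𝔭₁) :
    ∃ (e : ℕ) (h₁ h₂ : Q →+ ℕ), IsNodeChart (π (.ofMul p₀)) e h₁ h₂ ∧ h₁ (π (.ofMul p₁)) = l ∧
      h₁ (π (.ofMul p₂)) = 0 ∧ h₂ (π (.ofMul p₁)) = 0 ∧ h₂ (π (.ofMul p₂)) = l := by
  -- A prime which omits an element of the maximal ideal is not maximal, so the dimension leaves no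
  -- room below it.
  have min : ∀ 𝔭 : Ideal O, 𝔭.IsPrime → ∀ s ∈ maximalIdeal O, s ∉ 𝔭 →
      ∀ q : Ideal O, q.IsPrime → ¬ q < 𝔭 :=
    fun 𝔭 hp s hs hs' q hq hlt => hs' (dim q 𝔭 hq hp hlt ▸ hs)
  have fg : AddMonoid.FG Q := AddMonoid.fg_of_surjective π h.surj
  have zero : algMon O p₀ p₀ = 0 := algMon_eq_zero dvd_rfl
  have hz : ∀ (𝔭 : Ideal O) [𝔭.IsPrime], π (.ofMul p₀) ∉ h.face 𝔭 := by
    intro 𝔭 _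
    rw [h.mem_face, not_not, zero]
    exact zero_mem _
  refine LogTrop.exists_isNodeChart h.sharp sat hl hs (h.mem_face_of_add_mem 𝔭₁)
    (h.mem_face_of_add_mem 𝔭₂) (hz _) (hz _) ((h.mem_face _ _).mpr h₂₁) ((h.mem_face _ _).mpr h₁₂)
    ?_ (h.exists_add_of_notMem_face (min _ ‹_› _ h₂ h₂₁))
    (h.exists_add_of_notMem_face (min _ ‹_› _ h₁ h₁₂)) ?_
  · intro a n hn
    obtain ⟨p, rfl⟩ := h.exists_eq a
    rw [← pi_pow, h.exists_add_iff] at hn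
    obtain ⟨f, hf, hd⟩ := hn
    have := algMon_eq_zero (O := O) hd
    rw [map_mul, hf.mul_left_eq_zero, map_pow] at this
    exact h.exists_add_iff.mpr (exists_dvd_of_algMon_eq_zero (eq_zero_of_pow_eq_zero this))
  · intro a ha ha0
    obtain ⟨p, rfl⟩ := h.exists_eq a
    rw [h.mem_face] at ha
    rw [Ne, h.eq_zero_iff] at ha0
    obtain ⟨n, hn⟩ := exists_dvd_pow_mul dim h₂₁ ha ha0
    refine ⟨n, ?_⟩
    rw [← pi_pow]
    exact h.exists_add_iff.mpr hn

/-- On a branch where `x` vanishes, `y` generates the maximal ideal, and `p₂` is `y ^ w` up to a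
unit. The ideal `J` need only be radical and contained in `𝔭`, which covers the extension to `O` of
a prime of the curve. -/
theorem IsGhostMap.length_eq [IsNoetherianRing O] [Algebra.FormallySmooth (modelRing P p₀) O]
    [Algebra ℂ O] [IsScalarTower ℂ (modelRing P p₀) O] (ψ : O →ₐ[ℂ] ℂ) (h : IsGhostMap p₀ O π)
    (dim : ∀ p q : Ideal O, p.IsPrime → q.IsPrime → p < q → q = maximalIdeal O)
    {𝔭 : Ideal O} [𝔭.IsPrime] {p₁ p₂ : P} {l : ℕ} (hl : 0 < l)
    (h₂ : algMon O p₀ p₂ ∈ maximalIdeal O) (h₂₁ : algMon O p₀ p₂ ∉ 𝔭)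
    {e : ℕ} {k₁ k₂ : Q →+ ℕ} (H : IsNodeChart (π (.ofMul p₀)) e k₁ k₂)
    (v₁₁ : k₁ (π (.ofMul p₁)) = l) (v₁₂ : k₁ (π (.ofMul p₂)) = 0)
    (v₂₁ : k₂ (π (.ofMul p₁)) = 0) (v₂₂ : k₂ (π (.ofMul p₂)) = l)
    {J : Ideal O} (hJ : J.IsRadical) (hJ𝔭 : J ≤ 𝔭) (hpJ : algMon O p₀ p₁ ∈ J)
    {w : ℕ} (hw : l = w * e) :
    Module.length O (O ⧸ (J ⊔ Ideal.span {algMon O p₀ p₂})) = w := by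
  have he := H.pos
  have assoc : ∀ p p' : P, π (.ofMul p) = π (.ofMul p') →
      Associated (algMon O p₀ p) (algMon O p₀ p') := by
    intro p p' hpp
    obtain ⟨f, f', hf, hf', e⟩ := (h.eq_iff _ _).mp hpp
    have a₁ : Associated (algMon O p₀ p) (algMon O p₀ (p * f)) := by
      rw [map_mul]
      exact (associated_mul_unit_left _ _ hf).symm
    have a₂ : Associated (algMon O p₀ (p' * f')) (algMon O p₀ p') := by
      rw [map_mul]
      exact associated_mul_unit_left _ _ hf'
    exact a₁.trans (e ▸ a₂)
  obtain ⟨x, x₁, x₂⟩ := H.exists_x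
  obtain ⟨y, y₁, y₂⟩ := H.exists_y
  obtain ⟨x, rfl⟩ := h.exists_eq x
  obtain ⟨y, rfl⟩ := h.exists_eq y
  have hxw : π (.ofMul p₁) = π (.ofMul (x ^ w)) := by
    refine H.inj _ _ ?_ ?_ <;> rw [pi_pow, map_nsmul]
    · rw [x₁, v₁₁, hw, smul_eq_mul]
    · rw [x₂, v₂₁, smul_zero]
  have hyw : π (.ofMul p₂) = π (.ofMul (y ^ w)) := by
    refine H.inj _ _ ?_ ?_ <;> rw [pi_pow, map_nsmul]
    · rw [y₁, v₁₂, smul_zero]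
    · rw [y₂, v₂₂, hw, smul_eq_mul]
  -- Only `x ^ w` is known to lie in `J`; here radicality enters.
  have hx : algMon O p₀ x ∈ J := by
    refine hJ ⟨w, ?_⟩
    rw [← map_pow]
    exact Ideal.mem_of_dvd _ (assoc _ _ hxw).dvd hpJ
  have ay : Associated (algMon O p₀ p₂) (algMon O p₀ y ^ w) := by
    rw [← map_pow]
    exact assoc _ _ hyw
  have hw0 : w ≠ 0 := by
    rintro rfl
    omega
  have hy𝔭 : algMon O p₀ y ∉ 𝔭 := fun hy =>
    h₂₁ (Ideal.mem_of_dvd _ ay.dvd' (Ideal.pow_mem_of_mem _ hy _ (Nat.pos_of_ne_zero hw0)))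
  have hy : algMon O p₀ y ∈ maximalIdeal O :=
    Ideal.IsPrime.mem_of_pow_mem (maximalIdeal.isMaximal O).isPrime w
      (Ideal.mem_of_dvd _ ay.dvd h₂)
  have hspan : Ideal.span {algMon O p₀ p₂} = Ideal.span {algMon O p₀ y ^ w} :=
    le_antisymm (Ideal.span_singleton_le_span_singleton.mpr ay.dvd')
      (Ideal.span_singleton_le_span_singleton.mpr ay.dvd)
  rw [hspan]
  refine length_quotient_span_pow ?_ hy
    (fun k hk => hy𝔭 (Ideal.IsPrime.mem_of_pow_mem ‹_› k (hJ𝔭 hk))) w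
  rw [maximalIdeal_eq_span dim h₂₁ h₂ ψ, Ideal.span_le]
  rintro _ ⟨p, hp, rfl⟩
  have key : ∀ t : P, (∃ c, π (.ofMul p) = π (.ofMul t) + c) →
      algMon O p₀ t ∣ algMon O p₀ p := by
    rintro t ⟨c, hc⟩
    obtain ⟨c, rfl⟩ := h.exists_eq c
    rw [← pi_mul] at hc
    refine dvd_trans ?_ (assoc _ _ hc).dvd'
    rw [map_mul]
    exact dvd_mul_right _ _
  have ge : ∀ t : P, k₁ (π (.ofMul t)) ≤ k₁ (π (.ofMul p)) →
      k₂ (π (.ofMul t)) ≤ k₂ (π (.ofMul p)) → algMon O p₀ t ∣ algMon O p₀ p := by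
    intro t t₁ t₂
    obtain ⟨c, c₁, c₂⟩ := H.surj (k₁ (π (.ofMul p)) - k₁ (π (.ofMul t)))
      (k₂ (π (.ofMul p)) - k₂ (π (.ofMul t))) (by
        rw [Nat.cast_sub t₁, Nat.cast_sub t₂]
        have := dvd_sub (H.dvd (π (.ofMul p))) (H.dvd (π (.ofMul t)))
        rwa [sub_sub_sub_comm] at this)
    exact key t ⟨c, H.inj _ _ (by rw [map_add, c₁]; omega) (by rw [map_add, c₂]; omega)⟩
  have ne : ¬ (k₁ (π (.ofMul p)) = 0 ∧ k₂ (π (.ofMul p)) = 0) := by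
    rintro ⟨e₁, e₂⟩
    have : π (.ofMul p) = 0 := H.inj _ _ (by rw [e₁, map_zero]) (by rw [e₂, map_zero])
    exact hp ((h.eq_zero_iff p).mp this)
  have hd := H.dvd (π (.ofMul p))
  have pos_ge : ∀ n : ℕ, n ≠ 0 → (e : ℤ) ∣ n → e ≤ n := fun n hn hdvd =>
    Nat.le_of_dvd (Nat.pos_of_ne_zero hn) (Int.natCast_dvd_natCast.mp hdvd)
  -- On the axes, a nonzero coordinate is a multiple of `e`, hence at least `e`, and the monomial is
  -- divisible by `y` or by `x`. Off the axes it is divisible by `z`, hence zero.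
  by_cases c₁ : k₁ (π (.ofMul p)) = 0
  · have c₂ : k₂ (π (.ofMul p)) ≠ 0 := fun c₂ => ne ⟨c₁, c₂⟩
    rw [c₁, Nat.cast_zero, zero_sub, dvd_neg] at hd
    refine Ideal.mem_sup_right (Ideal.mem_span_singleton.mpr (ge y ?_ ?_))
    · rw [y₁]
      exact Nat.zero_le _
    · rw [y₂]
      exact pos_ge _ c₂ hd
  · by_cases c₂ : k₂ (π (.ofMul p)) = 0
    · rw [c₂, Nat.cast_zero, sub_zero] at hd
      refine Ideal.mem_sup_left (Ideal.mem_of_dvd _ (ge x ?_ ?_) hx)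
      · rw [x₁]
        exact pos_ge _ c₁ hd
      · rw [x₂]
        exact Nat.zero_le _
    · have := ge p₀ (by rw [H.z₁]; omega) (by rw [H.z₂]; omega)
      rw [algMon_eq_zero dvd_rfl, zero_dvd_iff] at this
      change algMon O p₀ p ∈ _
      rw [this]
      exact zero_mem _

theorem IsNodeChart.swap {z : Q} {e : ℕ} {h₁ h₂ : Q →+ ℕ} (H : IsNodeChart z e h₁ h₂) :
    IsNodeChart z e h₂ h₁ where
  pos := H.pos
  z₁ := H.z₂
  z₂ := H.z₁
  inj a b e₁ e₂ := H.inj a b e₂ e₁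
  dvd a := by
    rw [← dvd_neg, neg_sub]
    exact H.dvd a
  surj x y h := by
    obtain ⟨a, a₁, a₂⟩ := H.surj y x (by rwa [← dvd_neg, neg_sub])
    exact ⟨a, a₂, a₁⟩

end Node

end LogTrop
end

noncomputable section

namespace LogTrop

/-! ### Stalks of log structures -/

section Stalk

variable {X : Scheme.{0}} {Ω : Type} [Field Ω] [IsSepClosed Ω] {s : Spec (.of Ω) ⟶ X}

/-- The lifts of a geometric point to an étale `W → X`. -/
abbrev Lift (s : Spec (.of Ω) ⟶ X) (W : X.Etale) : Type := (Scheme.pointSmallEtale s).fiber.obj W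

/-- The image of a lift under a morphism of étale neighbourhoods. -/
abbrev Lift.map {W' W : X.Etale} (φ : W' ⟶ W) (w : Lift s W') : Lift s W :=
  (Scheme.pointSmallEtale s).fiber.map φ w

/-- A lift of a geometric point as a morphism of schemes. -/
def Lift.hom {W : X.Etale} (w : Lift s W) : Spec (.of Ω) ⟶ W.left := w.left

/-- The underlying point of a lift of a geometric point. -/
def Lift.pt {W : X.Etale} (w : Lift s W) : W.left := w.hom default

theorem Lift.w {W : X.Etale} (w : Lift s W) : w.hom ≫ W.hom = s := Over.w w

theorem Lift.hom_pt {W : X.Etale} (w : Lift s W) : W.hom w.pt = s default :=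
  congr($(w.w) default)

/-- A separably closed field lifts through an étale morphism at any prescribed point of the fibre.
This turns statements that hold étale locally into statements at a geometric point. -/
theorem exists_lift_of_etale {W' W : X.Etale} (φ : W' ⟶ W) (w : Lift s W) {y : W'.left}
    (hy : φ.left y = w.pt) : ∃ w' : Lift s W', w'.map φ = w ∧ w'.pt = y := by
  obtain ⟨l, hl, rfl⟩ := Scheme.exists_fac_of_etale_of_isSepClosed φ.left w.hom y hy
  have e : φ.left ≫ W.hom = W'.hom := MorphismProperty.Over.w φ
  refine ⟨Over.homMk l ?_, ?_, rfl⟩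
  · change l ≫ W'.hom = s
    rw [← e, ← Category.assoc, hl]
    exact w.w
  · exact Over.OverMorphism.ext hl

theorem exists_lift_of_hom_eq {W : X.Etale} {y : W.left} (hy : W.hom y = s default) :
    ∃ w : Lift s W, w.pt = y := by
  obtain ⟨l, hl, rfl⟩ := Scheme.exists_fac_of_etale_of_isSepClosed W.hom s y hy
  exact ⟨Over.homMk l hl, rfl⟩

theorem Locally.exists_lift {W : X.Etale} {P : ∀ V : X.Etale, (V ⟶ W) → Prop} (h : Locally W P)
    (w : Lift s W) : ∃ (V : X.Etale) (φ : V ⟶ W) (v : Lift s V), v.map φ = w ∧ P V φ := by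
  obtain ⟨V, φ, y, hy, hP⟩ := h w.pt
  obtain ⟨v, hv, -⟩ := exists_lift_of_etale φ w hy
  exact ⟨V, φ, v, hv, hP⟩

theorem exists_common_lift {U V : X.Etale} (u : Lift s U) (v : Lift s V) :
    ∃ (W : X.Etale) (w : Lift s W) (a : W ⟶ U) (b : W ⟶ V), w.map a = u ∧ w.map b = v := by
  obtain ⟨⟨W, w⟩, a, b, -⟩ := IsCofilteredOrEmpty.cone_objs
    (C := (Scheme.pointSmallEtale s).fiber.Elements) ⟨U, u⟩ ⟨V, v⟩
  exact ⟨W, w, a.1, b.1, a.2, b.2⟩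

namespace LogStr

variable (L : LogStr X)

/-- The germ of a section of the log structure at a lift of a geometric point. -/
def germAt {W : X.Etale} (w : Lift s W) : L.sec W →* L.stalk s :=
  ((Scheme.pointSmallEtale s).toPresheafFiber W w (L.M ⋙ forget₂ CommMonCat MonCat)).hom

theorem germAt_res {W' W : X.Etale} (φ : W' ⟶ W) (w : Lift s W') (m : L.sec W) :
    L.germAt w (L.res φ m) = L.germAt (w.map φ) m :=
  congr($((Scheme.pointSmallEtale s).toPresheafFiber_w φ w (L.M ⋙ forget₂ CommMonCat MonCat)).hom m)

theorem germ_eq {W : X.Etale} (w : Lift s W) (m : L.global) :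
    L.germ s m = L.germAt w (L.res (toEtaleTop W) m) := by
  rw [germAt_res]
  have : w.map (toEtaleTop W) = (Over.homMk s (Category.comp_id s) : Lift s (etaleTop X)) := by
    exact Over.OverMorphism.ext w.w
  rw [this]
  rfl

theorem exists_germAt_eq (a : L.stalk s) :
    ∃ (W : X.Etale) (w : Lift s W) (m : L.sec W), L.germAt w m = a :=
  (Scheme.pointSmallEtale s).toPresheafFiber_jointly_surjective a

theorem germAt_eq_iff {W : X.Etale} (w : Lift s W) (m m' : L.sec W) :
    L.germAt w m = L.germAt w m' ↔ ∃ (V : X.Etale) (φ : V ⟶ W) (v : Lift s V), v.map φ = w ∧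
      L.res φ m = L.res φ m' :=
  (Scheme.pointSmallEtale s).toPresheafFiber_eq_iff' (P := L.M ⋙ forget₂ CommMonCat MonCat) W w m m'

theorem res_comp {W₁ W₂ W₃ : X.Etale} (φ : W₁ ⟶ W₂) (ψ : W₂ ⟶ W₃) (m : L.sec W₃) :
    L.res (φ ≫ ψ) m = L.res φ (L.res ψ m) := by
  change L.M.map (φ ≫ ψ).op m = _
  rw [op_comp, Functor.map_comp]
  rfl

/-- The section lying over the inverse of `α m` is inverse to `m`, because only `1` lies over `1`.
-/
theorem isUnit_sec_iff {W : X.Etale} (m : L.sec W) : IsUnit m ↔ IsUnit (L.α W m) := by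
  refine ⟨fun h => h.map _, fun h => ?_⟩
  obtain ⟨m', hm', -⟩ := L.units W _ (h.unit⁻¹).isUnit
  obtain ⟨m₁, -, h₁⟩ := L.units W 1 isUnit_one
  refine IsUnit.of_mul_eq_one m' ?_
  refine (h₁ (m * m') ?_).trans (h₁ 1 (map_one (L.α W))).symm
  refine (map_mul (L.α W) m m').trans ?_
  rw [hm']
  exact h.mul_val_inv

theorem exists_isUnit_res_of_isUnit_germAt {W : X.Etale} (w : Lift s W) (m : L.sec W)
    (h : IsUnit (L.germAt w m)) : ∃ (V : X.Etale) (φ : V ⟶ W) (v : Lift s V), v.map φ = w ∧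
      IsUnit (L.res φ m) := by
  obtain ⟨b, hb⟩ := h.exists_right_inv
  obtain ⟨V, v, n, rfl⟩ := L.exists_germAt_eq b
  obtain ⟨V', v', a, b, rfl, rfl⟩ := exists_common_lift w v
  have hb' : L.germAt v' (L.res a m * L.res b n) = L.germAt v' 1 := by
    refine (map_mul (L.germAt v') _ _).trans (Eq.trans ?_ (map_one (L.germAt v')).symm)
    refine Eq.trans ?_ hb
    exact congrArg₂ _ (L.germAt_res a v' m) (L.germAt_res b v' n)
  obtain ⟨V'', φ, v'', rfl, hv⟩ := (L.germAt_eq_iff v' _ _).mp hb'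
  refine ⟨V'', φ ≫ a, v'', rfl, IsUnit.of_mul_eq_one (L.res φ (L.res b n)) ?_⟩
  rw [res_comp]
  exact ((map_mul (L.res φ) _ _).symm.trans hv).trans (map_one (L.res φ))

/-- On the open set where `α m` is invertible, `m` itself is invertible. The units of the log stalk
are thus read off in the local ring of the neighbourhood. -/
theorem isUnit_germAt_iff {W : X.Etale} (w : Lift s W) (m : L.sec W) :
    IsUnit (L.germAt w m) ↔ w.pt ∈ W.left.basicOpen (L.α W m) := by
  constructor
  · intro h
    obtain ⟨V, φ, v, rfl, hv⟩ := L.exists_isUnit_res_of_isUnit_germAt w m h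
    have hu := hv.map (L.α V)
    rw [L.α_map] at hu
    refine (mem_basicOpen_appTop φ.left _ v.pt).mp ?_
    exact (Scheme.basicOpen_of_isUnit _ hu).ge trivial
  · intro h
    let D := W.left.basicOpen (L.α W m)
    let V : X.Etale := MorphismProperty.Over.mk ⊤ (D.ι ≫ W.hom)
      (inferInstance : Etale (D.ι ≫ W.hom))
    let φ : V ⟶ W := MorphismProperty.Over.homMk D.ι rfl trivial
    obtain ⟨v, rfl, -⟩ := exists_lift_of_etale φ w (y := (⟨w.pt, h⟩ : D)) rfl
    rw [← germAt_res]
    refine IsUnit.map _ ((L.isUnit_sec_iff _).mpr ?_)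
    rw [L.α_map]
    refine V.left.toRingedSpace.isUnit_of_isUnit_germ ⊤ _ fun y hy => ?_
    exact (V.left.mem_basicOpen _ y hy).mp ((mem_basicOpen_appTop φ.left _ y).mpr y.2)

/-- The homomorphism from a chart to the ghost sheaf. -/
def ghost {P : Type} [CommMonoid P] {U : X.Etale} (u : Lift s U) (β : P →* L.sec U) :
    Additive P →+ Additive (Associates (L.stalk s)) :=
  MonoidHom.toAdditive ((Associates.mkMonoidHom.comp (L.germAt u)).comp β)

theorem exists_germAt_eq_mul {P : Type} [CommMonoid P] {U : X.Etale} {β : P →* L.sec U}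
    (hβ : IsChart L U β) (u : Lift s U) (a : L.stalk s) :
    ∃ (p : P) (c : (L.stalk s)ˣ), a = L.germAt u (β p) * c := by
  obtain ⟨V, v, m, rfl⟩ := L.exists_germAt_eq a
  obtain ⟨W, w, a, b, rfl, rfl⟩ := exists_common_lift u v
  obtain ⟨W', φ, w', rfl, p, c, h⟩ := (hβ.generates W a (L.res b m)).exists_lift w
  refine ⟨p, Units.map (L.germAt w') c, ?_⟩
  have h' := congrArg (L.germAt w') h
  refine (Eq.trans ?_ h').trans ((map_mul (L.germAt w') _ _).trans ?_)
  · rw [germAt_res, germAt_res]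
  · rw [germAt_res]
    rfl

/-- The unit relating the two germs spreads out to an étale neighbourhood, where the relations of
the chart apply. -/
theorem exists_mul_eq_mul {P : Type} [CommMonoid P] {U : X.Etale} {β : P →* L.sec U}
    (hβ : IsChart L U β) (u : Lift s U) {p p' : P}
    (h : Associated (L.germAt u (β p)) (L.germAt u (β p'))) :
    ∃ f f', IsUnit (L.germAt u (β f)) ∧ IsUnit (L.germAt u (β f')) ∧ p * f = p' * f' := by
  obtain ⟨c, hc⟩ := h
  obtain ⟨V, v, m, hm⟩ := L.exists_germAt_eq c.1
  obtain ⟨V', φ, v', rfl, hu⟩ := L.exists_isUnit_res_of_isUnit_germAt v m (hm ▸ c.isUnit)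
  obtain ⟨W, w, a, b, rfl, rfl⟩ := exists_common_lift u v'
  have h1 : L.germAt w (L.res a (β p) * L.res b (L.res φ m)) = L.germAt w (L.res a (β p')) := by
    refine (map_mul (L.germAt w) _ _).trans ?_
    rw [germAt_res, germAt_res, germAt_res, germAt_res, ← hc]
    exact congrArg _ hm
  obtain ⟨W', ψ, w', rfl, h2⟩ := (L.germAt_eq_iff w _ _).mp h1
  have h3 : L.res (ψ ≫ a) (β p) * ((hu.map (L.res (ψ ≫ b))).unit : (L.sec W')ˣ) =
      L.res (ψ ≫ a) (β p') * ((1 : (L.sec W')ˣ) : L.sec W') := by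
    rw [IsUnit.unit_spec, res_comp, res_comp, res_comp]
    refine Eq.trans ?_ (h2.trans (mul_one _).symm)
    exact (map_mul (L.res ψ) _ _).symm
  obtain ⟨W'', χ, w'', rfl, q, q', c₁, c₂, h₁, h₂, e, -⟩ :=
    (hβ.relations W' (ψ ≫ a) p p' _ _ h3).exists_lift w'
  refine ⟨q, q', ?_, ?_, e⟩
  · have := (c₁.isUnit).map (L.germAt w'')
    rw [← h₁, germAt_res] at this
    exact this
  · have := (c₂.isUnit).map (L.germAt w'')
    rw [← h₂, germAt_res] at this
    exact this

/-- Links the log stalk with the local ring: a monomial is invertible in one exactly when it is in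
the other. -/
theorem isGhostMap {P : Type} [CommMonoid P] {p₀ : P} {U : X.Etale} {β : P →* L.sec U}
    (hβ : IsChart L U β) (u : Lift s U) [Algebra (modelRing P p₀) (U.left.presheaf.stalk u.pt)]
    (hα : ∀ p, algMon (U.left.presheaf.stalk u.pt) p₀ p =
      U.left.presheaf.germ ⊤ u.pt trivial (L.α U (β p))) :
    IsGhostMap p₀ (U.left.presheaf.stalk u.pt) (L.ghost u β) where
  surj a := by
    induction a using Additive.rec with | ofMul a => ?_
    obtain ⟨a, rfl⟩ := Associates.mk_surjective a
    obtain ⟨p, c, h⟩ := L.exists_germAt_eq_mul hβ u a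
    refine ⟨.ofMul p, congrArg Additive.ofMul (Associates.mk_eq_mk_iff_associated.mpr ⟨c, h.symm⟩)⟩
  eq_iff p p' := by
    have iff : ∀ p, IsUnit (L.germAt u (β p)) ↔ IsUnit (algMon (U.left.presheaf.stalk u.pt) p₀ p) := by
      intro p
      rw [isUnit_germAt_iff, hα]
      exact U.left.mem_basicOpen_top _ _
    have assoc : L.ghost u β (.ofMul p) = L.ghost u β (.ofMul p') ↔
        Associated (L.germAt u (β p)) (L.germAt u (β p')) :=
      Additive.ofMul.injective.eq_iff.trans Associates.mk_eq_mk_iff_associated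
    rw [assoc]
    constructor
    · intro h
      obtain ⟨f, f', hf, hf', e⟩ := L.exists_mul_eq_mul hβ u h
      exact ⟨f, f', (iff f).mp hf, (iff f').mp hf', e⟩
    · rintro ⟨f, f', hf, hf', e⟩
      have e' := congrArg (fun q => L.germAt u (β q)) e
      simp only [map_mul] at e'
      refine (associated_mul_unit_left _ _ ((iff f).mpr hf)).symm.trans ?_
      rw [e']
      exact associated_mul_unit_left _ _ ((iff f').mpr hf')

end LogStr

end Stalk

end LogTrop
end

/-! ### Descent from the étale neighbourhood to the local ring of the curve -/

noncomputable section

namespace LogTrop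

open IsLocalRing

section Branch

theorem mem_iff_of_span_eq {O : Type*} [CommRing O] {I : Ideal O} {a b : O} (h : Ideal.span {a} = Ideal.span {b}) :
    a ∈ I ↔ b ∈ I := by
  rw [← Ideal.span_singleton_le_iff_mem, ← Ideal.span_singleton_le_iff_mem, h]

variable {P : Type} [CommMonoid P] [IsCancelMul P] {p₀ : P} {B O : Type} [CommRing B] [CommRing O]
  [Algebra (modelRing P p₀) O] [Algebra B O] [IsLocalRing O] [IsNoetherianRing O]
  [Module.FaithfullyFlat B O] [Algebra.FormallyUnramified B O] [Algebra.EssFiniteType B O]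

/-- A prime of `O` over `c + (r)` lies strictly above a prime over `c` by going down, so dimension
one makes it maximal. This is the nilpotence needed to compare lengths over `B` and `O`. -/
theorem exists_pow_le_map (dim : ringKrullDim B = 1) {c : Ideal B} [c.IsPrime] {r : B}
    (hr : r ∉ c) : ∃ n, maximalIdeal O ^ n ≤ (c ⊔ Ideal.span {r}).map (algebraMap B O) := by
  refine Ideal.exists_pow_le_of_le_radical_of_fg ?_ (IsNoetherian.noetherian _)
  rw [Ideal.radical_eq_sInf]
  refine le_sInf fun n hn => ?_
  have := hn.2
  have hle := Ideal.map_le_iff_le_comap.mp hn.1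
  have hrn : r ∈ n.under B := hle (Ideal.mem_sup_right (Ideal.mem_span_singleton_self r))
  have hlt : c < n.under B := lt_of_le_of_ne (le_sup_left.trans hle) fun h => hr (h ▸ hrn)
  have : n.LiesOver (n.under B) := ⟨rfl⟩
  obtain ⟨q, hq, hqp, -⟩ := Ideal.exists_ideal_lt_liesOver_of_lt n hlt
  exact (eq_maximalIdeal_of_lt dim hq).ge

variable [IsLocalRing B] [IsLocalHom (algebraMap B O)]
  [Module.Flat (modelRing P p₀) O] [Algebra.FormallySmooth (modelRing P p₀) O]
  [Algebra ℂ O] [IsScalarTower ℂ (modelRing P p₀) O]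
  {Q : Type} [AddCommMonoid Q] {π : Additive P →+ Q}

theorem IsGhostMap.length_quotient_eq (h : IsGhostMap p₀ O π)
    (ψ : O →ₐ[ℂ] ℂ) (res : ∀ c : ℂ, ∃ b : B, algebraMap B O b = algebraMap ℂ O c)
    (dim : ringKrullDim B = 1) {c : Ideal B} [c.IsPrime] {r₁ r₂ : B} (h₁ : r₁ ∈ c) (h₂ : r₂ ∉ c)
    (h₂' : r₂ ∈ maximalIdeal B) {p₁ p₂ : P}
    (hp₁ : Ideal.span {algebraMap B O r₁} = Ideal.span {algMon O p₀ p₁})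
    (hp₂ : Ideal.span {algebraMap B O r₂} = Ideal.span {algMon O p₀ p₂}) {l : ℕ} (hl : 0 < l)
    {e : ℕ} {k₁ k₂ : Q →+ ℕ} (H : IsNodeChart (π (.ofMul p₀)) e k₁ k₂)
    (v₁₁ : k₁ (π (.ofMul p₁)) = l) (v₁₂ : k₁ (π (.ofMul p₂)) = 0)
    (v₂₁ : k₂ (π (.ofMul p₁)) = 0) (v₂₂ : k₂ (π (.ofMul p₂)) = l)
    {w : ℕ} (hw : l = w * e) :
    Module.length B (B ⧸ (c ⊔ Ideal.span {r₂})) = w := by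
  obtain ⟨n, hn⟩ := exists_pow_le_map (O := O) dim h₂
  rw [LogTrop.length_quotient_eq (fun a => ?_) _ n hn]
  · obtain ⟨𝔭, h𝔭, e𝔭⟩ : ∃ 𝔭 : Ideal O, 𝔭.IsPrime ∧ 𝔭.comap (algebraMap B O) = c := by
      obtain ⟨q, hq⟩ := PrimeSpectrum.comap_surjective_of_faithfullyFlat (B := O)
        (⟨c, inferInstance⟩ : PrimeSpectrum B)
      exact ⟨q.asIdeal, q.2, congrArg PrimeSpectrum.asIdeal hq⟩
    rw [Ideal.map_sup, Ideal.map_span, Set.image_singleton, hp₂]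
    refine h.length_eq ψ (fun p q hp hq hlt => eq_maximalIdeal_of_lt dim hlt) (𝔭 := 𝔭) hl
      ?_ ?_ H v₁₁ v₁₂ v₂₁ v₂₂ (isRadical_map_of_isPrime B O c)
      (Ideal.map_le_iff_le_comap.mpr e𝔭.ge) ?_ hw
    · rw [← mem_iff_of_span_eq hp₂]
      exact fun hu => h₂' ((isUnit_map_iff (algebraMap B O) r₂).mp hu)
    · rw [← mem_iff_of_span_eq hp₂, ← Ideal.mem_comap, e𝔭]
      exact h₂
    · rw [← mem_iff_of_span_eq hp₁]
      exact Ideal.mem_map_of_mem _ h₁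
  · obtain ⟨b, hb⟩ := res (ψ a)
    exact ⟨b, hb ▸ sub_algebraMap_mem_maximalIdeal ψ a⟩

/-- Primes of `O` over `c₁` and `c₂` are chosen to construct the coordinates. The lengths use the
whole extensions of `c₁` and `c₂` instead, so the choice does not affect them; the second is
obtained by exchanging the coordinates. -/
theorem IsGhostMap.exists_node (h : IsGhostMap p₀ O π) [Monoid.FG P] [IsCancelAdd Q] [IsReduced B]
    (sat : ∀ (a b : Q) (n : ℕ), 0 < n → (∃ c, n • a = n • b + c) → ∃ c, a = b + c)
    (ψ : O →ₐ[ℂ] ℂ) (res : ∀ c : ℂ, ∃ b : B, algebraMap B O b = algebraMap ℂ O c)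
    (dim : ringKrullDim B = 1) {c₁ c₂ : Ideal B} [c₁.IsPrime] [c₂.IsPrime] {r₁ r₂ : B}
    (h₁₁ : r₁ ∈ c₁) (h₁₂ : r₁ ∉ c₂) (h₂₁ : r₂ ∉ c₁) (h₂₂ : r₂ ∈ c₂) {p₁ p₂ : P}
    (hp₁ : Ideal.span {algebraMap B O r₁} = Ideal.span {algMon O p₀ p₁})
    (hp₂ : Ideal.span {algebraMap B O r₂} = Ideal.span {algMon O p₀ p₂}) {l : ℕ} (hl : 0 < l)
    (hs : π (.ofMul p₁) + π (.ofMul p₂) = l • π (.ofMul p₀)) :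
    ∃ w e : ℕ, 0 < w ∧ 0 < e ∧
      Module.length B (B ⧸ (c₁ ⊔ Ideal.span {r₂})) = w ∧
      Module.length B (B ⧸ (c₂ ⊔ Ideal.span {r₁})) = w ∧
      (∀ e' : ℕ, (∃ ι : Q ≃+ S e', ι (π (.ofMul p₀)) = S.z e') ↔ e' = e) ∧ w * e = l := by
  have : IsNoetherianRing B := isNoetherianRing_of_faithfullyFlat (O := O)
  have : IsReduced O := isReduced_of_formallyUnramified_of_flat B O
  have m₁ : r₁ ∈ maximalIdeal B := le_maximalIdeal (Ideal.IsPrime.ne_top ‹_›) h₁₁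
  have m₂ : r₂ ∈ maximalIdeal B := le_maximalIdeal (Ideal.IsPrime.ne_top ‹_›) h₂₂
  have mem : ∀ {r p}, r ∈ maximalIdeal B →
      Ideal.span {algebraMap B O r} = Ideal.span {algMon O p₀ p} →
      algMon O p₀ p ∈ maximalIdeal O := by
    intro r p hr hp
    rw [← mem_iff_of_span_eq hp]
    exact fun hu => hr ((isUnit_map_iff (algebraMap B O) r).mp hu)
  have prime : ∀ (c : Ideal B) [c.IsPrime], ∃ 𝔭 : Ideal O, 𝔭.IsPrime ∧
      𝔭.comap (algebraMap B O) = c := by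
    intro c _
    obtain ⟨q, hq⟩ := PrimeSpectrum.comap_surjective_of_faithfullyFlat (B := O)
      (⟨c, inferInstance⟩ : PrimeSpectrum B)
    exact ⟨q.asIdeal, q.2, congrArg PrimeSpectrum.asIdeal hq⟩
  obtain ⟨𝔭₁, _, e₁⟩ := prime c₁
  obtain ⟨𝔭₂, _, e₂⟩ := prime c₂
  obtain ⟨e, k₁, k₂, H, v₁₁, v₁₂, v₂₁, v₂₂⟩ := h.exists_isNodeChart sat
    (fun p q hp hq hlt => eq_maximalIdeal_of_lt dim hlt) (𝔭₁ := 𝔭₁) (𝔭₂ := 𝔭₂) hl hs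
    (mem m₁ hp₁) (mem m₂ hp₂)
    (by rw [← mem_iff_of_span_eq hp₁, ← Ideal.mem_comap, e₂]; exact h₁₂)
    (by rw [← mem_iff_of_span_eq hp₂, ← Ideal.mem_comap, e₁]; exact h₂₁)
  -- `p₁` has coordinates `(l, 0)`, and these are congruent modulo `e`.
  obtain ⟨w, hw⟩ : ∃ w, l = w * e := by
    have := H.dvd (π (.ofMul p₁))
    rw [v₁₁, v₂₁, Nat.cast_zero, sub_zero, Int.natCast_dvd_natCast] at this
    obtain ⟨w, hw⟩ := this
    exact ⟨w, hw.trans (mul_comm _ _)⟩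
  refine ⟨w, e, Nat.pos_of_ne_zero ?_, H.pos, ?_, ?_, ?_, hw.symm⟩
  · rintro rfl
    omega
  · exact h.length_quotient_eq ψ res dim h₁₁ h₂₁ m₂ hp₁ hp₂ hl H v₁₁ v₁₂ v₂₁ v₂₂ hw
  · exact h.length_quotient_eq ψ res dim h₂₂ h₁₂ m₁ hp₂ hp₁ hl H.swap v₂₂ v₂₁ v₁₂ v₁₁ hw
  · intro e'
    constructor
    · rintro ⟨ι, hι⟩
      exact H.eq_of_equiv ι hι
    · rintro rfl
      exact H.exists_equiv

end Branch

end LogTrop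
end

noncomputable section

namespace LogTrop

open IsLocalRing

/-! ### Local rings of étale neighbourhoods -/

section SpecStalk

variable {A : Type} [CommRing A] {Y : Scheme.{0}} (q : Y ⟶ Spec (.of A)) (y : Y)

/-- The homomorphism from a ring to a local ring of a scheme over its spectrum. -/
def toStalk : A →+* Y.presheaf.stalk y :=
  ((Scheme.ΓSpecIso (.of A)).inv ≫ q.appTop ≫ Y.presheaf.germ ⊤ y trivial).hom

/-- The homomorphism from a ring to a local ring of its spectrum. -/
def specStalk (z : Spec (.of A)) : A →+* (Spec (.of A)).presheaf.stalk z :=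
  let z' : PrimeSpectrum A := z
  algebraMap A ((Spec.structureSheaf A).presheaf.stalk z')

theorem toStalk_eq : toStalk q y = (q.stalkMap y).hom.comp (specStalk (q y)) := by
  have h : CommRingCat.ofHom (specStalk (q y)) =
      (Scheme.ΓSpecIso (.of A)).inv ≫ (Spec (.of A)).presheaf.germ ⊤ (q y) trivial := by
    rfl
  have h' : CommRingCat.ofHom (specStalk (q y)) ≫ q.stalkMap y =
      (Scheme.ΓSpecIso (.of A)).inv ≫ q.appTop ≫ Y.presheaf.germ ⊤ y trivial := by
    rw [h, Category.assoc]
    exact congrArg (_ ≫ ·) (Scheme.Hom.germ_stalkMap q ⊤ y trivial)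
  exact congrArg CommRingCat.Hom.hom h'.symm

theorem flat_specStalk (z : PrimeSpectrum A) : (specStalk (A := A) z).Flat := by
  have h : (algebraMap A ((Spec.structureSheaf A).presheaf.stalk z)).Flat :=
    RingHom.flat_algebraMap_iff.mpr
    (IsLocalization.flat ((Spec.structureSheaf A).presheaf.stalk z) z.asIdeal.primeCompl)
  exact h

theorem essFiniteType_specStalk (z : PrimeSpectrum A) : (specStalk (A := A) z).EssFiniteType := by
  have h : (algebraMap A ((Spec.structureSheaf A).presheaf.stalk z)).EssFiniteType :=
    RingHom.essFiniteType_algebraMap.mpr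
    (Algebra.EssFiniteType.of_isLocalization ((Spec.structureSheaf A).presheaf.stalk z)
      z.asIdeal.primeCompl)
  exact h

theorem formallySmooth_specStalk (z : PrimeSpectrum A) : (specStalk (A := A) z).FormallySmooth := by
  have h : (algebraMap A ((Spec.structureSheaf A).presheaf.stalk z)).FormallySmooth :=
    RingHom.formallySmooth_algebraMap.mpr
    (Algebra.FormallySmooth.of_isLocalization
      (Rₘ := (Spec.structureSheaf A).presheaf.stalk z) z.asIdeal.primeCompl)
  exact h

theorem flat_toStalk [Flat q] : (toStalk q y).Flat := by
  rw [toStalk_eq]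
  exact RingHom.Flat.comp (flat_specStalk _) (Flat.stalkMap q y)

theorem essFiniteType_toStalk [LocallyOfFiniteType q] : (toStalk q y).EssFiniteType := by
  rw [toStalk_eq]
  exact RingHom.EssFiniteType.comp (essFiniteType_specStalk _) (LocallyOfFiniteType.stalkMap q y)

theorem formallySmooth_toStalk [Smooth q] : (toStalk q y).FormallySmooth := by
  rw [toStalk_eq]
  exact RingHom.FormallySmooth.stableUnderComposition _ _ (formallySmooth_specStalk _)
    ((Scheme.Hom.smoothLocus_eq_top q).ge (Set.mem_univ y))

end SpecStalk

/-! ### Rational points -/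

section Point

/-- The value of germs at a rational point. -/
theorem exists_evaluation {k : Type} [Field k] {Y : Scheme.{0}} (f : Spec (.of k) ⟶ Y) {y : Y}
    (hy : f default = y) : ∃ ψ : Y.presheaf.stalk y →+* k, ∀ a : Γ(Y, ⊤),
      ψ (Y.presheaf.germ ⊤ y trivial a) = (Scheme.ΓSpecIso (.of k)).hom (f.appTop a) := by
  have e : (default : Spec (.of k)) = closedPoint k := Subsingleton.elim _ _
  rw [e] at hy
  subst hy
  refine ⟨(Scheme.stalkClosedPointTo f).hom, fun a => ?_⟩
  have := congr($(Scheme.germ_stalkClosedPointTo f ⊤ trivial).hom a)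
  refine this.trans ?_
  simp
  rfl

/-- A rational point is closed. -/
theorem isClosed_singleton_of_section {k : Type} [Field k] {Y : Scheme.{0}}
    (str : Y ⟶ Spec (.of k)) (f : Spec (.of k) ⟶ Y) (hf : f ≫ str = 𝟙 _) :
    IsClosed {f default} := by
  have e : (default : Spec (.of k)) = closedPoint k := Subsingleton.elim _ _
  rw [e]
  refine isClosed_of_closure_subset fun y hy => ?_
  have hxy : f (closedPoint k) ⤳ y := specializes_iff_mem_closure.mpr hy
  -- If `y` is in the closure of the rational point, the value at that point is defined on the local
  -- ring at `y`. The constants make it surjective, so its kernel is the maximal ideal and the two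
  -- points agree.
  let θ : Y.presheaf.stalk y ⟶ .of k := Y.presheaf.stalkSpecializes hxy ≫ Scheme.stalkClosedPointTo f
  have hθ : Spec.map θ ≫ Y.fromSpecStalk y = f := by
    rw [Spec.map_comp, Category.assoc, Scheme.SpecMap_stalkSpecializes_fromSpecStalk]
    exact Scheme.Spec_stalkClosedPointTo_fromSpecStalk f
  obtain ⟨ι, hι⟩ := Spec.map_surjective (Y.fromSpecStalk y ≫ str)
  have hid : ι ≫ θ = 𝟙 _ := by
    apply Spec.map_injective
    rw [Spec.map_comp, hι, ← Category.assoc, hθ, hf, Spec.map_id]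
  have hsurj : Function.Surjective θ.hom := fun a => ⟨ι.hom a, congr($(hid).hom a)⟩
  have : (Spec.map θ) (closedPoint k) = closedPoint (Y.presheaf.stalk y) := by
    apply PrimeSpectrum.ext
    refine IsLocalRing.eq_maximalIdeal ?_
    have hm : (maximalIdeal k).IsMaximal := inferInstance
    exact Ideal.comap_isMaximal_of_surjective θ.hom hsurj (K := maximalIdeal k)
  have h2 : f (closedPoint k) = Y.fromSpecStalk y ((Spec.map θ) (closedPoint k)) := by
    conv_lhs => rw [← hθ]
    rfl
  rw [this, Scheme.fromSpecStalk_closedPoint] at h2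
  exact h2.symm

end Point

/-! ### Pulling germs back to étale neighbourhoods -/

section Pull

variable {X : Scheme.{0}} {Ω : Type} [Field Ω] [IsSepClosed Ω] {s : Spec (.of Ω) ⟶ X}

theorem stalkSpecializes_stalkMap_comp {Y Y' X : Scheme.{0}} {f : Y ⟶ X} {φ : Y' ⟶ Y} {h : Y' ⟶ X}
    (e : φ ≫ f = h) (y : Y') {x : X} (h₁ : f (φ y) = x) (h₂ : h y = x) :
    (X.presheaf.stalkSpecializes (specializes_of_eq h₁) ≫ f.stalkMap (φ y)) ≫ φ.stalkMap y =
      X.presheaf.stalkSpecializes (specializes_of_eq h₂) ≫ h.stalkMap y := by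
  subst e h₁
  rw [Scheme.Hom.stalkMap_comp, Category.assoc]
  rfl

/-- The homomorphism of local rings of an étale neighbourhood. -/
def Lift.pull {W : X.Etale} (w : Lift s W) {x : X} (hx : s default = x) :
    X.presheaf.stalk x →+* W.left.presheaf.stalk w.pt :=
  (X.presheaf.stalkSpecializes (specializes_of_eq (w.hom_pt.trans hx)) ≫ W.hom.stalkMap w.pt).hom

theorem Lift.pull_germ {W : X.Etale} (w : Lift s W) {x : X} (hx : s default = x) (D : X.Opens)
    (hD : x ∈ D) (f : Γ(X, D)) : w.pull hx (X.presheaf.germ D x hD f) =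
      W.left.presheaf.germ (W.hom ⁻¹ᵁ D) w.pt ((w.hom_pt.trans hx).symm ▸ hD : W.hom w.pt ∈ D)
        (W.hom.app D f) := by
  change (X.presheaf.germ D x hD ≫ X.presheaf.stalkSpecializes _ ≫ W.hom.stalkMap w.pt).hom f = _
  rw [TopCat.Presheaf.germ_stalkSpecializes_assoc, Scheme.Hom.germ_stalkMap]
  rfl

theorem Lift.stalkMap_pull {W W' : X.Etale} (φ : W' ⟶ W) (w : Lift s W') {x : X}
    (hx : s default = x) (r : X.presheaf.stalk x) :
    (φ.left.stalkMap w.pt).hom ((w.map φ).pull hx r) = w.pull hx r := by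
  have := stalkSpecializes_stalkMap_comp (MorphismProperty.Over.w φ) w.pt ((w.map φ).hom_pt.trans hx)
    (w.hom_pt.trans hx)
  exact congr($(this).hom r)

theorem Lift.pull_properties {W : X.Etale} (w : Lift s W) {x : X} (hx : s default = x) :
    (w.pull hx).Flat ∧ (w.pull hx).FormallyUnramified ∧ (w.pull hx).EssFiniteType ∧
      IsLocalHom (w.pull hx) := by
  obtain rfl : W.hom w.pt = x := w.hom_pt.trans hx
  have : w.pull hx = (W.hom.stalkMap w.pt).hom := by
    change (X.presheaf.stalkSpecializes _ ≫ W.hom.stalkMap w.pt).hom = _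
    rw [TopCat.Presheaf.stalkSpecializes_refl, Category.id_comp]
  rw [this]
  have : Etale W.hom := W.prop
  exact ⟨Flat.stalkMap _ _, FormallyUnramified.stalkMap _ _, LocallyOfFiniteType.stalkMap _ _,
    inferInstance⟩

theorem span_eq_of_stalkMap {Y Y' : Scheme.{0}} (φ : Y' ⟶ Y) [Etale φ] (y : Y')
    {a b : Y.presheaf.stalk (φ y)}
    (h : Ideal.span {(φ.stalkMap y).hom a} = Ideal.span {(φ.stalkMap y).hom b}) :
    Ideal.span {a} = Ideal.span {b} := by
  let _ := (φ.stalkMap y).hom.toAlgebra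
  have : Module.Flat (Y.presheaf.stalk (φ y)) (Y'.presheaf.stalk y) := Flat.stalkMap φ y
  have : IsLocalHom (algebraMap (Y.presheaf.stalk (φ y)) (Y'.presheaf.stalk y)) :=
    inferInstanceAs (IsLocalHom (φ.stalkMap y).hom)
  have : Module.FaithfullyFlat (Y.presheaf.stalk (φ y)) (Y'.presheaf.stalk y) :=
    Module.FaithfullyFlat.of_flat_of_isLocalHom
  apply Ideal.map_injective_of_faithfullyFlat (B := Y'.presheaf.stalk y)
  rw [Ideal.map_span, Ideal.map_span, Set.image_singleton, Set.image_singleton]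
  exact h

namespace LogStr

variable (L : LogStr X)

theorem exists_res_eq_mul {U V : X.Etale} (u : Lift s U) (v : Lift s V) (n : L.sec U) (m : L.sec V)
    (h : Associated (L.germAt u n) (L.germAt v m)) :
    ∃ (W : X.Etale) (w : Lift s W) (a : W ⟶ U) (b : W ⟶ V) (c : L.sec W), w.map a = u ∧
      w.map b = v ∧ IsUnit c ∧ L.res b m = L.res a n * c := by
  obtain ⟨c, hc⟩ := h
  obtain ⟨V', v', k, hk⟩ := L.exists_germAt_eq c.1
  obtain ⟨V'', φ, v'', rfl, hu⟩ := L.exists_isUnit_res_of_isUnit_germAt v' k (hk ▸ c.isUnit)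
  obtain ⟨W, w, a, b, rfl, rfl⟩ := exists_common_lift u v
  obtain ⟨W', w', a', b', rfl, rfl⟩ := exists_common_lift w v''
  have h1 : L.germAt w' (L.res a' (L.res a n) * L.res b' (L.res φ k)) =
      L.germAt w' (L.res a' (L.res b m)) := by
    refine (map_mul (L.germAt w') _ _).trans ?_
    rw [germAt_res, germAt_res, germAt_res, germAt_res, germAt_res, germAt_res, ← hc]
    exact congrArg _ hk
  obtain ⟨W'', ψ, w'', rfl, h2⟩ := (L.germAt_eq_iff w' _ _).mp h1
  refine ⟨W'', w'', ψ ≫ a' ≫ a, ψ ≫ a' ≫ b, L.res ψ (L.res b' (L.res φ k)), rfl, rfl,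
    (hu.map (L.res b')).map (L.res ψ), ?_⟩
  rw [res_comp, res_comp, res_comp, res_comp]
  exact h2.symm.trans (map_mul (L.res ψ) _ _)

/-- The germ `r` is given by a section over `V`, the monomial by a section over `U`. On a common
refinement they differ by a unit, and equality of the ideals descends to `U` by faithful flatness.
-/
theorem span_pull_eq {U V : X.Etale} (u : Lift s U) (v : Lift s V) (n : L.sec U) (m : L.sec V)
    (h : Associated (L.germAt u n) (L.germAt v m)) {x : X} (hx : s default = x)
    {r : X.presheaf.stalk x}
    (hr : v.pull hx r = V.left.presheaf.germ ⊤ v.pt trivial (L.α V m)) :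
    Ideal.span {u.pull hx r} =
      Ideal.span {U.left.presheaf.germ ⊤ u.pt trivial (L.α U n)} := by
  obtain ⟨W, w, a, b, c, rfl, rfl, hc, e⟩ := L.exists_res_eq_mul u v n m h
  refine span_eq_of_stalkMap a.left w.pt ?_
  have germ : ∀ {U : X.Etale} (a : W ⟶ U) (n : L.sec U),
      (a.left.stalkMap w.pt).hom (U.left.presheaf.germ ⊤ (a.left w.pt) trivial (L.α U n)) =
        W.left.presheaf.germ ⊤ w.pt trivial (L.α W (L.res a n)) := by
    intro U a n
    rw [L.α_map]
    exact congr($(Scheme.Hom.germ_stalkMap a.left ⊤ w.pt trivial).hom (L.α U n))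
  have h1 : (a.left.stalkMap w.pt).hom ((w.map a).pull hx r) =
      W.left.presheaf.germ ⊤ w.pt trivial (L.α W (L.res b m)) := by
    rw [Lift.stalkMap_pull, ← Lift.stalkMap_pull b, hr]
    exact germ b m
  have h2 := germ a n
  have h3 : W.left.presheaf.germ ⊤ w.pt trivial (L.α W (L.res b m)) =
      W.left.presheaf.germ ⊤ w.pt trivial (L.α W (L.res a n)) *
        W.left.presheaf.germ ⊤ w.pt trivial (L.α W c) := by
    rw [e]
    exact (congrArg _ (map_mul (L.α W) _ _)).trans (map_mul (W.left.presheaf.germ ⊤ w.pt trivial).hom _ _)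
  have hu : IsUnit (W.left.presheaf.germ ⊤ w.pt trivial (L.α W c)) :=
    (hc.map (L.α W)).map (W.left.presheaf.germ ⊤ w.pt trivial).hom
  have assoc : Associated ((a.left.stalkMap w.pt).hom ((w.map a).pull hx r))
      ((a.left.stalkMap w.pt).hom (U.left.presheaf.germ ⊤ (a.left w.pt) trivial (L.α U n))) := by
    rw [h1, h2, h3]
    exact associated_mul_unit_left _ _ hu
  exact le_antisymm (Ideal.span_singleton_le_span_singleton.mpr assoc.dvd')
    (Ideal.span_singleton_le_span_singleton.mpr assoc.dvd)

end LogStr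

end Pull

end LogTrop
end

noncomputable section

namespace LogTrop

open IsLocalRing

/-! ### Nodes of log curves -/

theorem exists_eq_add_of_isSaturatedMonoid {N : Type} [CommMonoid N] (h : IsSaturatedMonoid N)
    (a b : Additive (Associates N)) (n : ℕ) (hn : 0 < n) (hc : ∃ c, n • a = n • b + c) :
    ∃ c, a = b + c := by
  obtain ⟨c, hc⟩ := hc
  obtain ⟨a, rfl⟩ := Associates.mk_surjective a
  obtain ⟨b, rfl⟩ := Associates.mk_surjective b
  obtain ⟨c, rfl⟩ := Associates.mk_surjective c
  have e : Associates.mk a ^ n = Associates.mk b ^ n * Associates.mk c := hc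
  rw [← Associates.mk_pow, ← Associates.mk_pow, Associates.mk_mul_mk] at e
  have hd : b ^ n ∣ a ^ n :=
    (dvd_mul_right _ _).trans (Associates.mk_eq_mk_iff_associated.mp e).dvd'
  obtain ⟨d, rfl⟩ := h.2 a b n hn hd
  exact ⟨.ofMul (Associates.mk d), rfl⟩

theorem isCancelAdd_of_isSaturatedMonoid {N : Type} [CommMonoid N] (h : IsSaturatedMonoid N) :
    IsCancelAdd (Additive (Associates N)) := by
  have := h.1
  have : IsLeftCancelAdd (Additive (Associates N)) := by
    refine ⟨fun a b c e => ?_⟩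
    obtain ⟨a, rfl⟩ := Associates.mk_surjective a
    obtain ⟨b, rfl⟩ := Associates.mk_surjective b
    obtain ⟨c, rfl⟩ := Associates.mk_surjective c
    have e' : Associates.mk (a * b) = Associates.mk (a * c) := e
    obtain ⟨u, hu⟩ := Associates.mk_eq_mk_iff_associated.mp e'
    rw [mul_assoc] at hu
    exact Associates.mk_eq_mk_iff_associated.mpr ⟨u, mul_left_cancel hu⟩
  exact AddCommMagma.IsLeftCancelAdd.toIsCancelAdd _

theorem hasNodeInteger_iff {C : Scheme.{0}} (L : LogStr C) (ρ : L.global) (p : Spec (.of ℂ) ⟶ C)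
    (e : ℕ) : HasNodeInteger L ρ p e ↔ ∃ ι : Additive (Associates (L.stalk p)) ≃+ S e,
      ι (.ofMul (Associates.mk (L.germ p ρ))) = S.z e :=
  ⟨fun ⟨ι, h⟩ => ⟨MulEquiv.toAdditiveLeft ι, h⟩, fun ⟨ι, h⟩ => ⟨MulEquiv.toAdditiveLeft.symm ι, h⟩⟩

theorem appTop_modelStr {P : Type} [CommMonoid P] (p₀ : P) (c : ℂ) :
    (modelStr P p₀).appTop ((Scheme.ΓSpecIso (.of ℂ)).inv c) =
      (Scheme.ΓSpecIso (.of (modelRing P p₀))).inv (algebraMap ℂ (modelRing P p₀) c) :=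
  congr($(Scheme.ΓSpecIso_inv_naturality
    (CommRingCat.ofHom (algebraMap ℂ (modelRing P p₀)))).hom c).symm

theorem isNoetherianRing_modelRing (P : Type) [CommMonoid P] [Monoid.FG P] (p₀ : P) :
    IsNoetherianRing (modelRing P p₀) := by
  have : Algebra.FiniteType ℂ (MonoidAlgebra ℂ P) := inferInstance
  have : IsNoetherianRing (MonoidAlgebra ℂ P) := Algebra.FiniteType.isNoetherianRing ℂ _
  infer_instance

/-- The theorem for an abstract log curve: two sections with product `ρ ^ l` separate two branches
at a rational point. Each is replaced by a monomial of a log smooth chart up to a unit. -/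
theorem IsLogCurve.exists_node {C : Scheme.{0}} {str : C ⟶ Spec (.of ℂ)} {L : LogStr C}
    {ρ : L.global} (hC : IsLogCurve str L ρ) {p : Spec (.of ℂ) ⟶ C}
    (hp : p ≫ str = 𝟙 (Spec (.of ℂ))) {x : C} (hx : p default = x)
    {c₁ c₂ : Ideal (C.presheaf.stalk x)} [c₁.IsPrime] [c₂.IsPrime] {r₁ r₂ : C.presheaf.stalk x}
    (h₁₁ : r₁ ∈ c₁) (h₁₂ : r₁ ∉ c₂) (h₂₁ : r₂ ∉ c₁) (h₂₂ : r₂ ∈ c₂)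
    {V : C.Etale} (v : Lift p V) (m₁ m₂ : L.sec V)
    (hm₁ : v.pull hx r₁ = V.left.presheaf.germ ⊤ v.pt trivial (L.α V m₁))
    (hm₂ : v.pull hx r₂ = V.left.presheaf.germ ⊤ v.pt trivial (L.α V m₂))
    {l : ℕ} (hl : 0 < l) (hm : m₁ * m₂ = L.res (toEtaleTop V) ρ ^ l) :
    ∃ w e : ℕ, 0 < w ∧ 0 < e ∧
      Module.length (C.presheaf.stalk x) (C.presheaf.stalk x ⧸ (c₁ ⊔ Ideal.span {r₂})) = w ∧
      Module.length (C.presheaf.stalk x) (C.presheaf.stalk x ⧸ (c₂ ⊔ Ideal.span {r₁})) = w ∧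
      (∀ e' : ℕ, HasNodeInteger L ρ p e' ↔ e' = e) ∧ w * e = l := by
  obtain ⟨U, u₀, P, _, β, p₀, q, hu₀, _, _, hβ, hβ₀, -, _, hstr, hα⟩ := hC.logSmooth x
  obtain ⟨u, rfl⟩ := exists_lift_of_hom_eq (hu₀.trans hx.symm)
  have dim : ringKrullDim (C.presheaf.stalk x) = 1 :=
    hC.dim_eq_one x (hx ▸ isClosed_singleton_of_section str p hp)
  have sat := hC.saturated ℂ p
  have := hC.isReduced
  obtain ⟨flat, unram, eft, isloc⟩ := u.pull_properties hx
  let B := C.presheaf.stalk x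
  let O := U.left.presheaf.stalk u.pt
  let _ : Algebra B O := (u.pull hx).toAlgebra
  let _ : Algebra (modelRing P p₀) O := (toStalk q u.pt).toAlgebra
  let _ : Algebra ℂ O := ((toStalk q u.pt).comp (algebraMap ℂ (modelRing P p₀))).toAlgebra
  have : IsScalarTower ℂ (modelRing P p₀) O :=
    @IsScalarTower.of_algebraMap_eq ℂ (modelRing P p₀) O _ _ _ _ _ _ fun _ => rfl
  have : Module.Flat B O := flat
  have : Algebra.FormallyUnramified B O := unram
  have : Algebra.EssFiniteType B O := eft
  have : IsLocalHom (algebraMap B O) := isloc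
  have : Module.FaithfullyFlat B O := Module.FaithfullyFlat.of_flat_of_isLocalHom
  have : Module.Flat (modelRing P p₀) O := flat_toStalk q u.pt
  have : Algebra.FormallySmooth (modelRing P p₀) O := formallySmooth_toStalk q u.pt
  have : Algebra.EssFiniteType (modelRing P p₀) O := essFiniteType_toStalk q u.pt
  have : IsNoetherianRing (modelRing P p₀) := isNoetherianRing_modelRing P p₀
  have : IsNoetherianRing O := Algebra.EssFiniteType.isNoetherianRing (modelRing P p₀) O
  have hmon : ∀ p : P, algMon O p₀ p = U.left.presheaf.germ ⊤ u.pt trivial (L.α U (β p)) := by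
    intro p
    rw [← hα]
    rfl
  have ghost : IsGhostMap p₀ O (L.ghost u β) := L.isGhostMap hβ u hmon
  have hconst : ∀ c : ℂ, algebraMap ℂ O c = U.left.presheaf.germ ⊤ u.pt trivial
      ((U.hom ≫ str).appTop ((Scheme.ΓSpecIso (.of ℂ)).inv c)) := by
    intro c
    rw [← hstr, Scheme.Hom.comp_appTop]
    change toStalk q u.pt (algebraMap ℂ (modelRing P p₀) c) = U.left.presheaf.germ ⊤ u.pt trivial
      (q.appTop ((modelStr P p₀).appTop ((Scheme.ΓSpecIso (.of ℂ)).inv c)))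
    rw [appTop_modelStr]
    rfl
  -- The lift of the rational point makes `O` an algebra with residue field `ℂ`. The constants of
  -- `O` come from the curve, as both structures are induced by `str`.
  obtain ⟨ψ, hψ⟩ := exists_evaluation u.hom (y := u.pt) rfl
  have hψ' : ∀ c : ℂ, ψ (algebraMap ℂ O c) = c := by
    intro c
    rw [hconst, hψ]
    have e : u.hom ≫ U.hom ≫ str = 𝟙 _ := by
      rw [← Category.assoc, u.w, hp]
    change (Scheme.ΓSpecIso (.of ℂ)).hom ((U.hom ≫ str).appTop ≫ u.hom.appTop
      |>.hom ((Scheme.ΓSpecIso (.of ℂ)).inv c)) = c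
    rw [← Scheme.Hom.comp_appTop, e]
    simp
  have res : ∀ c : ℂ, ∃ b : B, algebraMap B O b = algebraMap ℂ O c := by
    intro c
    refine ⟨C.presheaf.germ ⊤ x trivial (str.appTop ((Scheme.ΓSpecIso (.of ℂ)).inv c)), ?_⟩
    rw [hconst]
    exact u.pull_germ hx ⊤ trivial _
  obtain ⟨p₁, a₁, e₁⟩ := L.exists_germAt_eq_mul hβ u (L.germAt v m₁)
  obtain ⟨p₂, a₂, e₂⟩ := L.exists_germAt_eq_mul hβ u (L.germAt v m₂)
  have as₁ : Associated (L.germAt u (β p₁)) (L.germAt v m₁) := ⟨a₁, e₁.symm⟩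
  have as₂ : Associated (L.germAt u (β p₂)) (L.germAt v m₂) := ⟨a₂, e₂.symm⟩
  have hp₁ : Ideal.span {algebraMap B O r₁} = Ideal.span {algMon O p₀ p₁} := by
    rw [hmon]
    exact L.span_pull_eq u v (β p₁) m₁ as₁ hx hm₁
  have hp₂ : Ideal.span {algebraMap B O r₂} = Ideal.span {algMon O p₀ p₂} := by
    rw [hmon]
    exact L.span_pull_eq u v (β p₂) m₂ as₂ hx hm₂
  have hρ : L.germ p ρ = L.germAt u (β p₀) := by
    rw [hβ₀]
    exact L.germ_eq u ρ
  -- The relation `m₁ * m₂ = ρ ^ l` read in the ghost stalk, where the unit factors disappear.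
  have hs : L.ghost u β (.ofMul p₁) + L.ghost u β (.ofMul p₂) = l • L.ghost u β (.ofMul p₀) := by
    have h₀ : L.germAt v (L.res (toEtaleTop V) ρ) = L.germAt u (β p₀) := (L.germ_eq v ρ).symm.trans hρ
    have h : L.germAt v m₁ * L.germAt v m₂ = L.germAt u (β p₀) ^ l := by
      rw [← h₀]
      exact ((map_mul (L.germAt v) _ _).symm.trans (congrArg (L.germAt v) hm)).trans
        (map_pow (L.germAt v) _ _)
    have h' : Associates.mk (L.germAt v m₁) * Associates.mk (L.germAt v m₂) =
        Associates.mk (L.germAt u (β p₀)) ^ l := by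
      rw [Associates.mk_mul_mk, h, Associates.mk_pow]
    rw [← Associates.mk_eq_mk_iff_associated.mpr as₁,
      ← Associates.mk_eq_mk_iff_associated.mpr as₂] at h'
    exact congrArg Additive.ofMul h'
  have : IsCancelAdd (Additive (Associates (L.stalk p))) := isCancelAdd_of_isSaturatedMonoid sat
  have : _root_.IsReduced B := inferInstanceAs (_root_.IsReduced (C.presheaf.stalk x))
  obtain ⟨w, e, hw, he, l₁, l₂, huniq, hwe⟩ := ghost.exists_node (B := B)
    (exists_eq_add_of_isSaturatedMonoid sat) ⟨ψ, hψ'⟩ res dim h₁₁ h₁₂ h₂₁ h₂₂ hp₁ hp₂ hl hs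
  refine ⟨w, e, hw, he, l₁, l₂, fun e' => ?_, hwe⟩
  rw [hasNodeInteger_iff, hρ]
  exact huniq e'

end LogTrop
end

noncomputable section

namespace LogTrop

open IsLocalRing

/-! ### Ideals of germs -/

section StalkIdeal

variable {X : Scheme.{0}} {Z : Set X} {η x : X}

/-- A function vanishes on all of `Z` exactly when it is not invertible at the generic point `η`. So
the spanning germs are already an ideal, and a prime one. -/
theorem stalkIdeal_eq_comap (hη : η ∈ Z) (hZ : ∀ z ∈ Z, η ⤳ z) (hx : η ⤳ x) :
    stalkIdeal Z x = (maximalIdeal (X.presheaf.stalk η)).comap (X.presheaf.stalkSpecializes hx).hom := by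
  have key : ∀ (U : X.Opens) (hxU : x ∈ U) (f : Γ(X, U)),
      X.presheaf.germ U x hxU f ∈
        (maximalIdeal (X.presheaf.stalk η)).comap (X.presheaf.stalkSpecializes hx).hom ↔
        ∀ z ∈ Z, z ∉ X.basicOpen f := by
    intro U hxU f
    have e : (X.presheaf.stalkSpecializes hx).hom (X.presheaf.germ U x hxU f) =
        X.presheaf.germ U η (hx.mem_open U.2 hxU) f :=
      congr($(TopCat.Presheaf.germ_stalkSpecializes X.presheaf hxU hx).hom f)
    rw [Ideal.mem_comap, e, mem_maximalIdeal, mem_nonunits_iff, ← X.mem_basicOpen]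
    exact ⟨fun h z hz hzf => h ((hZ z hz).mem_open (X.basicOpen f).2 hzf), fun h => h η hη⟩
  refine le_antisymm (Ideal.span_le.mpr ?_) ?_
  · rintro _ ⟨U, hxU, f, hf, rfl⟩
    exact (key U hxU f).mpr hf
  · intro a ha
    obtain ⟨U, hxU, f, rfl⟩ := X.presheaf.exists_germ_eq a
    exact Ideal.subset_span ⟨U, hxU, f, (key U hxU f).mp ha, rfl⟩

theorem isPrime_stalkIdeal (hη : η ∈ Z) (hZ : ∀ z ∈ Z, η ⤳ z) (hx : η ⤳ x) :
    (stalkIdeal Z x).IsPrime := by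
  rw [stalkIdeal_eq_comap hη hZ hx]
  infer_instance

theorem germ_mem_stalkIdeal_iff (hη : η ∈ Z) (hZ : ∀ z ∈ Z, η ⤳ z) (hx : η ⤳ x) (U : X.Opens)
    (hxU : x ∈ U) (f : Γ(X, U)) :
    X.presheaf.germ U x hxU f ∈ stalkIdeal Z x ↔ η ∉ X.basicOpen f := by
  have e : (X.presheaf.stalkSpecializes hx).hom (X.presheaf.germ U x hxU f) =
      X.presheaf.germ U η (hx.mem_open U.2 hxU) f :=
    congr($(TopCat.Presheaf.germ_stalkSpecializes X.presheaf hxU hx).hom f)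
  rw [stalkIdeal_eq_comap hη hZ hx, Ideal.mem_comap, e, mem_maximalIdeal, mem_nonunits_iff,
    ← X.mem_basicOpen]

theorem exists_genericPoint (hZ : IsIrreducible Z) (hZ' : IsClosed Z) :
    ∃ η ∈ Z, ∀ z ∈ Z, η ⤳ z := by
  obtain ⟨η, hη⟩ := QuasiSober.sober hZ hZ'
  exact ⟨η, hη.mem, fun z hz => hη.specializes hz⟩

end StalkIdeal

/-! ### Functions on affine charts -/

section Chart

variable {R : Type} [CommRing R] {X : Scheme.{0}} (j : Spec (.of R) ⟶ X) [IsOpenImmersion j]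

/-- The elements of a ring as functions on an affine chart. -/
def chartFn : R →+* Γ(X, j ''ᵁ ⊤) :=
  ((Scheme.ΓSpecIso (.of R)).inv ≫ (j.appIso ⊤).inv).hom

theorem mem_chart (z : Spec (.of R)) : j z ∈ j ''ᵁ ⊤ := ⟨z, trivial, rfl⟩

theorem stalkMap_germ_chartFn (z : Spec (.of R)) (a : R) :
    (j.stalkMap z).hom (X.presheaf.germ (j ''ᵁ ⊤) (j z) (mem_chart j z) (chartFn j a)) =
      specStalk z a := by
  have h : CommRingCat.ofHom (specStalk z) =
      (Scheme.ΓSpecIso (.of R)).inv ≫ (Spec (.of R)).presheaf.germ ⊤ z trivial := by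
    rfl
  have h' : (j.appIso ⊤).inv ≫ X.presheaf.germ (j ''ᵁ ⊤) (j z) (mem_chart j z) ≫ j.stalkMap z =
      (Spec (.of R)).presheaf.germ ⊤ z trivial := by
    rw [Scheme.Hom.germ_stalkMap, ← Category.assoc, Scheme.Hom.appIso_inv_app]
    exact TopCat.Presheaf.germ_res _ _ _ _
  have := congr($(h').hom ((Scheme.ΓSpecIso (.of R)).inv a))
  exact this.trans congr($(h).hom a).symm

theorem mem_basicOpen_chartFn (z : Spec (.of R)) (a : R) :
    j z ∈ X.basicOpen (chartFn j a) ↔ a ∉ z.asIdeal := by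
  rw [X.mem_basicOpen _ _ (mem_chart j z), ← isUnit_map_iff (j.stalkMap z).hom,
    stalkMap_germ_chartFn]
  let z' : PrimeSpectrum R := z
  exact not_not.symm.trans (not_congr
    (IsLocalization.AtPrime.to_map_mem_maximal_iff ((Spec.structureSheaf R).presheaf.stalk z')
      z'.asIdeal a))

/-- Germs are fractions of elements of the chart ring, so ideals of germs can be compared on such
elements. -/
theorem exists_mul_germ_chartFn (z : Spec (.of R)) {y : X} (hy : j z = y) (hy' : y ∈ j ''ᵁ ⊤)
    (s : X.presheaf.stalk y) : ∃ a b : R, b ∉ z.asIdeal ∧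
      s * X.presheaf.germ (j ''ᵁ ⊤) y hy' (chartFn j b) =
        X.presheaf.germ (j ''ᵁ ⊤) y hy' (chartFn j a) := by
  subst hy
  let z' : PrimeSpectrum R := z
  obtain ⟨⟨a, b⟩, h⟩ := IsLocalization.surj (M := z'.asIdeal.primeCompl)
    (S := (Spec.structureSheaf R).presheaf.stalk z') ((j.stalkMap z).hom s)
  refine ⟨a, b.1, b.2, ?_⟩
  have inj : Function.Injective (j.stalkMap z).hom :=
    (ConcreteCategory.bijective_of_isIso (j.stalkMap z)).1
  apply inj
  rw [map_mul]
  erw [stalkMap_germ_chartFn, stalkMap_germ_chartFn]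
  exact h

theorem stalkMap_germ_chartFn_comp {Y : Scheme.{0}} {k : Y ⟶ Spec (.of R)} {m : Y ⟶ X}
    (e : k ≫ j = m) (y : Y) (hy : m y ∈ j ''ᵁ ⊤) (a : R) :
    (m.stalkMap y).hom (X.presheaf.germ (j ''ᵁ ⊤) (m y) hy (chartFn j a)) = toStalk k y a := by
  subst e
  rw [toStalk_eq, Scheme.Hom.stalkMap_comp]
  exact congrArg (k.stalkMap y).hom (stalkMap_germ_chartFn j (k y) a)

theorem Lift.pull_stalkMap {Ω : Type} [Field Ω] [IsSepClosed Ω] {C : Scheme.{0}}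
    {s : Spec (.of Ω) ⟶ C} {V : C.Etale} (v : Lift s V) {x : C} (hx : s default = x) (h : C ⟶ X)
    (D : X.Opens) (hD : h x ∈ D) (hD' : (V.hom ≫ h) v.pt ∈ D) (f : Γ(X, D)) :
    v.pull hx ((h.stalkMap x).hom (X.presheaf.germ D (h x) hD f)) =
      ((V.hom ≫ h).stalkMap v.pt).hom (X.presheaf.germ D ((V.hom ≫ h) v.pt) hD' f) := by
  obtain rfl : V.hom v.pt = x := v.hom_pt.trans hx
  have : v.pull hx = (V.hom.stalkMap v.pt).hom := by
    change (C.presheaf.stalkSpecializes _ ≫ V.hom.stalkMap v.pt).hom = _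
    rw [TopCat.Presheaf.stalkSpecializes_refl, Category.id_comp]
  rw [this, Scheme.Hom.stalkMap_comp]
  rfl

end Chart

end LogTrop
end

noncomputable section

namespace LogTrop

/-! ### The prime ideal of an orbit closure -/

section OrbitIdeal

variable {n : ℕ} (σ : Set (Fin n → ℝ))

open Classical in
/-- The retraction of the coordinate ring of an affine toric variety onto the coordinate ring of its
closed orbit, which sends the monomials that are not invertible to zero. -/
def orbitRetract : coneRing σ →+* coneRing σ :=
  (AddMonoidAlgebra.lift ℂ (coneRing σ) (dualMonoid σ)
    { toFun := fun m => if -m.toAdd.1 ∈ dualMonoid σ then zmon m.toAdd else 0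
      map_one' := by
        have : -(1 : Multiplicative (dualMonoid σ)).toAdd.1 ∈ dualMonoid σ := by
          simp
        rw [if_pos this]
        rfl
      map_mul' := fun a b => by
        have key : -(a * b).toAdd.1 ∈ dualMonoid σ ↔
            -a.toAdd.1 ∈ dualMonoid σ ∧ -b.toAdd.1 ∈ dualMonoid σ := by
          have e : (a * b).toAdd.1 = a.toAdd.1 + b.toAdd.1 := rfl
          rw [e]
          constructor
          · intro h
            constructor
            · have := add_mem h b.toAdd.2
              rwa [neg_add, neg_add_cancel_right] at this
            · have := add_mem h a.toAdd.2
              rwa [neg_add, add_assoc, add_comm, add_assoc, add_neg_cancel, add_zero] at this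
          · rintro ⟨h, h'⟩
            rw [neg_add]
            exact add_mem h h'
        by_cases ha : -a.toAdd.1 ∈ dualMonoid σ
        · by_cases hb : -b.toAdd.1 ∈ dualMonoid σ
          · rw [if_pos (key.mpr ⟨ha, hb⟩), if_pos ha, if_pos hb, zmon, zmon, zmon,
              AddMonoidAlgebra.single_mul_single, one_mul]
            rfl
          · rw [if_neg fun h => hb (key.mp h).2, if_neg hb, mul_zero]
        · rw [if_neg fun h => ha (key.mp h).1, if_neg ha, zero_mul] }).toRingHom

variable {σ}

open Classical in
theorem orbitRetract_single (m : dualMonoid σ) (c : ℂ) :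
    orbitRetract σ (AddMonoidAlgebra.single m c) =
      if -m.1 ∈ dualMonoid σ then AddMonoidAlgebra.single m c else 0 := by
  refine (AddMonoidAlgebra.lift_single _ m c).trans ?_
  change c • (if -m.1 ∈ dualMonoid σ then zmon m else 0) = _
  split_ifs
  · rw [zmon, AddMonoidAlgebra.smul_single, smul_eq_mul, mul_one]
  · rw [smul_zero]

theorem orbitRetract_zmon_eq_zero {m : dualMonoid σ} (hm : -m.1 ∉ dualMonoid σ) :
    orbitRetract σ (zmon m) = 0 := by
  classical
  rw [zmon, orbitRetract_single, if_neg hm]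

/-- The retraction discards exactly the monomials that are not invertible, so they generate its
kernel. -/
theorem sub_orbitRetract_mem (f : coneRing σ) :
    f - orbitRetract σ f ∈ Ideal.span {a | ∃ m : dualMonoid σ, -m.1 ∉ dualMonoid σ ∧ zmon m = a} := by
  classical
  induction f using AddMonoidAlgebra.induction_linear with
  | zero => simp
  | add f g hf hg =>
    rw [map_add, add_sub_add_comm]
    exact Ideal.add_mem _ hf hg
  | single m c =>
    rw [orbitRetract_single]
    split_ifs with h
    · rw [sub_self]
      exact Ideal.zero_mem _
    · have : AddMonoidAlgebra.single m c = AddMonoidAlgebra.single 0 c * zmon m := by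
        rw [zmon, AddMonoidAlgebra.single_mul_single, zero_add, mul_one]
      rw [sub_zero, this]
      exact Ideal.mul_mem_left _ _ (Ideal.subset_span ⟨m, h, rfl⟩)

variable (σ) in
/-- The point of an affine toric variety which is the generic point of its closed orbit. -/
def orbitPoint : PrimeSpectrum (coneRing σ) where
  asIdeal := RingHom.ker (orbitRetract σ)
  isPrime := by
    -- A submonoid of a lattice has unique sums, hence its monoid algebra is a domain and the kernel
    -- of an endomorphism is prime.
    have : UniqueSums (dualMonoid σ) :=
      UniqueSums.of_injective_addHom (dualMonoid σ).subtype.toAddHom Subtype.val_injective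
        inferInstance
    have : NoZeroDivisors (coneRing σ) := inferInstance
    have : IsDomain (coneRing σ) := NoZeroDivisors.to_isDomain _
    exact RingHom.ker_isPrime _

theorem orbitPoint_asIdeal : (orbitPoint σ).asIdeal =
    Ideal.span {a | ∃ m : dualMonoid σ, -m.1 ∉ dualMonoid σ ∧ zmon m = a} := by
  refine le_antisymm (fun f hf => ?_) (Ideal.span_le.mpr ?_)
  · have := sub_orbitRetract_mem f
    rwa [(RingHom.mem_ker).mp hf, sub_zero] at this
  · rintro _ ⟨m, hm, rfl⟩
    exact orbitRetract_zmon_eq_zero hm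

end OrbitIdeal

/-! ### The cone over a segment -/

section Segment

/-- The lattice point of height one over a lattice point of the plane. -/
def up (v : Fin 2 → ℤ) : Fin 3 → ℤ := ![v 0, v 1, 1]

theorem sum_mul_up (m : Fin 3 → ℤ) (v : Fin 2 → ℤ) :
    m ⬝ᵥ up v = m 0 * v 0 + m 1 * v 1 + m 2 := by
  simp [dotProduct, Fin.sum_univ_three, up]

theorem up_mem_coneOver {τ : Set (Fin 2 → ℝ)} {v : Fin 2 → ℤ} (hv : (fun i => (v i : ℝ)) ∈ τ) :
    (fun i => (up v i : ℝ)) ∈ DegenerationFan.coneOver τ := by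
  refine subset_closure ⟨1, zero_le_one, _, hv, ?_⟩
  ext i
  fin_cases i <;> simp [up]

theorem coneOver_mono {τ τ' : Set (Fin 2 → ℝ)} (h : τ ⊆ τ') :
    DegenerationFan.coneOver τ ⊆ DegenerationFan.coneOver τ' :=
  closure_mono fun _ ⟨r, hr, m, hm, e⟩ => ⟨r, hr, m, h hm, e⟩

variable {v₁ v₂ : Fin 2 → ℤ}

/-- The segment between two lattice points. -/
abbrev seg (v₁ v₂ : Fin 2 → ℤ) : Set (Fin 2 → ℝ) :=
  segment ℝ (fun i => (v₁ i : ℝ)) (fun i => (v₂ i : ℝ))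

theorem cast_dotProduct (m u : Fin 3 → ℤ) :
    ((m ⬝ᵥ u : ℤ) : ℝ) = ∑ i, (m i : ℝ) * (u i : ℝ) := by
  simp [dotProduct]

/-- Nonnegativity is a closed condition inherited by nonnegative combinations, so the two vertices
suffice. -/
theorem mem_dualMonoid_seg {m : Fin 3 → ℤ} :
    m ∈ dualMonoid (DegenerationFan.coneOver (seg v₁ v₂)) ↔ 0 ≤ m ⬝ᵥ up v₁ ∧ 0 ≤ m ⬝ᵥ up v₂ := by
  constructor
  · intro h
    constructor
    · have := h _ (up_mem_coneOver (v := v₁) (left_mem_segment ℝ _ _))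
      rw [← cast_dotProduct] at this
      exact_mod_cast this
    · have := h _ (up_mem_coneOver (v := v₂) (right_mem_segment ℝ _ _))
      rw [← cast_dotProduct] at this
      exact_mod_cast this
  · rintro ⟨h₁, h₂⟩
    have hc : IsClosed {x : Fin 3 → ℝ | 0 ≤ ∑ i, (m i : ℝ) * x i} :=
      isClosed_le continuous_const (by fun_prop)
    refine fun x hx => closure_minimal ?_ hc hx
    rintro _ ⟨r, hr, _, ⟨a, b, ha, hb, hab, rfl⟩, rfl⟩
    rw [sum_mul_up] at h₁ h₂
    have h₁' : (0 : ℝ) ≤ m 0 * v₁ 0 + m 1 * v₁ 1 + m 2 := by exact_mod_cast h₁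
    have h₂' : (0 : ℝ) ≤ m 0 * v₂ 0 + m 1 * v₂ 1 + m 2 := by exact_mod_cast h₂
    have h := mul_nonneg hr (add_nonneg (mul_nonneg ha h₁') (mul_nonneg hb h₂'))
    refine h.trans_eq ?_
    rw [Fin.sum_univ_three]
    simp
    linear_combination (r * m 2 : ℝ) * hab

theorem span_coneOver_seg : Submodule.span ℝ (DegenerationFan.coneOver (seg v₁ v₂)) =
    Submodule.span ℝ {(fun i => (up v₁ i : ℝ)), fun i => (up v₂ i : ℝ)} := by
  refine le_antisymm (Submodule.span_le.mpr ?_) (Submodule.span_mono ?_)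
  · refine closure_minimal ?_ (Submodule.closed_of_finiteDimensional _)
    rintro _ ⟨r, hr, _, ⟨a, b, ha, hb, hab, rfl⟩, rfl⟩
    rw [SetLike.mem_coe, Submodule.mem_span_pair]
    refine ⟨r * a, r * b, ?_⟩
    ext i
    fin_cases i
    · simp [up]
      ring
    · simp [up]
      ring
    · simp [up]
      rw [← mul_add, hab, mul_one]
  · rintro _ (rfl | rfl)
    · exact up_mem_coneOver (left_mem_segment ℝ _ _)
    · exact up_mem_coneOver (right_mem_segment ℝ _ _)

theorem finrank_span_coneOver_seg (hv : v₁ ≠ v₂) :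
    Module.finrank ℝ (Submodule.span ℝ (DegenerationFan.coneOver (seg v₁ v₂))) = 2 := by
  rw [span_coneOver_seg]
  have h : LinearIndependent ℝ ![(fun i => (up v₁ i : ℝ)), fun i => (up v₂ i : ℝ)] := by
    rw [LinearIndependent.pair_iff]
    intro a b hab
    have e0 := congrFun hab 0
    have e1 := congrFun hab 1
    have e2 := congrFun hab 2
    simp [up] at e0 e1 e2
    have hb : b = -a := by linarith
    subst hb
    have : a = 0 := by
      by_contra ha
      apply hv
      ext i
      fin_cases i
      · have : a * ((v₁ 0 : ℝ) - v₂ 0) = 0 := by linarith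
        have := (mul_eq_zero.mp this).resolve_left ha
        have : (v₁ 0 : ℝ) = v₂ 0 := by linarith
        exact_mod_cast this
      · have : a * ((v₁ 1 : ℝ) - v₂ 1) = 0 := by linarith
        have := (mul_eq_zero.mp this).resolve_left ha
        have : (v₁ 1 : ℝ) = v₂ 1 := by linarith
        exact_mod_cast this
    exact ⟨this, by rw [this, neg_zero]⟩
  have := finrank_span_eq_card h
  rwa [Matrix.range_cons, Matrix.range_cons, Matrix.range_empty, Set.union_empty, Fintype.card_fin] at this

/-- The lattice length of a segment. -/
abbrev segLength (v₁ v₂ : Fin 2 → ℤ) : ℕ := Int.gcd (v₂ 0 - v₁ 0) (v₂ 1 - v₁ 1)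

theorem segLength_comm : segLength v₁ v₂ = segLength v₂ v₁ := by
  rw [segLength, segLength, ← neg_sub (v₁ 0), ← neg_sub (v₁ 1), Int.neg_gcd, Int.gcd_neg]

theorem segLength_pos (hv : v₁ ≠ v₂) : 0 < segLength v₁ v₂ := by
  refine Nat.pos_of_ne_zero fun h => hv ?_
  obtain ⟨h0, h1⟩ := Int.gcd_eq_zero_iff.mp h
  ext i
  fin_cases i
  · exact (sub_eq_zero.mp h0).symm
  · exact (sub_eq_zero.mp h1).symm

/-- Bézout coefficients `A`, `B` of `v₂ - v₁` give a form on the plane which grows by `l` along the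
segment; the third entry of each vector makes the form vanish at one end. -/
theorem exists_dotProduct_eq :
    ∃ s₁ s₂ : Fin 3 → ℤ, s₁ ⬝ᵥ up v₁ = segLength v₁ v₂ ∧ s₁ ⬝ᵥ up v₂ = 0 ∧
      s₂ ⬝ᵥ up v₁ = 0 ∧ s₂ ⬝ᵥ up v₂ = segLength v₁ v₂ ∧
      s₁ + s₂ = segLength v₁ v₂ • Pi.single 2 1 := by
  set A := Int.gcdA (v₂ 0 - v₁ 0) (v₂ 1 - v₁ 1)
  set B := Int.gcdB (v₂ 0 - v₁ 0) (v₂ 1 - v₁ 1)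
  have h : (segLength v₁ v₂ : ℤ) = (v₂ 0 - v₁ 0) * A + (v₂ 1 - v₁ 1) * B :=
    Int.gcd_eq_gcd_ab _ _
  refine ⟨![-A, -B, A * v₂ 0 + B * v₂ 1], ![A, B, -(A * v₁ 0 + B * v₁ 1)], ?_, ?_, ?_, ?_, ?_⟩
  · rw [sum_mul_up, h]
    simp
    ring
  · rw [sum_mul_up]
    simp
    ring
  · rw [sum_mul_up]
    simp
  · rw [sum_mul_up, h]
    simp
    ring
  · ext i
    fin_cases i
    · simp
    · simp
    · simp
      rw [h]
      ring

theorem segLength_dvd {m : Fin 3 → ℤ} (hm : m ⬝ᵥ up v₁ = 0) :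
    (segLength v₁ v₂ : ℤ) ∣ m ⬝ᵥ up v₂ := by
  have e : m ⬝ᵥ up v₂ = m 0 * (v₂ 0 - v₁ 0) + m 1 * (v₂ 1 - v₁ 1) := by
    rw [sum_mul_up] at hm ⊢
    linear_combination hm
  rw [e]
  exact dvd_add (Dvd.dvd.mul_left (Int.gcd_dvd_left ..) _) (Dvd.dvd.mul_left (Int.gcd_dvd_right ..) _)

end Segment

end LogTrop
end

noncomputable section

namespace LogTrop

/-! ### Points and strata of toric varieties -/

namespace Fan

variable {n : ℕ} (F : Fan n)

/-- The closed orbit in the affine chart of a cone. -/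
def closedOrbit (σ : F.Cone) : Set (Spec (.of (coneRing σ.1))) :=
  {x | ∀ m : dualMonoid σ.1, -m.1 ∉ dualMonoid σ.1 → zmon m ∈ x.asIdeal}

theorem exists_chart_eq (y : F.toric) : ∃ (σ : F.Cone) (z : Spec (.of (coneRing σ.1))),
    F.chart σ z = y := by
  obtain ⟨i, z, hz⟩ := (Scheme.IsLocallyDirected.openCover F.charts).exists_eq y
  exact ⟨_, _, hz⟩

theorem exists_of_chart_eq {σ τ : F.Cone} {z : Spec (.of (coneRing σ.1))}
    {z' : Spec (.of (coneRing τ.1))} (h : F.chart σ z = F.chart τ z') :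
    ∃ (ρ : F.Cone) (f : ρ ⟶ σ) (g : ρ ⟶ τ) (w : Spec (.of (coneRing ρ.1))),
      F.charts.map f w = z ∧ F.charts.map g w = z' :=
  (Scheme.IsLocallyDirected.ι_eq_ι_iff F.charts).mp h

theorem charts_map_comp_chart {τ σ : F.Cone} (f : τ ⟶ σ) : F.charts.map f ≫ F.chart σ = F.chart τ :=
  Limits.colimit.w F.charts f

theorem chart_map {τ σ : F.Cone} (f : τ ⟶ σ) (z : Spec (.of (coneRing τ.1))) :
    F.chart σ (F.charts.map f z) = F.chart τ z := by
  rw [← F.charts_map_comp_chart f]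
  rfl

theorem zmon_mem_map_iff {τ σ : F.Cone} (f : τ ⟶ σ) (z : Spec (.of (coneRing τ.1)))
    (m : dualMonoid σ.1) : zmon m ∈ (F.charts.map f z).asIdeal ↔
      zmon (AddSubmonoid.inclusion (dualMonoid_anti (leOfHom f : τ.1 ⊆ σ.1)) m) ∈ z.asIdeal := by
  change coneRingMap (leOfHom f : τ.1 ⊆ σ.1) (zmon m) ∈ z.asIdeal ↔ _
  rw [zmon, coneRingMap_single]
  rfl

/-- Every point lies on the closed orbit of some affine chart. -/
theorem exists_mem_closedOrbit (y : F.toric) : ∃ (τ : F.Cone) (z : Spec (.of (coneRing τ.1))),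
    F.chart τ z = y ∧ z ∈ F.closedOrbit τ := by
  obtain ⟨σ, z, hz⟩ := F.exists_chart_eq y
  let T : Set (Set (Fin n → ℝ)) := {τ | ∃ (h : τ ∈ F.cones) (z : _), F.chart ⟨τ, h⟩ z = y}
  have hT : T.Finite := F.finite.subset fun τ ⟨h, _⟩ => h
  -- For a minimal cone whose chart contains `y`, a noninvertible monomial cannot be nonzero at `y`:
  -- the chart of the proper face where it vanishes would contain `y`.
  obtain ⟨τ, ⟨hτ, z, rfl⟩, hmin⟩ := hT.exists_minimal ⟨σ.1, σ.2, z, hz⟩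
  refine ⟨⟨τ, hτ⟩, z, rfl, fun m hm => ?_⟩
  by_contra hz
  let τ' : F.Cone := ⟨{x ∈ τ | ∑ i, (m.1 i : ℝ) * x i = 0}, F.face_mem τ hτ m.1 m.2⟩
  let f : τ' ⟶ (⟨τ, hτ⟩ : F.Cone) := homOfLE fun x hx => hx.1
  obtain ⟨w, hw⟩ : z ∈ Set.range (F.charts.map f) := by
    rw [(F.charts_map f (m := m) rfl).2]
    exact hz
  have hle : τ ⊆ τ'.1 := hmin ⟨τ'.2, w, (F.chart_map f w).symm.trans (congrArg _ hw)⟩ fun x hx => hx.1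
  apply hm
  intro x hx
  have := (hle hx).2
  simp [Finset.sum_neg_distrib, this]

end Fan

namespace DegenerationFan

variable (F : DegenerationFan)

theorem isClosed_stratum (σ : F.Cone) : IsClosed (F.stratum σ.1) := by
  have : F.stratum σ.1 = closure (F.chart σ '' F.closedOrbit σ) := by
    refine Set.ext fun y => ?_
    constructor
    · intro hy
      obtain ⟨_, hy⟩ := Set.mem_iUnion.mp hy
      exact hy
    · intro hy
      exact Set.mem_iUnion.mpr ⟨σ.2, hy⟩
  rw [this]
  exact isClosed_closure

theorem mem_stratum_iff {σ : Set (Fin 3 → ℝ)} {y : F.toric} :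
    y ∈ F.stratum σ ↔ ∃ hσ : σ ∈ F.cones, y ∈ closure (F.chart ⟨σ, hσ⟩ '' F.closedOrbit ⟨σ, hσ⟩) :=
  Set.mem_iUnion

/-- An open subset which meets a stratum meets the orbit. -/
theorem exists_mem_closedOrbit_of_mem_stratum {σ : Set (Fin 3 → ℝ)} {y : F.toric}
    (hy : y ∈ F.stratum σ) {U : Set F.toric} (hU : IsOpen U) (hyU : y ∈ U) :
    ∃ (hσ : σ ∈ F.cones) (z : _), z ∈ F.closedOrbit ⟨σ, hσ⟩ ∧ F.chart ⟨σ, hσ⟩ z ∈ U := by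
  obtain ⟨hσ, hy⟩ := F.mem_stratum_iff.mp hy
  obtain ⟨_, hU, z, hz, rfl⟩ := mem_closure_iff.mp hy U hU hyU
  exact ⟨hσ, z, hz, hU⟩

/-- If a point of an affine chart lies on a stratum, then the cone of the stratum is contained in the
cone of the chart. -/
theorem subset_of_mem_stratum {σ : Set (Fin 3 → ℝ)} {τ : F.Cone} {z : Spec (.of (coneRing τ.1))}
    (hz : F.chart τ z ∈ F.stratum σ) : σ ⊆ τ.1 := by
  obtain ⟨hσ, z', hz', ⟨w, hw⟩⟩ := F.exists_mem_closedOrbit_of_mem_stratum hz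
    (F.chart τ).isOpenEmbedding.isOpen_range ⟨z, rfl⟩
  obtain ⟨ρ, f, g, u, rfl, rfl⟩ := F.exists_of_chart_eq hw
  refine Set.Subset.trans ?_ (leOfHom f : ρ.1 ⊆ τ.1)
  -- The form cutting out `ρ` in `σ` has a nonzero monomial at a point of the closed orbit of `σ`,
  -- so it is invertible there; thus `σ ⊆ ρ`.
  obtain ⟨m, hm⟩ := F.exists_face hσ ρ.2 (leOfHom g)
  have hmem : zmon m ∉ (F.charts.map g u).asIdeal := by
    have : F.charts.map g u ∈ Set.range (F.charts.map g) := ⟨u, rfl⟩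
    rw [(F.charts_map g hm).2] at this
    exact this
  have hinv : -m.1 ∈ dualMonoid σ := by
    by_contra hneg
    exact hmem (hz' m hneg)
  intro x hx
  rw [hm]
  refine ⟨hx, le_antisymm ?_ (m.2 x hx)⟩
  have := hinv x hx
  simpa [Finset.sum_neg_distrib] using this

/-- A monomial of an affine chart which is positive on the cone of a stratum vanishes on that
stratum. -/
theorem zmon_mem_of_mem_stratum {σ : Set (Fin 3 → ℝ)} {τ : F.Cone} (hστ : σ ⊆ τ.1)
    {z : Spec (.of (coneRing τ.1))} (hz : F.chart τ z ∈ F.stratum σ) (m : dualMonoid τ.1)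
    (hm : -m.1 ∉ dualMonoid σ) : zmon m ∈ z.asIdeal := by
  by_contra hmz
  -- The open set where the monomial does not vanish would meet the orbit of `σ`, on which it is
  -- zero.
  obtain ⟨hσ, z', hz', ⟨w, hmw, hw⟩⟩ := F.exists_mem_closedOrbit_of_mem_stratum hz
    ((F.chart τ).isOpenEmbedding.isOpenMap _ (PrimeSpectrum.basicOpen (zmon m)).2) ⟨z, hmz, rfl⟩
  let f : (⟨σ, hσ⟩ : F.Cone) ⟶ τ := homOfLE hστ
  rw [← F.chart_map f] at hw
  obtain rfl := (F.chart τ).isOpenEmbedding.injective hw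
  exact hmw ((F.zmon_mem_map_iff f z' m).mpr (hz' _ hm))

theorem chart_mem_stratum {σ : F.Cone} {z : Spec (.of (coneRing σ.1))} (hz : z ∈ F.closedOrbit σ) :
    F.chart σ z ∈ F.stratum σ.1 :=
  F.mem_stratum_iff.mpr ⟨σ.2, subset_closure ⟨z, hz, rfl⟩⟩

theorem orbitPoint_mem_closedOrbit (σ : F.Cone) :
    (orbitPoint σ.1 : Spec (.of (coneRing σ.1))) ∈ F.closedOrbit σ :=
  fun _ hm => orbitRetract_zmon_eq_zero hm

theorem orbitPoint_specializes {σ : F.Cone} {z : Spec (.of (coneRing σ.1))}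
    (hz : z ∈ F.closedOrbit σ) : (orbitPoint σ.1 : Spec (.of (coneRing σ.1))) ⤳ z := by
  refine (PrimeSpectrum.le_iff_specializes _ _).mp ?_
  change (orbitPoint σ.1).asIdeal ≤ z.asIdeal
  rw [orbitPoint_asIdeal, Ideal.span_le]
  rintro _ ⟨m, hm, rfl⟩
  exact hz m hm

/-- The generic point of a stratum. -/
theorem orbitPoint_specializes_of_mem_stratum (σ : F.Cone) {y : F.toric} (hy : y ∈ F.stratum σ.1) :
    F.chart σ (orbitPoint σ.1) ⤳ y := by
  obtain ⟨_, hy⟩ := F.mem_stratum_iff.mp hy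
  rw [specializes_iff_mem_closure]
  refine closure_minimal ?_ isClosed_closure hy
  rintro _ ⟨z, hz, rfl⟩
  exact specializes_iff_mem_closure.mp
    ((F.orbitPoint_specializes hz).map (F.chart σ).continuous)

/-- A point of a stratum of dimension one which does not lie on a stratum of dimension zero lies on
the orbit. -/
theorem exists_mem_closedOrbit_of_finrank (σ : F.Cone)
    (hσ : Module.finrank ℝ (Submodule.span ℝ σ.1) = 2) {y : F.toric} (hy : y ∈ F.stratum σ.1)
    (h₃ : ∀ τ ∈ F.cones, Module.finrank ℝ (Submodule.span ℝ τ) = 3 → y ∉ F.stratum τ) :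
    ∃ z ∈ F.closedOrbit σ, F.chart σ z = y := by
  obtain ⟨τ, z, rfl, hz⟩ := F.exists_mem_closedOrbit y
  have hle : σ.1 ⊆ τ.1 := F.subset_of_mem_stratum hy
  have hspan := Submodule.span_mono (R := ℝ) hle
  have h2 := Submodule.finrank_mono hspan
  have h3 : Module.finrank ℝ (Submodule.span ℝ τ.1) ≤ 3 := by
    simpa using Submodule.finrank_le (Submodule.span ℝ τ.1)
  have hne : Module.finrank ℝ (Submodule.span ℝ τ.1) ≠ 3 := fun h =>
    h₃ τ.1 τ.2 h (F.chart_mem_stratum hz)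
  -- The cone of the orbit of `y` contains `σ` and has dimension two as well; a face with the same
  -- span is the whole cone.
  have heq : Submodule.span ℝ σ.1 = Submodule.span ℝ τ.1 :=
    Submodule.eq_of_le_of_finrank_eq hspan (by omega)
  obtain ⟨m, hm⟩ := F.exists_face τ.2 σ.2 hle
  have hτσ : τ.1 ⊆ σ.1 := by
    intro x hx
    let φ : (Fin 3 → ℝ) →ₗ[ℝ] ℝ := ∑ i, (m.1 i : ℝ) • LinearMap.proj i
    have hφ : ∀ x, φ x = ∑ i, (m.1 i : ℝ) * x i := fun x => by simp [φ]
    have hker : Submodule.span ℝ σ.1 ≤ LinearMap.ker φ := by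
      rw [Submodule.span_le]
      intro x hx
      rw [hm] at hx
      exact (hφ x).trans hx.2
    rw [hm]
    exact ⟨hx, (hφ x).symm.trans (hker (heq ▸ Submodule.subset_span hx))⟩
  obtain rfl : σ = τ := Subtype.ext (Set.Subset.antisymm hle hτσ)
  exact ⟨z, hz, rfl⟩

end DegenerationFan

end LogTrop
end

noncomputable section

namespace LogTrop

/-! ### Components which are mapped into toric strata -/

section Pull

variable {R : Type} [CommRing R] {C X : Scheme.{0}} (j : Spec (.of R) ⟶ X) [IsOpenImmersion j]
  (h : C ⟶ X) {x : C} (hx : h x ∈ j ''ᵁ ⊤)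

/-- The germ of the pull-back of an element of the ring of an affine chart. -/
def chartGerm : R →+* C.presheaf.stalk x :=
  (h.stalkMap x).hom.comp ((X.presheaf.germ (j ''ᵁ ⊤) (h x) hx).hom.comp (chartFn j))

theorem chartGerm_mem_stalkIdeal_iff {Z : Set C} {η : C} (hη : η ∈ Z) (hZ : ∀ z ∈ Z, η ⤳ z)
    (hηx : η ⤳ x) {ζ : Spec (.of R)} (hζ : j ζ = h η) (a : R) :
    chartGerm j h hx a ∈ stalkIdeal Z x ↔ a ∈ ζ.asIdeal := by
  have e : chartGerm j h hx a =
      C.presheaf.germ (h ⁻¹ᵁ (j ''ᵁ ⊤)) x hx (h.app (j ''ᵁ ⊤) (chartFn j a)) :=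
    congr($(Scheme.Hom.germ_stalkMap h (j ''ᵁ ⊤) x hx).hom (chartFn j a))
  have e' : η ∈ C.basicOpen (h.app (j ''ᵁ ⊤) (chartFn j a)) ↔ h η ∈ X.basicOpen (chartFn j a) :=
    iff_of_eq (congrArg (η ∈ ·) (Scheme.preimage_basicOpen h (chartFn j a)).symm)
  rw [e]
  refine (germ_mem_stalkIdeal_iff hη hZ hηx (h ⁻¹ᵁ (j ''ᵁ ⊤)) hx _).trans ((not_congr e').trans ?_)
  rw [← hζ]
  exact (not_congr (mem_basicOpen_chartFn j ζ a)).trans not_not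

/-- The ideal of a stratum with generic point `θ` is generated, up to denominators that become
units, by the elements of the chart ring in the prime of `θ`. -/
theorem map_stalkIdeal_le {D : Set X} {θ z : Spec (.of R)} (hθ : j θ ∈ D)
    (hD : ∀ y ∈ D, j θ ⤳ y) (hz : j z = h x) (hθx : j θ ⤳ h x) {J : Ideal (C.presheaf.stalk x)}
    (hJ : ∀ a ∈ θ.asIdeal, chartGerm j h hx a ∈ J) :
    (stalkIdeal D (h x)).map (h.stalkMap x).hom ≤ J := by
  rw [Ideal.map_le_iff_le_comap]
  intro s hs
  obtain ⟨a, b, hb, e⟩ := exists_mul_germ_chartFn j z hz hx s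
  have ha : a ∈ θ.asIdeal := by
    have : X.presheaf.germ (j ''ᵁ ⊤) (h x) hx (chartFn j a) ∈ stalkIdeal D (h x) := by
      rw [← e]
      exact Ideal.mul_mem_right _ _ hs
    rw [germ_mem_stalkIdeal_iff hθ hD hθx] at this
    exact not_not.mp ((not_congr (mem_basicOpen_chartFn j θ a)).mp this)
  have hu : IsUnit (chartGerm j h hx b) := by
    refine IsUnit.map (h.stalkMap x).hom ((X.mem_basicOpen _ (h x) hx).mp ?_)
    rw [← hz]
    exact (mem_basicOpen_chartFn j z b).mpr hb
  have := congrArg (h.stalkMap x).hom e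
  rw [map_mul] at this
  refine (J.mul_unit_mem_iff_mem hu).mp ?_
  exact (congrArg (· ∈ J) this).mpr (hJ a ha)

end Pull

section Component

variable {v₁ v₂ : Fin 2 → ℤ} {σ : Set (Fin 3 → ℝ)} (hσ : σ = DegenerationFan.coneOver (seg v₁ v₂))
include hσ

/-- A form that vanishes at `v₁` takes a multiple of the lattice length at `v₂`, so a positive value
is at least that of `s`, and subtracting `s` keeps the form nonnegative. -/
theorem dvd_zmon_of_dotProduct_eq_zero {s m : dualMonoid σ} (hs₁ : s.1 ⬝ᵥ up v₁ = 0)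
    (hs₂ : s.1 ⬝ᵥ up v₂ = segLength v₁ v₂) (hm₁ : m.1 ⬝ᵥ up v₁ = 0) (hm₂ : 0 < m.1 ⬝ᵥ up v₂) :
    zmon s ∣ zmon m := by
  subst hσ
  obtain ⟨k, hk⟩ := segLength_dvd (v₂ := v₂) hm₁
  have hle : (segLength v₁ v₂ : ℤ) ≤ m.1 ⬝ᵥ up v₂ := Int.le_of_dvd hm₂ ⟨k, hk⟩
  have hmem : m.1 - s.1 ∈ dualMonoid (DegenerationFan.coneOver (seg v₁ v₂)) := by
    rw [mem_dualMonoid_seg, sub_dotProduct, sub_dotProduct]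
    omega
  refine ⟨zmon ⟨_, hmem⟩, ?_⟩
  rw [zmon, zmon, zmon, AddMonoidAlgebra.single_mul_single, one_mul]
  congr 1
  ext1
  simp

/-- So modulo the monomials positive at `v₁`, the ideal of the orbit of the segment is generated by
`zmon s` alone. -/
theorem dotProduct_pos_or_dvd {s m : dualMonoid σ} (hs₁ : s.1 ⬝ᵥ up v₁ = 0)
    (hs₂ : s.1 ⬝ᵥ up v₂ = segLength v₁ v₂) (hm : -m.1 ∉ dualMonoid σ) :
    0 < m.1 ⬝ᵥ up v₁ ∨ zmon s ∣ zmon m := by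
  have h := m.2
  by_cases h₁ : 0 < m.1 ⬝ᵥ up v₁
  · exact .inl h₁
  · right
    subst hσ
    rw [mem_dualMonoid_seg] at h hm
    rw [neg_dotProduct, neg_dotProduct] at hm
    exact dvd_zmon_of_dotProduct_eq_zero rfl hs₁ hs₂ (by omega) (by omega)

end Component

namespace DegenerationFan

variable (F : DegenerationFan) {v₁ v₂ : Fin 2 → ℤ} (hv : v₁ ≠ v₂) {σ : F.Cone}
  (hσ : σ.1 = coneOver (seg v₁ v₂)) {C : Scheme.{0}} {h : C ⟶ F.toric} {Z : Set C}
  (hZ : Z ∈ irreducibleComponents C)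
  (hmaps : Set.MapsTo h Z (F.cellStratum {fun i => (v₁ i : ℝ)}))
  (hnot : ¬ Set.MapsTo h Z (F.stratum σ.1)) {x : C} (hxZ : x ∈ Z)
  {z₀ : Spec (.of (coneRing σ.1))} (hz₀ : z₀ ∈ F.closedOrbit σ) (hz : F.chart σ z₀ = h x)
  (hx : h x ∈ F.chart σ ''ᵁ ⊤) {s : dualMonoid σ.1} (hs₁ : s.1 ⬝ᵥ up v₁ = 0)
  (hs₂ : s.1 ⬝ᵥ up v₂ = segLength v₁ v₂)
include hv hσ hZ hmaps hnot hxZ hz₀ hz hs₁ hs₂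

/-- The ideal of a component which is mapped into the stratum of a vertex of a segment, at a point of
the orbit of the segment: it contains the monomials which are positive at the vertex, and the
preimage of the stratum of the segment is given by the primitive monomial which vanishes at the
vertex. -/
theorem stalkIdeal_component : (stalkIdeal Z x).IsPrime ∧
    (∀ m : dualMonoid σ.1, 0 < m.1 ⬝ᵥ up v₁ →
      chartGerm (F.chart σ) h hx (zmon m) ∈ stalkIdeal Z x) ∧
    chartGerm (F.chart σ) h hx (zmon s) ∉ stalkIdeal Z x ∧
    stalkIdeal Z x ⊔ (stalkIdeal (F.stratum σ.1) (h x)).map (h.stalkMap x).hom =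
      stalkIdeal Z x ⊔ Ideal.span {chartGerm (F.chart σ) h hx (zmon s)} := by
  obtain ⟨η, hη, hgen⟩ := exists_genericPoint hZ.1 (isClosed_of_mem_irreducibleComponents Z hZ)
  have hηx := hgen x hxZ
  have hsp : h η ⤳ h x := hηx.map h.continuous
  obtain ⟨ζ, -, hζ⟩ := hsp.mem_open (F.chart σ ''ᵁ ⊤).2 hx
  have iff := chartGerm_mem_stalkIdeal_iff (F.chart σ) h hx hη hgen hηx hζ
  have hsub : coneOver {fun i => (v₁ i : ℝ)} ⊆ σ.1 := by
    rw [hσ]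
    exact coneOver_mono (Set.singleton_subset_iff.mpr (left_mem_segment ℝ _ _))
  have hpos : ∀ m : dualMonoid σ.1, 0 < m.1 ⬝ᵥ up v₁ → zmon m ∈ ζ.asIdeal := by
    intro m hm
    refine F.zmon_mem_of_mem_stratum hsub (z := ζ) ?_ m fun hneg => ?_
    · exact (congrArg (· ∈ F.stratum _) hζ).mpr (hmaps hη)
    · have := hneg _ (up_mem_coneOver (v := v₁) rfl)
      rw [← cast_dotProduct, neg_dotProduct] at this
      have : 0 ≤ -(m.1 ⬝ᵥ up v₁) := by exact_mod_cast this
      omega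
  -- If `zmon s` vanished at the generic point of the component, so would every noninvertible
  -- monomial. The component would lie in the stratum of the segment, contrary to transversality.
  have hsζ : zmon s ∉ ζ.asIdeal := by
    intro hmem
    apply hnot
    have hζ' : ζ ∈ F.closedOrbit σ := by
      intro m hm
      rcases dotProduct_pos_or_dvd hσ hs₁ hs₂ hm with h | h
      · exact hpos m h
      · exact Ideal.mem_of_dvd _ h hmem
    have := F.chart_mem_stratum hζ'
    have hη' : h η ∈ F.stratum σ.1 := (congrArg (· ∈ F.stratum σ.1) hζ).mp this
    intro y hy
    exact ((hgen y hy).map h.continuous).mem_closed (F.isClosed_stratum σ) hη'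
  refine ⟨isPrime_stalkIdeal hη hgen hηx, fun m hm => (iff _).mpr (hpos m hm),
    fun hmem => hsζ ((iff _).mp hmem), ?_⟩
  have hθ : F.chart σ (orbitPoint σ.1) ∈ F.stratum σ.1 :=
    F.chart_mem_stratum (F.orbitPoint_mem_closedOrbit σ)
  have hD : ∀ y ∈ F.stratum σ.1, F.chart σ (orbitPoint σ.1) ⤳ y := fun y hy =>
    F.orbitPoint_specializes_of_mem_stratum σ hy
  have hxD : h x ∈ F.stratum σ.1 := hz ▸ F.chart_mem_stratum hz₀
  refine le_antisymm (sup_le le_sup_left ?_) (sup_le le_sup_left ?_)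
  · refine map_stalkIdeal_le (F.chart σ) h hx hθ hD hz (hD _ hxD) fun a ha => ?_
    have hle : (orbitPoint σ.1).asIdeal ≤
        (stalkIdeal Z x ⊔ Ideal.span {chartGerm (F.chart σ) h hx (zmon s)}).comap
          (chartGerm (F.chart σ) h hx) := by
      rw [orbitPoint_asIdeal, Ideal.span_le]
      rintro _ ⟨m, hm, rfl⟩
      rcases dotProduct_pos_or_dvd hσ hs₁ hs₂ hm with h' | h'
      · exact Ideal.mem_sup_left ((iff _).mpr (hpos m h'))
      · exact Ideal.mem_sup_right (Ideal.mem_span_singleton.mpr (map_dvd _ h'))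
    exact hle ha
  · rw [Ideal.span_singleton_le_iff_mem]
    refine Ideal.mem_sup_right (Ideal.mem_map_of_mem _ ?_)
    refine (germ_mem_stalkIdeal_iff hθ hD (hD _ hxD) _ hx _).mpr ?_
    refine (not_congr (mem_basicOpen_chartFn (F.chart σ) _ _)).mpr (not_not.mpr ?_)
    refine F.orbitPoint_mem_closedOrbit σ s fun hneg => ?_
    have := (congrArg (fun τ => -s.1 ∈ dualMonoid τ) hσ).mp hneg
    rw [mem_dualMonoid_seg, neg_dotProduct, neg_dotProduct] at this
    have := segLength_pos hv
    omega

end DegenerationFan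

end LogTrop
end

noncomputable section

namespace LogTrop

/-! ### Toric sections on the curve -/

theorem LogHom.map_res_toEtaleTop {X Y : Scheme.{0}} {f : X ⟶ Y} {L : LogStr X} {N : LogStr Y}
    (F : LogHom f L N) {U : X.Etale} {V : Y.Etale} (φ : U.left ⟶ V.left)
    (h : φ ≫ V.hom = U.hom ≫ f) (τ : N.global) :
    F.map φ h (N.res (toEtaleTop V) τ) = L.res (toEtaleTop U) (F.global τ) := by
  have hφ : (φ ≫ (toEtaleTop V).left) ≫ (etaleTop Y).hom = U.hom ≫ f :=
    (Category.comp_id _).trans h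
  have hU : ((toEtaleTop U).left ≫ f) ≫ (etaleTop Y).hom = U.hom ≫ f := Category.comp_id _
  have e : φ ≫ (toEtaleTop V).left = (toEtaleTop U).left ≫ f := h
  refine (F.map_res φ (toEtaleTop V) h hφ τ).trans
    (Eq.trans ?_ (F.res_map (U := etaleTop X) (V := etaleTop Y) f (toEtaleTop U) _ hU τ).symm)
  congr 1
  congr 1

/-- The pull-back of sections along two morphisms of log schemes to an étale neighbourhood. -/
theorem LogHom.exists_pullback {C X Y : Scheme.{0}} {g : C ⟶ X} {f : X ⟶ Y} {L : LogStr C}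
    {L₀ : LogStr X} {N : LogStr Y} (gl : LogHom g L L₀) (i : LogHom f L₀ N) {Ω : Type} [Field Ω]
    [IsSepClosed Ω] (p : Spec (.of Ω) ⟶ C) (W : Y.Etale) {z : W.left}
    (hz : W.hom z = (g ≫ f) (p default)) :
    ∃ (V : C.Etale) (_ : Lift p V) (k : V.left ⟶ W.left) (μ : N.sec W →* L.sec V),
      k ≫ W.hom = V.hom ≫ g ≫ f ∧ (∀ t, L.α V (μ t) = k.appTop (N.α W t)) ∧
      ∀ τ : N.global,
        μ (N.res (toEtaleTop W) τ) = L.res (toEtaleTop V) (gl.global (i.global τ)) := by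
  have : Etale W.hom := W.prop
  -- The two successive fibre products, each an étale neighbourhood to which one of the log
  -- morphisms applies.
  let W₀ : X.Etale := MorphismProperty.Over.mk ⊤ (Limits.pullback.fst f W.hom)
    (inferInstance : Etale (Limits.pullback.fst f W.hom))
  have : Etale W₀.hom := W₀.prop
  let V : C.Etale := MorphismProperty.Over.mk ⊤ (Limits.pullback.fst g W₀.hom)
    (inferInstance : Etale (Limits.pullback.fst g W₀.hom))
  let a : V.left ⟶ W₀.left := Limits.pullback.snd g W₀.hom
  let b : W₀.left ⟶ W.left := Limits.pullback.snd f W.hom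
  have ha : a ≫ W₀.hom = V.hom ≫ g := Limits.pullback.condition.symm
  have hb : b ≫ W.hom = W₀.hom ≫ f := Limits.pullback.condition.symm
  obtain ⟨z₀, hz₀, -⟩ := Scheme.Pullback.exists_preimage_pullback (f := f) (g := W.hom)
    (g (p default)) z hz.symm
  obtain ⟨y, hy, -⟩ := Scheme.Pullback.exists_preimage_pullback (f := g) (g := W₀.hom)
    (p default) z₀ hz₀.symm
  obtain ⟨v, -⟩ := exists_lift_of_hom_eq (W := V) hy
  refine ⟨V, v, a ≫ b, (gl.map a ha).comp (i.map b hb), ?_, fun t => ?_, fun τ => ?_⟩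
  · rw [Category.assoc, hb, ← Category.assoc, ha, Category.assoc]
  · change L.α V (gl.map a ha (i.map b hb t)) = _
    rw [gl.α_map, i.α_map, Scheme.Hom.comp_appTop]
    rfl
  · exact (congrArg (gl.map a ha) (i.map_res_toEtaleTop b hb τ)).trans
      (gl.map_res_toEtaleTop a ha _)

namespace DegenerationFan

variable (F : DegenerationFan)

/-- The affine chart of a cone as an étale neighbourhood. -/
def chartEtale (σ : F.Cone) : F.toric.Etale :=
  MorphismProperty.Over.mk ⊤ (F.chart σ) (inferInstance : Etale (F.chart σ))

/-- A point in the chart and in the torus comes from the chart of a common face contained in `{0}`,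
where every monomial has an inverse. -/
theorem zmon_mem_divisorialSubmonoid (σ : F.Cone) (m : dualMonoid σ.1) :
    (Scheme.ΓSpecIso (.of (coneRing σ.1))).inv.hom (zmon m) ∈
      divisorialSubmonoid F.toric F.torus (F.chartEtale σ) := by
  rintro (x : Spec (.of (coneRing σ.1))) ⟨y, hy⟩
  obtain ⟨ρ, f, k, w, rfl, -⟩ := F.exists_of_chart_eq hy.symm
  have hmem : zmon m ∉ (F.charts.map f w).asIdeal := by
    rw [F.zmon_mem_map_iff f w m]
    let w' : PrimeSpectrum (coneRing ρ.1) := w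
    intro h
    apply w'.isPrime.ne_top
    refine Ideal.eq_top_of_isUnit_mem _ h ?_
    have hneg : -m.1 ∈ dualMonoid ρ.1 := by
      intro x hx
      have : x = 0 := (leOfHom k : ρ.1 ⊆ {0}) hx
      simp [this]
    refine IsUnit.of_mul_eq_one (zmon ⟨-m.1, hneg⟩) ?_
    rw [zmon, zmon, AddMonoidAlgebra.single_mul_single, AddMonoidAlgebra.one_def, one_mul]
    congr 1
    ext1
    simp
  have := AlgebraicGeometry.basicOpen_eq_of_affine (R := .of (coneRing σ.1)) (zmon m)
  exact (congrArg (F.charts.map f w ∈ ·) this).mpr hmem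

/-- The monomials as sections of the log structure. -/
def chartSec (σ : F.Cone) (m : dualMonoid σ.1) : F.logStr.sec (F.chartEtale σ) :=
  (⟨_, F.zmon_mem_divisorialSubmonoid σ m⟩ :
    divisorialSubmonoid F.toric F.torus (F.chartEtale σ))

theorem α_chartSec (σ : F.Cone) (m : dualMonoid σ.1) :
    F.logStr.α (F.chartEtale σ) (F.chartSec σ m) =
      (Scheme.ΓSpecIso (.of (coneRing σ.1))).inv (zmon m) := rfl

theorem chartSec_mul_chartSec {σ : F.Cone} {m₁ m₂ : dualMonoid σ.1} {l : ℕ}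
    (h : m₁.1 + m₂.1 = l • Pi.single 2 1) : F.chartSec σ m₁ * F.chartSec σ m₂ =
      F.logStr.res (toEtaleTop (F.chartEtale σ)) F.tSec ^ l := by
  have hz : zmon m₁ * zmon m₂ = zmon ⟨_, F.height_mem σ⟩ ^ l := by
    rw [zmon, zmon, zmon, AddMonoidAlgebra.single_mul_single, AddMonoidAlgebra.single_pow, one_mul,
      one_pow]
    congr 1
    exact Subtype.ext h
  refine Subtype.ext ?_
  change (Scheme.ΓSpecIso (.of (coneRing σ.1))).inv.hom (zmon m₁) *
    (Scheme.ΓSpecIso (.of (coneRing σ.1))).inv.hom (zmon m₂) = ((F.chart σ).appTop F.tFun) ^ l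
  rw [F.chart_tFun σ, ← map_mul, hz, map_pow]

end DegenerationFan

end LogTrop
end


/-! ### The weight and the node integer at a point of `D_E` -/

theorem mainTheorem7 (F : DegenerationFan) (v₁ v₂ : Fin 2 → ℤ) (hv : v₁ ≠ v₂)
    (hE : segment ℝ (fun i => (v₁ i : ℝ)) (fun i => (v₂ i : ℝ)) ∈ F.cells)
    (L₀ : LogStr F.centralFibre) (i : LogHom F.inclusion L₀ F.logStr) (hi : i.IsStrict)
    (C : Scheme.{0}) (str : C ⟶ Spec (.of ℂ)) (L : LogStr C) (ρ : L.global)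
    (hC : IsLogCurve str L ρ)
    (g : C ⟶ F.centralFibre) (hg : g ≫ F.toPoint = str)
    (gl : LogHom g L L₀) (hgl : gl.global (i.global F.tSec) = ρ)
    (htrans : F.IsToricallyTransverse g)
    (C₁ C₂ : Set C) (hC₁ : C₁ ∈ irreducibleComponents C) (hC₂ : C₂ ∈ irreducibleComponents C)
    (hv₁ : Set.MapsTo (g ≫ F.inclusion) C₁ (F.cellStratum {fun i => (v₁ i : ℝ)}))
    (hv₂ : Set.MapsTo (g ≫ F.inclusion) C₂ (F.cellStratum {fun i => (v₂ i : ℝ)}))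
    (p : Spec (.of ℂ) ⟶ C) (hp : p ≫ str = 𝟙 (Spec (.of ℂ)))
    (hp₁ : p default ∈ C₁) (hp₂ : p default ∈ C₂)
    (hpE : (g ≫ F.inclusion) (p default) ∈
      F.cellStratum (segment ℝ (fun i => (v₁ i : ℝ)) (fun i => (v₂ i : ℝ)))) :
    ∃ w e : ℕ, 0 < w ∧ 0 < e ∧
      interMult (g ≫ F.inclusion) C₁
        (F.cellStratum (segment ℝ (fun i => (v₁ i : ℝ)) (fun i => (v₂ i : ℝ)))) (p default) = w ∧
      interMult (g ≫ F.inclusion) C₂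
        (F.cellStratum (segment ℝ (fun i => (v₁ i : ℝ)) (fun i => (v₂ i : ℝ)))) (p default) = w ∧
      (∀ e' : ℕ, HasNodeInteger L ρ p e' ↔ e' = e) ∧
      w * e = Int.gcd (v₂ 0 - v₁ 0) (v₂ 1 - v₁ 1) := by
  have hl := segLength_pos hv
  let σ : F.Cone := ⟨_, hE.2.2⟩
  have hσ : σ.1 = DegenerationFan.coneOver (seg v₁ v₂) := rfl
  have hσ' : σ.1 = DegenerationFan.coneOver (seg v₂ v₁) :=
    congrArg DegenerationFan.coneOver (segment_symm ℝ _ _)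
  have hrank := finrank_span_coneOver_seg hv
  -- `s₁` is positive at `v₁` and zero at `v₂`, `s₂` conversely; so `t₂` is the equation of `D_E` on
  -- `C₁`, and `t₁` on `C₂`.
  obtain ⟨s₁, s₂, h₁₁, h₁₂, h₂₁, h₂₂, hadd⟩ := exists_dotProduct_eq (v₁ := v₁) (v₂ := v₂)
  let t₁ : dualMonoid σ.1 := ⟨s₁, mem_dualMonoid_seg.mpr ⟨by omega, by omega⟩⟩
  let t₂ : dualMonoid σ.1 := ⟨s₂, mem_dualMonoid_seg.mpr ⟨by omega, by omega⟩⟩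
  obtain ⟨z₀, hz₀, hz⟩ := F.exists_mem_closedOrbit_of_finrank σ hrank hpE
    fun τ hτ h => htrans.1 τ hτ h _
  have hx : (g ≫ F.inclusion) (p default) ∈ F.chart σ ''ᵁ ⊤ := ⟨z₀, trivial, hz⟩
  obtain ⟨prime₁, pos₁, not₁, eq₁⟩ := F.stalkIdeal_component hv hσ hC₁ hv₁
    (htrans.2 σ.1 σ.2 hrank C₁ hC₁) hp₁ hz₀ hz hx (s := t₂) h₂₁ h₂₂
  obtain ⟨prime₂, pos₂, not₂, eq₂⟩ := F.stalkIdeal_component hv.symm hσ' hC₂ hv₂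
    (htrans.2 σ.1 σ.2 hrank C₂ hC₂) hp₂ hz₀ hz hx (s := t₁) h₁₂ (by rw [segLength_comm]; exact h₁₁)
  obtain ⟨V, v, k, μ, hk, hα, hμ⟩ := gl.exists_pullback i p (F.chartEtale σ) hz
  have hpt : (V.hom ≫ g ≫ F.inclusion) v.pt = (g ≫ F.inclusion) (p default) :=
    congrArg (g ≫ F.inclusion) v.hom_pt
  have hx' : (V.hom ≫ g ≫ F.inclusion) v.pt ∈ F.chart σ ''ᵁ ⊤ := hpt ▸ hx
  have hpull : ∀ m : dualMonoid σ.1,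
      v.pull rfl (chartGerm (F.chart σ) (g ≫ F.inclusion) hx (zmon m)) =
        V.left.presheaf.germ ⊤ v.pt trivial (L.α V (μ (F.chartSec σ m))) := by
    intro m
    rw [hα, F.α_chartSec]
    exact (v.pull_stalkMap rfl (g ≫ F.inclusion) _ hx hx' _).trans
      (stalkMap_germ_chartFn_comp (F.chart σ) hk v.pt hx' (zmon m))
  -- The toric relation between the two monomials and `t`, carried to the curve: this is where `l`
  -- enters the log structure.
  have hmul : μ (F.chartSec σ t₁) * μ (F.chartSec σ t₂) = L.res (toEtaleTop V) ρ ^ segLength v₁ v₂ := by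
    rw [← map_mul, F.chartSec_mul_chartSec hadd, map_pow, hμ, hgl]
  obtain ⟨w, e, hw, he, l₁, l₂, huniq, hwe⟩ := hC.exists_node hp rfl
    (pos₁ t₁ (by change 0 < s₁ ⬝ᵥ _; omega)) not₂ not₁ (pos₂ t₂ (by change 0 < s₂ ⬝ᵥ _; omega)) v _ _
    (hpull t₁) (hpull t₂) hl hmul
  refine ⟨w, e, hw, he, ?_, ?_, huniq, hwe⟩
  · exact (congrArg (fun J => Module.length _ (_ ⧸ J)) eq₁).trans l₁
  · exact (congrArg (fun J => Module.length _ (_ ⧸ J)) eq₂).trans l₂
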